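/- Let $K$ be a finite-dimensional Lie group with Lie algebra $\mathfrak k$, let $H\subset K$ be a closed subgroup with Lie algebra $\mathfrak h$, and let $K/H$ carry its usual smooth structure (for which the projection $\pi:K\to K/H$ is a submersion), with $n=\dim K/H\ge 2$. Let $o=\pi(e)$; the differential $d\pi_e$ induces $\mathfrak k/\mathfrak h\cong T_o(K/H)$. **$GN$-structures.** On $\mathbb R^n$ with standard basis $k,l,m_1,\dots,m_{n-2}$ and dual basis $\omega^1,\dots,\omega^n$, let $\eta=\omega^1\otimes\omega^2+\omega^2\otimes\omega^1+\sum_{i\ge3}\omega^i\otimes\omega^i$, and let $k^\perp=\{w:\eta(k,w)=0\}$. The group $GN\subset GL(n,\mathbb R)$ consists of the invertible linear maps $f$ with $f(k)\in\mathbb Rk$, with $\eta(f(w),f(\tilde w))=\eta(w,\tilde w)$ for all $w,\tilde w\in k^\perp$, and with $\eta(f(k),f(z))=\eta(k,z)$ for all $z\in\mathbb R^n$. A $GN$-structure $P$ on an $n$-manifold $M$ is a smooth reduction of the frame bundle of $M$ to $GN$; its elements over $x$ are certain linear isomorphisms $u:\mathbb R^n\to T_xM$. It determines the distributions $\lambda_x=u(\mathbb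 Rk)\subset\Lambda_x=u(k^\perp)$, an inner product $g^\perp_x$ on $\Lambda_x/\lambda_x$ and a functional $f_x:\lambda_x\otimes T_xM/\Lambda_x\to\mathbb R$, both induced by $(w,w')\mapsto\eta(u^{-1}w,u^{-1}w')$; none of these depends on the choice of $u\in P_x$. A diffeomorphism is an automorphism of $P$ if its differential maps $P$ into $P$; a (local) vector field is an infinitesimal automorphism if its (local) flow consists of (local) automorphisms. $P$ is a Kundt structure if $\Lambda$ is integrable (brackets of local sections of $\Lambda$ are sections of $\Lambda$) and around each point there is a nowhere vanishing local vector field with values in $\lambda$ that is an infinitesimal automorphism of $P$. A $GN$-structure on $K/H$ is $K$-invariant if the left translation $L_g$ of $K/H$ is an automorphism of it for every $g\in K$. **Quadruples.** An $Ad(H)$-invariant quadruple is $(\mathfrak a,\mathfrak b,(\cdot,\cdot),\beta)$ where $\mathfrak h\subset\mathfrak a\subset\mathfrak b\subset\mathfrak k$ are linear subspaces, $\mathfrak a$ and $\mathfrak b$ are $Ad(H)$-invariant, $\mathfrak h$ has codimension one in $\mathfrak a$ and $\mathfrak b$ has codimension one in $\mathfrak k$; $(\cdot,\cdot)$ is an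 $Ad(H)$-invariant positive definite inner product on $\mathfrak b/\mathfrak a$; and $\beta:\mathfrak a/\mathfrak h\otimes\mathfrak k/\mathfrak b\to\mathbb R$ is a non-zero $Ad(H)$-invariant linear functional. **Theorem.** Sending $P$ to $\mathfrak a=(d\pi_e)^{-1}(\lambda_o)$, $\mathfrak b=(d\pi_e)^{-1}(\Lambda_o)$, and to the inner product $(\cdot,\cdot)$ on $\mathfrak b/\mathfrak a\cong\Lambda_o/\lambda_o$ and the functional $\beta$ on $\mathfrak a/\mathfrak h\otimes\mathfrak k/\mathfrak b\cong\lambda_o\otimes T_o(K/H)/\Lambda_o$ given by $g^\perp_o$ and $f_o$, defines a bijection from the set of $K$-invariant $GN$-structures on $K/H$ onto the set of $Ad(H)$-invariant quadruples. Under this bijection, a $K$-invariant $GN$-structure is a Kundt structure if and only if its quadruple satisfies: 1. $\mathfrak b$ is a Lie subalgebra of $\mathfrak k$; 2. for every $a\in\mathfrak a$, the bracket $[a,-]$ induces a well-defined endomorphism of $\mathfrak b/\mathfrak a$ that is skew-adjoint with respect to $(\cdot,\cdot)$. -/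

import Mathlib

open scoped Manifold ContDiff Topology TensorProduct

noncomputable section

namespace KundtHom

/-! ### `G`-structures -/

section GStructures

variable {V : Type*} [NormedAddCommGroup V] [NormedSpace ℝ V]

/-- A `G`-structure on a manifold `M` modelled on `V`, for a group `G` of linear automorphisms of
`V`: a reduction of the bundle of frames `u : V ≃ T_x M` to `G`. The fibres are orbits of the right
action `u ↦ u ∘ a` of `G`, and there are smooth local sections through every fibre (in particular
no fibre is empty). -/
@[ext]
structure GStructure (G : Subgroup (V ≃L[ℝ] V)) (M : Type*) [TopologicalSpace M]
    [ChartedSpace V M] [IsManifold 𝓘(ℝ, V) ∞ M] where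
  /-- The fibre of the structure over a point, a set of frames. -/
  frames : ∀ x : M, Set (V ≃L[ℝ] TangentSpace 𝓘(ℝ, V) x)
  comp_mem : ∀ (x : M), ∀ u ∈ frames x, ∀ a ∈ G, a.trans u ∈ frames x
  exists_eq_comp : ∀ (x : M), ∀ u ∈ frames x, ∀ u' ∈ frames x, ∃ a ∈ G, u' = a.trans u
  exists_section : ∀ x : M, ∃ U : Set M, IsOpen U ∧ x ∈ U ∧
    ∃ s : ∀ y : M, V ≃L[ℝ] TangentSpace 𝓘(ℝ, V) y,
      (∀ y ∈ U, s y ∈ frames y) ∧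
      ∀ v : V, ContMDiffOn 𝓘(ℝ, V) 𝓘(ℝ, V).tangent ∞
        (fun y : M => (⟨y, s y v⟩ : TangentBundle 𝓘(ℝ, V) M)) U

variable {G : Subgroup (V ≃L[ℝ] V)} {M : Type*} [TopologicalSpace M] [ChartedSpace V M]
  [IsManifold 𝓘(ℝ, V) ∞ M]

/-- The derivative of `φ` at `x` maps the frames of `P` over `x` to frames of `P` over `φ x`. -/
def GStructure.PreservedAt (P : GStructure G M) (φ : M → M) (x : M) : Prop :=
  ∀ u ∈ P.frames x, ∃ u' ∈ P.frames (φ x),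
    ∀ v : V, u' v = mfderiv 𝓘(ℝ, V) 𝓘(ℝ, V) φ x (u v)

/-- The (smooth) vector field `X` on the open set `U` is an infinitesimal automorphism of `P` on
`U`: its local flow `φ` (which exists around every point of `U`, and is unique) consists of local
automorphisms of `P`. -/
def GStructure.IsInfinitesimalAutOn (P : GStructure G M)
    (X : ∀ y : M, TangentSpace 𝓘(ℝ, V) y) (U : Set M) : Prop :=
  ∀ p ∈ U, ∃ W : Set M, IsOpen W ∧ p ∈ W ∧ ∃ ε : ℝ, 0 < ε ∧ ∃ φ : ℝ → M → M,
    ContMDiffOn (𝓘(ℝ, ℝ).prod 𝓘(ℝ, V)) 𝓘(ℝ, V) ∞ (fun q : ℝ × M => φ q.1 q.2)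
      (Set.Ioo (-ε) ε ×ˢ W) ∧
    ∀ x ∈ W, φ 0 x = x ∧
      IsMIntegralCurveOn (I := 𝓘(ℝ, V)) (fun t => φ t x) X (Set.Ioo (-ε) ε) ∧
      ∀ t ∈ Set.Ioo (-ε) ε, φ t x ∈ U ∧ P.PreservedAt (φ t) x

/-- Integrability of a distribution `D`: the Lie bracket of any two smooth local sections of `D`
is again a section of `D`. -/
def IsIntegrableDistribution (D : ∀ x : M, Set (TangentSpace 𝓘(ℝ, V) x)) : Prop :=
  ∀ (U : Set M) (X Y : ∀ y : M, TangentSpace 𝓘(ℝ, V) y), IsOpen U →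
    ContMDiffOn 𝓘(ℝ, V) 𝓘(ℝ, V).tangent ∞
      (fun y : M => (⟨y, X y⟩ : TangentBundle 𝓘(ℝ, V) M)) U →
    ContMDiffOn 𝓘(ℝ, V) 𝓘(ℝ, V).tangent ∞
      (fun y : M => (⟨y, Y y⟩ : TangentBundle 𝓘(ℝ, V) M)) U →
    (∀ y ∈ U, X y ∈ D y) → (∀ y ∈ U, Y y ∈ D y) →
    ∀ y ∈ U, VectorField.mlieBracket 𝓘(ℝ, V) X Y y ∈ D y

end GStructures

/-! ### The group `GN` and `GN`-structures -/

/-- `ℝⁿ` with `n = m + 2 ≥ 2`. -/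
abbrev Mink (m : ℕ) : Type := EuclideanSpace ℝ (Fin (m + 2))

section GN

variable {m : ℕ}

/-- The first standard basis vector. -/
def kvec (m : ℕ) : Mink m := EuclideanSpace.single 0 1

/-- The Minkowski inner product `η = ω¹⊗ω² + ω²⊗ω¹ + ω³⊗ω³ + ⋯ + ωⁿ⊗ωⁿ`. -/
def eta (v w : Mink m) : ℝ :=
  v 0 * w 1 + v 1 * w 0 + ∑ i : Fin m, v i.succ.succ * w i.succ.succ

theorem eta_smul_left (c : ℝ) (v w : Mink m) : eta (c • v) w = c * eta v w := by
  simp only [eta, PiLp.smul_apply, smul_eq_mul, mul_add, Finset.mul_sum, mul_assoc]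

theorem kvec_ne_zero : kvec m ≠ 0 := by
  simp [kvec]

/-- The defining conditions of the group `GN`. -/
def IsGN (f : Mink m ≃L[ℝ] Mink m) : Prop :=
  f (kvec m) ∈ Submodule.span ℝ {kvec m} ∧
  (∀ w w' : Mink m, eta (kvec m) w = 0 → eta (kvec m) w' = 0 → eta (f w) (f w') = eta w w') ∧
  ∀ z : Mink m, eta (f (kvec m)) (f z) = eta (kvec m) z

theorem IsGN.exists_smul {f : Mink m ≃L[ℝ] Mink m} (hf : IsGN f) :
    ∃ c : ℝ, c ≠ 0 ∧ f (kvec m) = c • kvec m := by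
  obtain ⟨c, hc⟩ := Submodule.mem_span_singleton.1 hf.1
  refine ⟨c, ?_, hc.symm⟩
  rintro rfl
  rw [zero_smul] at hc
  exact kvec_ne_zero (m := m) ((map_eq_zero_iff f f.injective).1 hc.symm)

theorem IsGN.perp {f : Mink m ≃L[ℝ] Mink m} (hf : IsGN f) (w : Mink m) :
    eta (kvec m) (f w) = 0 ↔ eta (kvec m) w = 0 := by
  obtain ⟨c, hc, hk⟩ := hf.exists_smul
  have h := hf.2.2 w
  rw [hk, eta_smul_left] at h
  rw [← h]
  simp [hc]

/-- The group `GN`. -/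
def GN (m : ℕ) : Subgroup (Mink m ≃L[ℝ] Mink m) where
  carrier := {f | IsGN f}
  one_mem' := ⟨Submodule.mem_span_singleton_self _, fun _ _ _ _ => rfl, fun _ => rfl⟩
  mul_mem' := by
    intro f g hf hg
    obtain ⟨c, hc, hk⟩ := hg.exists_smul
    refine ⟨?_, fun w w' hw hw' => ?_, fun z => ?_⟩
    · change f (g (kvec m)) ∈ _
      rw [hk, map_smul]
      exact Submodule.smul_mem _ _ hf.1
    · change eta (f (g w)) (f (g w')) = _
      rw [hf.2.1 _ _ ((hg.perp w).2 hw) ((hg.perp w').2 hw'), hg.2.1 _ _ hw hw']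
    · change eta (f (g (kvec m))) (f (g z)) = _
      rw [← hg.2.2 z, hk, map_smul, eta_smul_left, eta_smul_left, hf.2.2]
  inv_mem' := by
    intro f hf
    obtain ⟨c, hc, hk⟩ := hf.exists_smul
    have hfi : ∀ z, f (f⁻¹ z) = z := fun z => f.apply_symm_apply z
    have hki : f⁻¹ (kvec m) = c⁻¹ • kvec m := by
      apply f.injective
      rw [hfi, map_smul, hk, smul_smul, inv_mul_cancel₀ hc, one_smul]
    have hp : ∀ w, eta (kvec m) w = 0 → eta (kvec m) (f⁻¹ w) = 0 := fun w hw => by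
      rw [← hf.perp, hfi]; exact hw
    refine ⟨?_, fun w w' hw hw' => ?_, fun z => ?_⟩
    · rw [hki]
      exact Submodule.smul_mem _ _ (Submodule.mem_span_singleton_self _)
    · have h := hf.2.1 _ _ (hp w hw) (hp w' hw')
      rw [hfi, hfi] at h
      exact h.symm
    · have h := hf.2.2 (f⁻¹ z)
      rw [hfi, hk, eta_smul_left] at h
      rw [hki, eta_smul_left, ← h, ← mul_assoc, inv_mul_cancel₀ hc, one_mul]

variable {M : Type*} [TopologicalSpace M] [ChartedSpace (Mink m) M]
  [IsManifold 𝓘(ℝ, Mink m) ∞ M]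

/-- The null line `λ_x = u(ℝk)`, `u ∈ P_x`. -/
def nullLine (P : GStructure (GN m) M) (x : M) : Set (TangentSpace 𝓘(ℝ, Mink m) x) :=
  {w | ∃ u ∈ P.frames x, ∃ v ∈ Submodule.span ℝ {kvec m}, u v = w}

/-- The hyperplane `Λ_x = u(k^⊥)`, `u ∈ P_x`. -/
def nullPerp (P : GStructure (GN m) M) (x : M) : Set (TangentSpace 𝓘(ℝ, Mink m) x) :=
  {w | ∃ u ∈ P.frames x, ∃ v : Mink m, eta (kvec m) v = 0 ∧ u v = w}

/-- Kundt structures: `Λ` is integrable, and around each point there is a (nowhere vanishing)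
smooth local section of the line distribution `λ` that is an infinitesimal automorphism. -/
def IsKundtStructure (P : GStructure (GN m) M) : Prop :=
  IsIntegrableDistribution (nullPerp P) ∧
  ∀ p : M, ∃ U : Set M, IsOpen U ∧ p ∈ U ∧ ∃ X : ∀ y : M, TangentSpace 𝓘(ℝ, Mink m) y,
    ContMDiffOn 𝓘(ℝ, Mink m) 𝓘(ℝ, Mink m).tangent ∞
      (fun y : M => (⟨y, X y⟩ : TangentBundle 𝓘(ℝ, Mink m) M)) U ∧
    (∀ y ∈ U, X y ∈ nullLine P y ∧ X y ≠ 0) ∧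
    P.IsInfinitesimalAutOn X U

end GN

/-! ### Homogeneous spaces -/

section Homogeneous

variable {E : Type*} [NormedAddCommGroup E] [NormedSpace ℝ E]
  {K : Type*} [TopologicalSpace K] [ChartedSpace E K] [Group K]

/-- The Lie algebra of `K`, i.e. its tangent space at the identity. -/
abbrev LieAlg (E : Type*) [NormedAddCommGroup E] [NormedSpace ℝ E]
    (K : Type*) [TopologicalSpace K] [ChartedSpace E K] [Group K] : Type _ :=
  GroupLieAlgebra 𝓘(ℝ, E) K

/-- The adjoint action `Ad(h)` on the Lie algebra, the derivative of `x ↦ h x h⁻¹` at the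
identity. -/
def Ad (h : K) : LieAlg E K →L[ℝ] LieAlg E K :=
  mfderiv 𝓘(ℝ, E) 𝓘(ℝ, E) (fun x : K => h * x * h⁻¹) 1

/-- The Lie algebra of the subgroup `H`: the velocities at `0` of the curves in `H` through the
identity. -/
def subgroupLieAlg [LieGroup 𝓘(ℝ, E) ∞ K] (H : Subgroup K) : Submodule ℝ (LieAlg E K) where
  carrier := {A | ∃ γ : ℝ → K, γ 0 = 1 ∧ (∀ t, γ t ∈ H) ∧
    HasMFDerivAt 𝓘(ℝ, ℝ) 𝓘(ℝ, E) γ 0 ((1 : ℝ →L[ℝ] ℝ).smulRight (A : E))}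
  zero_mem' := by
    refine ⟨fun _ => 1, rfl, fun _ => H.one_mem, ?_⟩
    refine (hasMFDerivAt_const (I := 𝓘(ℝ, ℝ)) (I' := 𝓘(ℝ, E)) (1 : K) (0 : ℝ)).congr_mfderiv ?_
    exact ((1 : ℝ →L[ℝ] ℝ).smulRight_zero (M₂ := E)).symm
  add_mem' := by
    rintro A B ⟨γ, hγ0, hγH, hγ⟩ ⟨δ, hδ0, hδH, hδ⟩
    refine ⟨fun t => γ t * δ t, by simp [hγ0, hδ0], fun t => H.mul_mem (hγH t) (hδH t), ?_⟩
    have hm : MDifferentiableAt (𝓘(ℝ, E).prod 𝓘(ℝ, E)) 𝓘(ℝ, E)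
        (fun p : K × K => p.1 * p.2) (γ 0, δ 0) :=
      (contMDiff_mul 𝓘(ℝ, E) ∞).mdifferentiableAt (by simp)
    refine (hm.hasMFDerivAt.comp (0 : ℝ) (hγ.prodMk hδ)).congr_mfderiv ?_
    refine ContinuousLinearMap.ext fun t => ?_
    have key : ∀ v : TangentSpace (𝓘(ℝ, E).prod 𝓘(ℝ, E)) ((γ 0, δ 0) : K × K),
        mfderiv (𝓘(ℝ, E).prod 𝓘(ℝ, E)) 𝓘(ℝ, E) (fun p : K × K => p.1 * p.2) (γ 0, δ 0) v
          = (v.1 + v.2 : E) := by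
      intro v
      rw [mfderiv_prod_eq_add_apply hm]
      have h1 : (fun z : K => z * δ 0) = id := by ext z; simp [hδ0]
      have h2 : (fun z : K => γ 0 * z) = id := by ext z; simp [hγ0]
      have aux : ∀ (f : K → K) (x : K), f = id →
          ∀ w : E, (mfderiv 𝓘(ℝ, E) 𝓘(ℝ, E) f x w : E) = w := by
        rintro f x rfl w
        rw [mfderiv_id]
        rfl
      exact congrArg₂ (fun a b : E => a + b) (aux _ (γ 0) h1 v.1) (aux _ (δ 0) h2 v.2)
    refine (key _).trans ?_
    exact (smul_add (M := ℝ) (A := E) t A B).symm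
  smul_mem' := by
    rintro c A ⟨γ, hγ0, hγH, hγ⟩
    refine ⟨fun t => γ (c * t), by simp [hγ0], fun t => hγH _, ?_⟩
    have hs : HasMFDerivAt 𝓘(ℝ, ℝ) 𝓘(ℝ, ℝ) (fun t : ℝ => c * t) 0
        (c • (1 : ℝ →L[ℝ] ℝ)) := by
      apply HasFDerivAt.hasMFDerivAt
      exact (hasFDerivAt_id (𝕜 := ℝ) (0 : ℝ)).const_mul c
    have hγ' : HasMFDerivAt 𝓘(ℝ, ℝ) 𝓘(ℝ, E) γ (c * 0)
        ((1 : ℝ →L[ℝ] ℝ).smulRight (A : E)) := by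
      rw [mul_zero]; exact hγ
    refine (HasMFDerivAt.comp (0 : ℝ) hγ' hs).congr_mfderiv ?_
    refine ContinuousLinearMap.ext fun t => ?_
    have h3 : ∀ (r : ℝ) (v : E), (c * r) • v = r • c • v := fun r v => by
      rw [smul_smul, mul_comm]
    exact h3 t A

/-- The `Ad(H)`-invariant quadruples `(𝔞, 𝔟, (·,·), β)` for `H ≤ K`. -/
@[ext]
structure InvariantQuadruple (E : Type*) [NormedAddCommGroup E] [NormedSpace ℝ E]
    {K : Type*} [TopologicalSpace K] [ChartedSpace E K] [Group K] [LieGroup 𝓘(ℝ, E) ∞ K]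
    (H : Subgroup K) where
  a : Submodule ℝ (LieAlg E K)
  b : Submodule ℝ (LieAlg E K)
  le_a : subgroupLieAlg H ≤ a
  a_le_b : a ≤ b
  /-- `𝔥` has codimension one in `𝔞`. -/
  finrank_a : Module.finrank ℝ (a ⧸ (subgroupLieAlg H).submoduleOf a) = 1
  /-- `𝔟` has codimension one in `𝔨`. -/
  finrank_b : Module.finrank ℝ (LieAlg E K ⧸ b) = 1
  Ad_mem_a : ∀ h ∈ H, ∀ A ∈ a, Ad h A ∈ a
  Ad_mem_b : ∀ h ∈ H, ∀ B ∈ b, Ad h B ∈ b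
  /-- The inner product `(·,·)` on `𝔟/𝔞`. -/
  ip : (b ⧸ a.submoduleOf b) →ₗ[ℝ] (b ⧸ a.submoduleOf b) →ₗ[ℝ] ℝ
  ip_symm : ∀ v w, ip v w = ip w v
  ip_pos : ∀ v, v ≠ 0 → 0 < ip v v
  ip_Ad : ∀ (h : K) (hh : h ∈ H) (x y : b),
    ip (Submodule.Quotient.mk ⟨Ad h x, Ad_mem_b h hh x x.2⟩)
        (Submodule.Quotient.mk ⟨Ad h y, Ad_mem_b h hh y y.2⟩) =
      ip (Submodule.Quotient.mk x) (Submodule.Quotient.mk y)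
  /-- The functional `β` on `𝔞/𝔥 ⊗ 𝔨/𝔟`. -/
  β : ((a ⧸ (subgroupLieAlg H).submoduleOf a) ⊗[ℝ] (LieAlg E K ⧸ b)) →ₗ[ℝ] ℝ
  β_ne_zero : β ≠ 0
  β_Ad : ∀ (h : K) (hh : h ∈ H) (x : a) (z : LieAlg E K),
    β (Submodule.Quotient.mk ⟨Ad h x, Ad_mem_a h hh x x.2⟩ ⊗ₜ[ℝ] Submodule.Quotient.mk (Ad h z)) =
      β (Submodule.Quotient.mk x ⊗ₜ[ℝ] Submodule.Quotient.mk z)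

/-- The two conditions on quadruples: `𝔟` is a Lie subalgebra, and for all `A ∈ 𝔞` the bracket
`[A, -]` induces an endomorphism `D` of `𝔟/𝔞` which is skew-adjoint for `(·,·)`. -/
def InvariantQuadruple.IsKundt [LieGroup 𝓘(ℝ, E) ∞ K] {H : Subgroup K}
    (Q : InvariantQuadruple E H) : Prop :=
  (∀ x ∈ Q.b, ∀ y ∈ Q.b, ⁅x, y⁆ ∈ Q.b) ∧
  ∀ A ∈ Q.a, ∃ D : Module.End ℝ (Q.b ⧸ Q.a.submoduleOf Q.b),
    (∀ x y : Q.b, (y : LieAlg E K) = ⁅A, (x : LieAlg E K)⁆ →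
      D (Submodule.Quotient.mk x) = Submodule.Quotient.mk y) ∧
    ∀ v w, Q.ip (D v) w = - Q.ip v (D w)

variable [LieGroup 𝓘(ℝ, E) ∞ K] {H : Subgroup K} {m : ℕ} [ChartedSpace (Mink m) (K ⧸ H)]

/-- The derivative at the identity of the projection `π : K → K/H`, with values in the tangent
space at the origin. -/
def dproj (E : Type*) [NormedAddCommGroup E] [NormedSpace ℝ E]
    {K : Type*} [TopologicalSpace K] [ChartedSpace E K] [Group K]
    (H : Subgroup K) (m : ℕ) [ChartedSpace (Mink m) (K ⧸ H)] :
    LieAlg E K →L[ℝ] TangentSpace 𝓘(ℝ, Mink m) ((1 : K) : K ⧸ H) :=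
  mfderiv 𝓘(ℝ, E) 𝓘(ℝ, Mink m) (fun x : K => (x : K ⧸ H)) 1

variable [IsManifold 𝓘(ℝ, Mink m) ∞ (K ⧸ H)]

/-- `K`-invariance of a `GN`-structure on `K/H`: all left translations are automorphisms. -/
def IsInvariantStructure (P : GStructure (GN m) (K ⧸ H)) : Prop :=
  ∀ (g : K) (x : K ⧸ H), P.PreservedAt (fun y : K ⧸ H => g • y) x

/-- The quadruple `Q` is the one read off from `P` at the origin `o`, via `dπ : 𝔨 → T_o(K/H)`:
`𝔞` and `𝔟` are the preimages of `λ_o` and `Λ_o`, and `(·,·)` and `β` correspond to the inner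
product on `Λ_o/λ_o` and the functional on `λ_o ⊗ T_o/Λ_o` that `η` induces through any frame
of `P` at `o`. -/
structure Corresponds (P : GStructure (GN m) (K ⧸ H)) (Q : InvariantQuadruple E H) : Prop where
  a_iff : ∀ A : LieAlg E K, A ∈ Q.a ↔ dproj E H m A ∈ nullLine P ((1 : K) : K ⧸ H)
  b_iff : ∀ B : LieAlg E K, B ∈ Q.b ↔ dproj E H m B ∈ nullPerp P ((1 : K) : K ⧸ H)
  ip_eq : ∀ u ∈ P.frames ((1 : K) : K ⧸ H), ∀ x y : Q.b,
    Q.ip (Submodule.Quotient.mk x) (Submodule.Quotient.mk y) =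
      eta (u.symm (dproj E H m x)) (u.symm (dproj E H m y))
  β_eq : ∀ u ∈ P.frames ((1 : K) : K ⧸ H), ∀ (x : Q.a) (z : LieAlg E K),
    Q.β (Submodule.Quotient.mk x ⊗ₜ[ℝ] Submodule.Quotient.mk z) =
      eta (u.symm (dproj E H m x)) (u.symm (dproj E H m z))

end Homogeneous

end KundtHom

end

/-! An invariant structure is determined by its frames at the origin `o`, because translations carry
them to every point. A frame `u` at `o` gives a surjection `B = u⁻¹ ∘ dπ : 𝔨 → ℝⁿ` with kernel `𝔥`
(`md_mk_eq_zero_iff`), and `k`, `k^⊥` and `η` pulled back along `B` are a quadruple. Another frame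
at `o` composes `B` with an element of `GN`, which does not change these data. Conversely, linear
algebra produces a `B` for every quadruple (`exists_adapted_map`), and two such maps differ by an
element of `GN` (`Adapted.exists_GN`). The isotropy action of `h ∈ H` on `T_o` corresponds to `Ad h`
on `𝔨`, so `Ad(H)`-invariance of the quadruple is what makes the translated frames at `gH`
independent of the representative `g`, up to `GN`.

For the Kundt condition everything is lifted to `K`. A vector field `X` on `K/H` becomes the
`ℝⁿ`-valued function `k ↦ u₀⁻¹ (dL_{k⁻¹} X(kH))` on `K`, and `cof_mlieBracket` computes a Lie
bracket as a difference of derivatives of such functions plus the algebraic term `B[x, y]`. If both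
fields lie in `Λ`, the derivatives stay in `k^⊥`, so integrability of `Λ` says exactly that `𝔟` is a
subalgebra.

If an infinitesimal automorphism `X` with values in `λ` is given near `o`, its flow expressed in a
translated frame is a curve in `GN` through the identity, whose derivative is minus the bracket with
`X`. Differentiating the invariance of `η` on `k^⊥` along it gives the skewness of `ad A` for the
lifts `A` of `X(o)` (`skew_of_infinitesimalAut`), and linearity in `A` extends this to all of `𝔞`.

For the converse take `A` with `B A = k`. As `𝔟` is a subalgebra, `ad A` acts on the line `𝔨/𝔟` by a
scalar `κ`. Coordinates on `K/H` are obtained by multiplying a slice on the right by a curve `q`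
with velocity `ρ A` in the left trivialization. Along `q`, the left logarithmic derivative `ξ` of
these coordinates satisfies `ξ' = -ρ [A, ξ]` up to multiples of `A`. Skewness keeps `η` on `k^⊥`
constant. The pairing of `λ` with `TM/Λ` is measured by `ρ η(k, Bξ)`, which is constant precisely
because the speed solves `ρ' = κ ρ²`; unit speed would rescale it when `κ ≠ 0`. The coordinate
translations therefore preserve the structure, and the coordinate field along `q` is the required
infinitesimal automorphism (`exists_infinitesimalAut`). -/

noncomputable section

namespace KundtHom

set_option linter.unusedSectionVars false

/-! ### Calculus on manifolds with derivatives read in the model spaces -/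

section ManifoldCalculus

variable {E : Type*} [NormedAddCommGroup E] [NormedSpace ℝ E]
  {E' : Type*} [NormedAddCommGroup E'] [NormedSpace ℝ E']
  {E'' : Type*} [NormedAddCommGroup E''] [NormedSpace ℝ E'']
  {F : Type*} [NormedAddCommGroup F] [NormedSpace ℝ F]
  {M : Type*} [TopologicalSpace M] [ChartedSpace E M]
  {M' : Type*} [TopologicalSpace M'] [ChartedSpace E' M']
  {M'' : Type*} [TopologicalSpace M''] [ChartedSpace E'' M'']
  {HN : Type*} [TopologicalSpace HN] {J : ModelWithCorners ℝ F HN}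
  {N : Type*} [TopologicalSpace N] [ChartedSpace HN N]

/-- The derivative of a map between boundaryless manifolds, as a map between the model spaces. -/
def md (E E' : Type*) [NormedAddCommGroup E] [NormedSpace ℝ E] [NormedAddCommGroup E']
    [NormedSpace ℝ E'] {M M' : Type*} [TopologicalSpace M] [ChartedSpace E M]
    [TopologicalSpace M'] [ChartedSpace E' M'] (f : M → M') (x : M) : E →L[ℝ] E' :=
  mfderiv 𝓘(ℝ, E) 𝓘(ℝ, E') f x

theorem md_comp {g : M' → M''} {f : M → M'} (x : M)
    (hg : MDifferentiableAt 𝓘(ℝ, E') 𝓘(ℝ, E'') g (f x))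
    (hf : MDifferentiableAt 𝓘(ℝ, E) 𝓘(ℝ, E') f x) :
    md E E'' (fun y => g (f y)) x = (md E' E'' g (f x)).comp (md E E' f x) :=
  mfderiv_comp x hg hf

theorem md_comp_apply {g : M' → M''} {f : M → M'} (x : M)
    (hg : MDifferentiableAt 𝓘(ℝ, E') 𝓘(ℝ, E'') g (f x))
    (hf : MDifferentiableAt 𝓘(ℝ, E) 𝓘(ℝ, E') f x) (v : E) :
    md E E'' (fun y => g (f y)) x v = md E' E'' g (f x) (md E E' f x v) := by
  rw [md_comp x hg hf]; rfl

theorem md_congr {f g : M → M'} {x : M} (h : f =ᶠ[𝓝 x] g) : md E E' f x = md E E' g x :=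
  h.mfderiv_eq

theorem md_id (x : M) : md E E (fun y : M => y) x = ContinuousLinearMap.id ℝ E :=
  mfderiv_id

theorem md_const (c : M') (x : M) : md E E' (fun _ : M => c) x = 0 :=
  mfderiv_const

theorem md_eq_fderiv (f : E → E') (x : E) : md E E' f x = fderiv ℝ f x :=
  mfderiv_eq_fderiv

theorem md_chart_self [IsManifold 𝓘(ℝ, E) 1 M] (x : M) :
    md E E (extChartAt 𝓘(ℝ, E) x) x = ContinuousLinearMap.id ℝ E :=
  mfderiv_extChartAt_self

theorem md_eq_fderiv_chart {f : M → E'} {x : M} (hf : MDifferentiableAt 𝓘(ℝ, E) 𝓘(ℝ, E') f x) :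
    md E E' f x = fderiv ℝ (f ∘ (extChartAt 𝓘(ℝ, E) x).symm) (extChartAt 𝓘(ℝ, E) x x) := by
  unfold md
  rw [hf.mfderiv]
  simp [writtenInExtChartAt]
  rfl

theorem mdifferentiableAt_of_comp_chart_symm [IsManifold 𝓘(ℝ, E) 1 M] {f : M → E'} {x : M}
    (hf : DifferentiableAt ℝ (f ∘ (extChartAt 𝓘(ℝ, E) x).symm) (extChartAt 𝓘(ℝ, E) x x)) :
    MDifferentiableAt 𝓘(ℝ, E) 𝓘(ℝ, E') f x := by
  rw [← mdifferentiableWithinAt_univ]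
  apply DifferentiableWithinAt.mdifferentiableWithinAt_of_comp_extChartAt_symm
  simpa [differentiableWithinAt_univ] using hf

theorem differentiableAt_comp_chart_symm {f : M → E'} {x : M}
    (hf : MDifferentiableAt 𝓘(ℝ, E) 𝓘(ℝ, E') f x) :
    DifferentiableAt ℝ (f ∘ (extChartAt 𝓘(ℝ, E) x).symm) (extChartAt 𝓘(ℝ, E) x x) := by
  rw [← mdifferentiableWithinAt_univ] at hf
  simpa [differentiableWithinAt_univ] using hf.differentiableWithinAt_comp_extChartAt_symm

/-- The trivialization of the tangent bundle at a point is the derivative of the chart there. This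
turns smoothness of a field into smoothness of a vector-valued function. -/
theorem contMDiffAt_tangentBundle_iff [IsManifold 𝓘(ℝ, E) 1 M] {n : WithTop ℕ∞}
    {f : N → M} {z : N → E} {q : N} :
    ContMDiffAt J 𝓘(ℝ, E).tangent n (fun p => (⟨f p, z p⟩ : TangentBundle 𝓘(ℝ, E) M)) q ↔
      ContMDiffAt J 𝓘(ℝ, E) n f q ∧
      ContMDiffAt J 𝓘(ℝ, E) n (fun p => md E E (extChartAt 𝓘(ℝ, E) (f q)) (f p) (z p)) q := by
  rw [Bundle.contMDiffAt_totalSpace]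
  refine and_congr_right fun hf => ?_
  refine Filter.EventuallyEq.contMDiffAt_iff ?_
  filter_upwards [hf.continuousAt.preimage_mem_nhds
    ((chartAt E (f q)).open_source.mem_nhds (mem_chart_source E (f q)))] with p hp
  have h := TangentBundle.continuousLinearMapAt_trivializationAt (I := 𝓘(ℝ, E))
    (x₀ := f q) (x := f p) hp
  have h2 := congrArg (fun L => (L (z p) : E)) h
  refine Eq.trans ?_ h2
  have hm : f p ∈ (trivializationAt E (TangentSpace 𝓘(ℝ, E)) (f q)).baseSet := by simpa using hp
  exact (congrFun (Bundle.Trivialization.coe_linearMapAt_of_mem (R := ℝ) _ hm)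
    (show TangentSpace 𝓘(ℝ, E) (f p) from z p)).symm

theorem mdifferentiableAt_tangentBundle_iff [IsManifold 𝓘(ℝ, E) 1 M]
    {f : N → M} {z : N → E} {q : N} :
    MDifferentiableAt J 𝓘(ℝ, E).tangent (fun p => (⟨f p, z p⟩ : TangentBundle 𝓘(ℝ, E) M)) q ↔
      MDifferentiableAt J 𝓘(ℝ, E) f q ∧
      MDifferentiableAt J 𝓘(ℝ, E)
        (fun p => md E E (extChartAt 𝓘(ℝ, E) (f q)) (f p) (z p)) q := by
  rw [mdifferentiableAt_totalSpace]
  refine and_congr_right fun hf => ?_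
  refine Filter.EventuallyEq.mdifferentiableAt_iff ?_
  filter_upwards [hf.continuousAt.preimage_mem_nhds
    ((chartAt E (f q)).open_source.mem_nhds (mem_chart_source E (f q)))] with p hp
  have h := TangentBundle.continuousLinearMapAt_trivializationAt (I := 𝓘(ℝ, E))
    (x₀ := f q) (x := f p) hp
  have h2 := congrArg (fun L => (L (z p) : E)) h
  refine Eq.trans ?_ h2
  have hm : f p ∈ (trivializationAt E (TangentSpace 𝓘(ℝ, E)) (f q)).baseSet := by simpa using hp
  exact (congrFun (Bundle.Trivialization.coe_linearMapAt_of_mem (R := ℝ) _ hm)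
    (show TangentSpace 𝓘(ℝ, E) (f p) from z p)).symm

theorem contMDiffAt_tangentBundle_const_iff [IsManifold 𝓘(ℝ, E) 1 M] {n : WithTop ℕ∞}
    {x : M} {z : N → E} {q : N} :
    ContMDiffAt J 𝓘(ℝ, E).tangent n (fun p => (⟨x, z p⟩ : TangentBundle 𝓘(ℝ, E) M)) q ↔
      ContMDiffAt J 𝓘(ℝ, E) n z q := by
  rw [contMDiffAt_tangentBundle_iff, md_chart_self]
  exact and_iff_right contMDiffAt_const

theorem tangentMap_contMDiffAt [IsManifold 𝓘(ℝ, E) ∞ M] [IsManifold 𝓘(ℝ, E') ∞ M']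
    {U : Set M} (hU : IsOpen U) {g : M → M'} (hg : ContMDiffOn 𝓘(ℝ, E) 𝓘(ℝ, E') ∞ g U)
    {f : N → M} {z : N → E} {q : N} {n : ℕ∞} (hq : f q ∈ U)
    (h : ContMDiffAt J 𝓘(ℝ, E).tangent n (fun p => (⟨f p, z p⟩ : TangentBundle 𝓘(ℝ, E) M)) q) :
    ContMDiffAt J 𝓘(ℝ, E').tangent n
      (fun p => (⟨g (f p), md E E' g (f p) (z p)⟩ : TangentBundle 𝓘(ℝ, E') M')) q := by
  have h1 := hg.contMDiffOn_tangentMapWithin (m := n) (by exact_mod_cast le_top)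
    hU.uniqueMDiffOn
  have hopen : IsOpen (Bundle.TotalSpace.proj ⁻¹' U : Set (TangentBundle 𝓘(ℝ, E) M)) :=
    hU.preimage (FiberBundle.continuous_proj E (TangentSpace 𝓘(ℝ, E)))
  have h2 := (h1.contMDiffAt (x := (⟨f q, z q⟩ : TangentBundle 𝓘(ℝ, E) M))
    (hopen.mem_nhds hq)).comp q h
  refine h2.congr_of_eventuallyEq ?_
  have hf : ContinuousAt f q := (contMDiffAt_tangentBundle_iff.1 h).1.continuousAt
  filter_upwards [hf.preimage_mem_nhds (hU.mem_nhds hq)] with p hp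
  simp only [Function.comp_apply, tangentMapWithin, md]
  rw [mfderivWithin_of_isOpen hU hp]
  rfl

/-- A vector field read in the chart at `x`. -/
def chartPull (x : M) (Z : ∀ y : M, TangentSpace 𝓘(ℝ, E) y) : E → E :=
  VectorField.mpullbackWithin 𝓘(ℝ, E) 𝓘(ℝ, E) (extChartAt 𝓘(ℝ, E) x).symm Z
    (Set.range 𝓘(ℝ, E))

theorem chartPull_apply_self [IsManifold 𝓘(ℝ, E) 1 M] (x : M)
    (Z : ∀ y : M, TangentSpace 𝓘(ℝ, E) y) :
    chartPull x Z (extChartAt 𝓘(ℝ, E) x x) = Z x := by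
  have h := mfderivWithin_extChartAt_symm_inverse_apply (I := 𝓘(ℝ, E)) (x := x) (Z x)
  refine Eq.trans ?_ h
  unfold chartPull
  rw [VectorField.mpullbackWithin_apply, extChartAt_to_inv]

theorem differentiableAt_chartPull [CompleteSpace E] [IsManifold 𝓘(ℝ, E) 2 M] {x : M}
    {Z : ∀ y : M, TangentSpace 𝓘(ℝ, E) y}
    (hZ : MDifferentiableAt 𝓘(ℝ, E) 𝓘(ℝ, E).tangent
      (fun y => (⟨y, Z y⟩ : TangentBundle 𝓘(ℝ, E) M)) x) :
    DifferentiableAt ℝ (chartPull x Z) (extChartAt 𝓘(ℝ, E) x x) := by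
  rw [← mdifferentiableWithinAt_univ] at hZ
  have h := hZ.differentiableWithinAt_mpullbackWithin_vectorField
  have e : ((extChartAt 𝓘(ℝ, E) x).symm ⁻¹' Set.univ ∩ Set.range 𝓘(ℝ, E)) = Set.univ := by simp
  rw [e] at h
  exact differentiableWithinAt_univ.1 h

theorem mlieBracket_eq_chartPull [IsManifold 𝓘(ℝ, E) 1 M] (x : M)
    (X Y : ∀ y : M, TangentSpace 𝓘(ℝ, E) y) :
    VectorField.mlieBracket 𝓘(ℝ, E) X Y x =
      VectorField.lieBracket ℝ (chartPull x X) (chartPull x Y) (extChartAt 𝓘(ℝ, E) x x) := by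
  rw [← VectorField.mlieBracketWithin_univ, VectorField.mlieBracketWithin_apply,
    mfderiv_extChartAt_self]
  have e : ((extChartAt 𝓘(ℝ, E) x).symm ⁻¹' Set.univ ∩ Set.range 𝓘(ℝ, E)) = Set.univ := by simp
  rw [e]
  refine (congrArg (fun L : E →L[ℝ] E => L _)
    (ContinuousLinearMap.inverse_id (R := ℝ) (M := E))).trans ?_
  exact congrFun (VectorField.lieBracketWithin_univ (𝕜 := ℝ) (V := chartPull x X)
    (W := chartPull x Y)) _

/-- The chain rule: the pulled back field is the image of `Z` under the inverse of the derivative of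
the inverse chart, which cancels. -/
theorem fderiv_chartPull_eventuallyEq [IsManifold 𝓘(ℝ, E) 2 M] {f : M → E'} {x : M}
    (hf : ContMDiffAt 𝓘(ℝ, E) 𝓘(ℝ, E') 2 f x)
    (Z : ∀ y : M, TangentSpace 𝓘(ℝ, E) y) :
    (fun v => fderiv ℝ (f ∘ (extChartAt 𝓘(ℝ, E) x).symm) v (chartPull x Z v)) =ᶠ[
      𝓝 (extChartAt 𝓘(ℝ, E) x x)]
      (fun y => md E E' f y (Z y)) ∘ (extChartAt 𝓘(ℝ, E) x).symm := by
  have h1 : ∀ᶠ y in 𝓝 x, ContMDiffAt 𝓘(ℝ, E) 𝓘(ℝ, E') 2 f y := by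
    obtain ⟨u, hu, h⟩ := (contMDiffAt_iff_contMDiffOn_nhds (n := 2) (by simp)).1 hf
    filter_upwards [eventually_mem_nhds_iff.2 hu] with y hy
    exact h.contMDiffAt hy
  have h2 := (continuousAt_extChartAt_symm (I := 𝓘(ℝ, E)) x).eventually
    (by simpa using h1)
  filter_upwards [h2, extChartAt_target_mem_nhds (I := 𝓘(ℝ, E)) x] with v hv hvt
  have hinv := isInvertible_mfderivWithin_extChartAt_symm (I := 𝓘(ℝ, E)) hvt
  have hd : MDifferentiableAt 𝓘(ℝ, E) 𝓘(ℝ, E) (extChartAt 𝓘(ℝ, E) x).symm v := by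
    rw [← mdifferentiableWithinAt_univ]
    simpa using mdifferentiableWithinAt_extChartAt_symm (I := 𝓘(ℝ, E)) hvt
  rw [← md_eq_fderiv]
  have hc := md_comp (E := E) (E' := E) (E'' := E') (g := f)
    (f := (extChartAt 𝓘(ℝ, E) x).symm) v (hv.mdifferentiableAt (by simp)) hd
  refine (congrArg (fun L : E →L[ℝ] E' => L (chartPull x Z v)) hc).trans ?_
  refine congrArg (md E E' f _) ?_
  obtain ⟨L, hL⟩ := hinv
  have hL' : md E E (extChartAt 𝓘(ℝ, E) x).symm v =
      mfderivWithin 𝓘(ℝ, E) 𝓘(ℝ, E) (extChartAt 𝓘(ℝ, E) x).symm (Set.range 𝓘(ℝ, E)) v := by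
    rw [ModelWithCorners.range_eq_univ, mfderivWithin_univ]; rfl
  have hp : chartPull x Z v = (mfderivWithin 𝓘(ℝ, E) 𝓘(ℝ, E) (extChartAt 𝓘(ℝ, E) x).symm
      (Set.range 𝓘(ℝ, E)) v).inverse (Z ((extChartAt 𝓘(ℝ, E) x).symm v)) := rfl
  rw [← hL, ContinuousLinearMap.inverse_equiv] at hp
  rw [hL', hp, ← hL]
  exact L.apply_symm_apply _

theorem contDiffAt_comp_chart_symm [IsManifold 𝓘(ℝ, E) ∞ M] {n : ℕ∞} {f : M → E'} {x : M}
    (hf : ContMDiffAt 𝓘(ℝ, E) 𝓘(ℝ, E') n f x) :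
    ContDiffAt ℝ n (f ∘ (extChartAt 𝓘(ℝ, E) x).symm) (extChartAt 𝓘(ℝ, E) x x) := by
  rw [← contMDiffAt_iff_contDiffAt]
  refine ContMDiffAt.comp _ (by simpa using hf) ?_
  exact ((contMDiffOn_extChartAt_symm (n := ∞) x).contMDiffAt (extChartAt_target_mem_nhds x)).of_le
    (by exact_mod_cast le_top)

theorem mdifferentiableAt_md_apply [CompleteSpace E] [IsManifold 𝓘(ℝ, E) ∞ M] {f : M → E'} {x : M}
    {Y : ∀ y : M, TangentSpace 𝓘(ℝ, E) y} (hf : ContMDiffAt 𝓘(ℝ, E) 𝓘(ℝ, E') 2 f x)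
    (hY : MDifferentiableAt 𝓘(ℝ, E) 𝓘(ℝ, E).tangent
      (fun y => (⟨y, Y y⟩ : TangentBundle 𝓘(ℝ, E) M)) x) :
    MDifferentiableAt 𝓘(ℝ, E) 𝓘(ℝ, E') (fun y => md E E' f y (Y y)) x := by
  apply mdifferentiableAt_of_comp_chart_symm
  refine DifferentiableAt.congr_of_eventuallyEq ?_ (fderiv_chartPull_eventuallyEq hf Y).symm
  refine DifferentiableAt.clm_apply ?_ (differentiableAt_chartPull hY)
  exact ((contDiffAt_comp_chart_symm (n := 2) hf).fderiv_right (m := 1) (by norm_num)).differentiableAt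
    (by simp)

/-- The identity `[X, Y] f = X(Y f) - Y(X f)`, transported from the model space by a chart. With `f`
a chart it computes the bracket itself, and this is how every bracket below is handled. -/
theorem md_mlieBracket [CompleteSpace E] [IsManifold 𝓘(ℝ, E) ∞ M] {f : M → E'} {x : M}
    {X Y : ∀ y : M, TangentSpace 𝓘(ℝ, E) y} (hf : ContMDiffAt 𝓘(ℝ, E) 𝓘(ℝ, E') 2 f x)
    (hX : MDifferentiableAt 𝓘(ℝ, E) 𝓘(ℝ, E).tangent
      (fun y => (⟨y, X y⟩ : TangentBundle 𝓘(ℝ, E) M)) x)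
    (hY : MDifferentiableAt 𝓘(ℝ, E) 𝓘(ℝ, E).tangent
      (fun y => (⟨y, Y y⟩ : TangentBundle 𝓘(ℝ, E) M)) x) :
    md E E' f x (VectorField.mlieBracket 𝓘(ℝ, E) X Y x) =
      md E E' (fun y => md E E' f y (Y y)) x (X x) -
        md E E' (fun y => md E E' f y (X y)) x (Y x) := by
  have hb : md E E' f x (VectorField.mlieBracket 𝓘(ℝ, E) X Y x) = md E E' f x
      (VectorField.lieBracket ℝ (chartPull x X) (chartPull x Y) (extChartAt 𝓘(ℝ, E) x x)) :=
    congrArg (md E E' f x) (mlieBracket_eq_chartPull x X Y)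
  rw [hb, md_eq_fderiv_chart (hf.mdifferentiableAt (by simp)),
    VectorField.fderiv_apply_lieBracket (n := 2) (contDiffAt_comp_chart_symm (n := 2) hf) (by simp)
      (differentiableAt_chartPull hY) (differentiableAt_chartPull hX),
    md_eq_fderiv_chart (mdifferentiableAt_md_apply hf hY),
    md_eq_fderiv_chart (mdifferentiableAt_md_apply hf hX),
    (fderiv_chartPull_eventuallyEq hf X).fderiv_eq, (fderiv_chartPull_eventuallyEq hf Y).fderiv_eq,
    chartPull_apply_self, chartPull_apply_self]

end ManifoldCalculus

/-! ### Smooth actions and their derivatives -/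

section Actions

variable (E : Type*) [NormedAddCommGroup E] [NormedSpace ℝ E]
  (V : Type*) [NormedAddCommGroup V] [NormedSpace ℝ V]
  {G : Type*} [TopologicalSpace G] [ChartedSpace E G]
  {M : Type*} [TopologicalSpace M] [ChartedSpace V M]
  {F : Type*} [NormedAddCommGroup F] [NormedSpace ℝ F]
  {HN : Type*} [TopologicalSpace HN] {J : ModelWithCorners ℝ F HN}
  {N : Type*} [TopologicalSpace N] [ChartedSpace HN N]

theorem contMDiff_smul_left [SMul G M] [ContMDiffSMul 𝓘(ℝ, E) 𝓘(ℝ, V) ∞ G M] (g : G) :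
    ContMDiff 𝓘(ℝ, V) 𝓘(ℝ, V) ∞ (fun y : M => g • y) :=
  ContMDiffSMul.contMDiff_const_smul (I := 𝓘(ℝ, E)) g

theorem mdifferentiableAt_smul_left [SMul G M] [ContMDiffSMul 𝓘(ℝ, E) 𝓘(ℝ, V) ∞ G M]
    (g : G) (x : M) : MDifferentiableAt 𝓘(ℝ, V) 𝓘(ℝ, V) (fun y : M => g • y) x :=
  (contMDiff_smul_left E V g).mdifferentiableAt (by simp)

theorem md_mul_smul [Group G] [MulAction G M] [ContMDiffSMul 𝓘(ℝ, E) 𝓘(ℝ, V) ∞ G M]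
    (g h : G) (x : M) (v : V) :
    md V V (fun y : M => (g * h) • y) x v =
      md V V (fun y : M => g • y) (h • x) (md V V (fun y : M => h • y) x v) := by
  simp only [mul_smul]
  exact md_comp_apply x (mdifferentiableAt_smul_left E V g _) (mdifferentiableAt_smul_left E V h _) v

theorem md_one_smul (G : Type*) [Group G] [MulAction G M] (x : M) (v : V) :
    md V V (fun y : M => (1 : G) • y) x v = v := by
  simp only [one_smul, md_id]
  rfl

theorem md_inv_smul_md_smul [Group G] [MulAction G M] [ContMDiffSMul 𝓘(ℝ, E) 𝓘(ℝ, V) ∞ G M]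
    (g : G) (x : M) (v : V) :
    md V V (fun y : M => g⁻¹ • y) (g • x) (md V V (fun y : M => g • y) x v) = v := by
  rw [← md_mul_smul E, inv_mul_cancel, md_one_smul]

theorem md_smul_md_inv_smul [Group G] [MulAction G M] [ContMDiffSMul 𝓘(ℝ, E) 𝓘(ℝ, V) ∞ G M]
    (g : G) (x : M) (v : V) :
    md V V (fun y : M => g • y) x (md V V (fun y : M => g⁻¹ • y) (g • x) v) = v := by
  have h := md_mul_smul E V g g⁻¹ (g • x) v
  rw [inv_smul_smul, mul_inv_cancel, md_one_smul] at h
  exact h.symm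

/-- A partial derivative is the total tangent map of `a` applied to a tangent vector whose first
component is the zero section, so smoothness is inherited from the tangent map. -/
theorem contMDiffAt_md_partial {V' : Type*} [NormedAddCommGroup V'] [NormedSpace ℝ V']
    {M' : Type*} [TopologicalSpace M'] [ChartedSpace V' M'] [IsManifold 𝓘(ℝ, V') ∞ M']
    [IsManifold 𝓘(ℝ, E) ∞ G] [IsManifold 𝓘(ℝ, V) ∞ M] {n : ℕ∞} {q : N} {a : G × M → M'}
    (ha : ContMDiff (𝓘(ℝ, E).prod 𝓘(ℝ, V)) 𝓘(ℝ, V') ∞ a)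
    {k : N → G} (hk : ContMDiffAt J 𝓘(ℝ, E) n k q) {f : N → M} {z : N → V}
    (h : ContMDiffAt J 𝓘(ℝ, V).tangent n (fun p => (⟨f p, z p⟩ : TangentBundle 𝓘(ℝ, V) M)) q) :
    ContMDiffAt J 𝓘(ℝ, V').tangent n
      (fun p => (⟨a (k p, f p), md V V' (fun y : M => a (k p, y)) (f p) (z p)⟩ :
        TangentBundle 𝓘(ℝ, V') M')) q := by
  have h1 : ContMDiffAt J 𝓘(ℝ, E).tangent n
      (fun p => (Bundle.zeroSection E (TangentSpace 𝓘(ℝ, E) (M := G)) (k p))) q :=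
    (Bundle.contMDiff_zeroSection ℝ (TangentSpace 𝓘(ℝ, E) (M := G))).contMDiffAt.comp q hk
  have h2 := (contMDiff_equivTangentBundleProd_symm (n := n) (I := 𝓘(ℝ, E)) (M := G)
    (I' := 𝓘(ℝ, V)) (M' := M)).contMDiffAt.comp q (h1.prodMk h)
  have h3 := (ha.contMDiff_tangentMap (m := n) (by exact_mod_cast le_top)).contMDiffAt.comp q h2
  refine h3.congr_of_eventuallyEq (Filter.Eventually.of_forall fun p => ?_)
  simp only [Function.comp_apply, tangentMap]
  refine congrArg (fun w : V' => (⟨a (k p, f p), w⟩ : TangentBundle 𝓘(ℝ, V') M')) ?_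
  have h4 := mfderiv_prod_eq_add_apply (p := (k p, f p)) (v := (0, z p))
    (ha.mdifferentiableAt (x := (k p, f p)) (by simp))
  refine Eq.trans ?_ h4.symm
  refine (zero_add (md V V' (fun y : M => a (k p, y)) (f p) (z p))).symm.trans ?_
  refine congrArg (fun w : V' => w + _) ?_
  exact (map_zero (md E V' (fun g : G => a (g, f p)) (k p))).symm

theorem contMDiffAt_md_smul [SMul G M] [ContMDiffSMul 𝓘(ℝ, E) 𝓘(ℝ, V) ∞ G M]
    [IsManifold 𝓘(ℝ, E) ∞ G] [IsManifold 𝓘(ℝ, V) ∞ M] {n : ℕ∞} {q : N}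
    {k : N → G} (hk : ContMDiffAt J 𝓘(ℝ, E) n k q) {f : N → M} {z : N → V}
    (h : ContMDiffAt J 𝓘(ℝ, V).tangent n (fun p => (⟨f p, z p⟩ : TangentBundle 𝓘(ℝ, V) M)) q) :
    ContMDiffAt J 𝓘(ℝ, V).tangent n
      (fun p => (⟨k p • f p, md V V (fun y : M => k p • y) (f p) (z p)⟩ :
        TangentBundle 𝓘(ℝ, V) M)) q :=
  contMDiffAt_md_partial E V (a := fun p : G × M => p.1 • p.2) ContMDiffSMul.contMDiff_smul hk h

end Actions

/-! ### The projection of a Lie group onto a homogeneous space -/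

section Homogeneous

variable {E : Type*} [NormedAddCommGroup E] [NormedSpace ℝ E]
  {V : Type*} [NormedAddCommGroup V] [NormedSpace ℝ V]
  {K : Type*} [TopologicalSpace K] [ChartedSpace E K] [Group K] [LieGroup 𝓘(ℝ, E) ∞ K]
  {H : Subgroup K} [ChartedSpace V (K ⧸ H)]
  {F : Type*} [NormedAddCommGroup F] [NormedSpace ℝ F]
  {N : Type*} [TopologicalSpace N] [ChartedSpace F N]

theorem exists_local_section
    (hπ : Manifold.IsSubmersion 𝓘(ℝ, E) 𝓘(ℝ, V) ∞ (fun x : K => (x : K ⧸ H))) (g : K) :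
    ∃ U : Set (K ⧸ H), IsOpen U ∧ (g : K ⧸ H) ∈ U ∧ ∃ σ : K ⧸ H → K,
      ContMDiffOn 𝓘(ℝ, V) 𝓘(ℝ, E) ∞ σ U ∧ (∀ y ∈ U, ((σ y : K) : K ⧸ H) = y) ∧
      σ (g : K ⧸ H) = g := by
  let h := hπ.isSubmersionAt g
  let φ := h.domChart
  let ψ := h.codChart
  -- In charts where the projection is linear, a section keeps the complementary coordinate fixed at
  -- its value at `g`.
  let τ : K ⧸ H → E := fun y => h.equiv.symm (ψ y, (h.equiv (φ g)).2)
  have hτ : ContMDiffOn 𝓘(ℝ, V) 𝓘(ℝ, E) ∞ τ ψ.source := by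
    refine (h.equiv.symm : (V × h.complement) →L[ℝ] E).contMDiff.comp_contMDiffOn ?_
    exact (contMDiffOn_of_mem_maximalAtlas h.codChart_mem_maximalAtlas).prodMk_space
      contMDiffOn_const
  have hw : ∀ e ∈ φ.target, ψ ((φ.symm e : K) : K ⧸ H) = (h.equiv e).1 := fun e he => by
    have h1 : e ∈ (h.domChart.extend 𝓘(ℝ, E)).target := by simpa using he
    simpa using h.writtenInCharts h1
  have hg : g ∈ φ.source := h.mem_domChart_source
  have hτg : τ (g : K ⧸ H) = φ g := by
    have := hw (φ g) (φ.map_source hg)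
    rw [φ.left_inv hg] at this
    simp [τ, this]
  refine ⟨ψ.source ∩ τ ⁻¹' φ.target, hτ.continuousOn.isOpen_inter_preimage ψ.open_source
    φ.open_target, ⟨h.mem_codChart_source, ?_⟩, fun y => φ.symm (τ y), ?_, ?_, ?_⟩
  · rw [Set.mem_preimage, hτg]
    exact φ.map_source hg
  · refine (contMDiffOn_symm_of_mem_maximalAtlas h.domChart_mem_maximalAtlas).comp
      (hτ.mono Set.inter_subset_left) ?_
    exact fun y hy => hy.2
  · rintro y ⟨hy1, hy2⟩
    refine ψ.injOn (h.source_subset_preimage_source (φ.map_target hy2)) hy1 ?_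
    rw [hw _ hy2]
    simp [τ]
  · simp only [hτg]
    exact φ.left_inv hg

/-- Locally the action is `(g, x) ↦ π (g σ(x))` for a smooth section `σ`. -/
theorem contMDiffSMul_quotient
    (hπ : Manifold.IsSubmersion 𝓘(ℝ, E) 𝓘(ℝ, V) ∞ (fun x : K => (x : K ⧸ H))) :
    ContMDiffSMul 𝓘(ℝ, E) 𝓘(ℝ, V) ∞ K (K ⧸ H) := by
  refine ⟨fun ⟨g, x⟩ => ?_⟩
  obtain ⟨k, rfl⟩ := QuotientGroup.mk_surjective x
  obtain ⟨U, hU, hkU, σ, hσ, hσU, -⟩ := exists_local_section hπ k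
  have hσk := hσ.contMDiffAt (hU.mem_nhds hkU)
  have h1 : ContMDiffAt (𝓘(ℝ, E).prod 𝓘(ℝ, V)) 𝓘(ℝ, E) ∞
      (fun p : K × (K ⧸ H) => p.1 * σ p.2) (g, (k : K ⧸ H)) :=
    contMDiffAt_fst.mul (ContMDiffAt.comp (g, (k : K ⧸ H)) hσk contMDiffAt_snd)
  refine (hπ.contMDiff.contMDiffAt.comp _ h1).congr_of_eventuallyEq ?_
  filter_upwards [continuousAt_snd.preimage_mem_nhds (hU.mem_nhds hkU)] with p hp
  simp only [Function.comp_apply]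
  conv_lhs => rw [← hσU p.2 hp]
  rfl

theorem md_mul {p q : N → K} {x : N} (hp : MDifferentiableAt 𝓘(ℝ, F) 𝓘(ℝ, E) p x)
    (hq : MDifferentiableAt 𝓘(ℝ, F) 𝓘(ℝ, E) q x) (w : F) :
    md F E (fun y => p y * q y) x w =
      md E E (fun k : K => k * q x) (p x) (md F E p x w) +
        md E E (fun k : K => p x * k) (q x) (md F E q x w) := by
  have hm : MDifferentiableAt (𝓘(ℝ, E).prod 𝓘(ℝ, E)) 𝓘(ℝ, E)
      (fun p : K × K => p.1 * p.2) (p x, q x) :=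
    (contMDiff_mul 𝓘(ℝ, E) ∞).mdifferentiableAt (by simp)
  have h1 := (hm.hasMFDerivAt.comp x (hp.hasMFDerivAt.prodMk hq.hasMFDerivAt)).mfderiv
  refine (congrArg (fun L : F →L[ℝ] E => L w) h1).trans ?_
  exact mfderiv_prod_eq_add_apply hm

theorem md_mk_mul_left [ContMDiffSMul 𝓘(ℝ, E) 𝓘(ℝ, V) ∞ K (K ⧸ H)]
    (hπ : ContMDiff 𝓘(ℝ, E) 𝓘(ℝ, V) ∞ (fun x : K => (x : K ⧸ H))) (g x : K) (v : E) :
    md E V (fun k : K => (k : K ⧸ H)) (g * x) (md E E (fun k : K => g * k) x v) =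
      md V V (fun y : K ⧸ H => g • y) (x : K ⧸ H) (md E V (fun k : K => (k : K ⧸ H)) x v) := by
  rw [← md_comp_apply x (hπ.mdifferentiableAt (by simp))
      ((contMDiff_mul_left (I := 𝓘(ℝ, E)) (n := ∞) (a := g)).mdifferentiableAt (by simp)),
    ← md_comp_apply x (mdifferentiableAt_smul_left E V g _) (hπ.mdifferentiableAt (by simp))]
  rfl

/-- Since `h⁻¹ ∈ H` is absorbed on the right, `π (h k h⁻¹) = h • π k`. The isotropy representation
at the origin is thus induced by `Ad`. -/
theorem md_smul_md_mk_one [ContMDiffSMul 𝓘(ℝ, E) 𝓘(ℝ, V) ∞ K (K ⧸ H)]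
    (hπ : ContMDiff 𝓘(ℝ, E) 𝓘(ℝ, V) ∞ (fun x : K => (x : K ⧸ H))) {h : K} (hh : h ∈ H) (v : E) :
    md V V (fun y : K ⧸ H => h • y) ((1 : K) : K ⧸ H) (md E V (fun k : K => (k : K ⧸ H)) 1 v) =
      md E V (fun k : K => (k : K ⧸ H)) 1 (Ad (E := E) h v) := by
  have hc : ContMDiff 𝓘(ℝ, E) 𝓘(ℝ, E) ∞ (fun x : K => h * x * h⁻¹) :=
    (contMDiff_mul_right (a := h⁻¹)).comp (contMDiff_mul_left (a := h))
  have e : md E V (fun k : K => (k : K ⧸ H)) 1 (Ad (E := E) h v) =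
      md E V (fun k : K => ((h * k * h⁻¹ : K) : K ⧸ H)) 1 v := by
    refine (Eq.trans ?_ (md_comp_apply (E := E) (E' := E) (E'' := V)
      (g := fun k : K => (k : K ⧸ H)) (f := fun x : K => h * x * h⁻¹) 1
      (hπ.mdifferentiableAt (by simp)) (hc.mdifferentiableAt (by simp)) v).symm)
    rw [mul_one, mul_inv_cancel]
    rfl
  rw [e, ← md_comp_apply (1 : K) (mdifferentiableAt_smul_left E V h _)
    (hπ.mdifferentiableAt (by simp))]
  have : (fun k : K => ((h * k * h⁻¹ : K) : K ⧸ H)) = fun k : K => h • (k : K ⧸ H) := by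
    funext k
    exact QuotientGroup.mk_mul_of_mem _ (H.inv_mem hh)
  rw [this]

theorem md_mk_surjective
    (hπ : Manifold.IsSubmersion 𝓘(ℝ, E) 𝓘(ℝ, V) ∞ (fun x : K => (x : K ⧸ H))) (g : K) :
    Function.Surjective (md E V (fun k : K => (k : K ⧸ H)) g) := by
  obtain ⟨U, hU, hgU, σ, hσ, hσU, hσg⟩ := exists_local_section hπ g
  intro v
  refine ⟨md V E σ (g : K ⧸ H) v, ?_⟩
  have h := md_comp_apply (E := V) (E' := E) (E'' := V) (g := fun k : K => (k : K ⧸ H)) (f := σ)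
    (g : K ⧸ H) (hπ.contMDiff.mdifferentiableAt (by simp))
    ((hσ.contMDiffAt (hU.mem_nhds hgU)).mdifferentiableAt (by simp)) v
  rw [hσg] at h
  rw [← h, md_congr (g := fun y : K ⧸ H => y)
    (Filter.eventually_of_mem (hU.mem_nhds hgU) hσU), md_id]
  rfl

theorem md_chart_symm_self {M : Type*} [TopologicalSpace M] [ChartedSpace V M]
    [IsManifold 𝓘(ℝ, V) ∞ M] (x : M) :
    md V V (extChartAt 𝓘(ℝ, V) x).symm (extChartAt 𝓘(ℝ, V) x x) = ContinuousLinearMap.id ℝ V := by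
  have h1 : MDifferentiableAt 𝓘(ℝ, V) 𝓘(ℝ, V) (extChartAt 𝓘(ℝ, V) x).symm
      (extChartAt 𝓘(ℝ, V) x x) :=
    ((contMDiffOn_extChartAt_symm (n := ∞) x).contMDiffAt
      (extChartAt_target_mem_nhds x)).mdifferentiableAt (by simp)
  have h2 := md_comp (E := V) (E' := V) (E'' := V) (g := (extChartAt 𝓘(ℝ, V) x).symm)
    (f := extChartAt 𝓘(ℝ, V) x) x h1 (contMDiffAt_extChartAt (n := ∞).mdifferentiableAt (by simp))
  rw [md_chart_self, ContinuousLinearMap.comp_id] at h2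
  rw [← h2, md_congr (g := fun y : M => y), md_id]
  filter_upwards [extChartAt_source_mem_nhds (I := 𝓘(ℝ, V)) x] with y hy
  exact (extChartAt 𝓘(ℝ, V) x).left_inv hy

theorem exists_curve_hasMFDerivAt {M : Type*} [TopologicalSpace M] [ChartedSpace V M]
    [IsManifold 𝓘(ℝ, V) ∞ M] (x : M) (v : V) :
    ∃ δ : ℝ → M, δ 0 = x ∧
      HasMFDerivAt 𝓘(ℝ, ℝ) 𝓘(ℝ, V) δ 0 ((1 : ℝ →L[ℝ] ℝ).smulRight v) := by
  let c := extChartAt 𝓘(ℝ, V) x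
  let l : ℝ → V := fun t => c x + t • v
  have hl0 : l 0 = c x := by simp [l]
  refine ⟨fun t => c.symm (l t), by simp [hl0, c], ?_⟩
  have h1 : MDifferentiableAt 𝓘(ℝ, V) 𝓘(ℝ, V) c.symm (l 0) := by
    rw [hl0]
    exact ((contMDiffOn_extChartAt_symm (n := ∞) x).contMDiffAt
      (extChartAt_target_mem_nhds x)).mdifferentiableAt (by simp)
  have h2 : HasFDerivAt l ((1 : ℝ →L[ℝ] ℝ).smulRight v) 0 :=
    ((hasFDerivAt_id (0 : ℝ)).smul_const v).const_add (c x)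
  refine (h1.hasMFDerivAt.comp (0 : ℝ) h2.hasMFDerivAt).congr_mfderiv ?_
  have h3 : md V V c.symm (l 0) = ContinuousLinearMap.id ℝ V := by
    rw [hl0]; exact md_chart_symm_self x
  have h4 : ∀ t : ℝ, md V V c.symm (l 0) (t • v) = t • v := fun t => by rw [h3]; rfl
  exact ContinuousLinearMap.ext fun t => h4 t

/-- The kernel of `dπ` is `𝔥`. A curve in `H` is collapsed to a point by `π`. Conversely, for a
local section `σ` the map `ρ k = σ(π k)⁻¹ k` sends a neighbourhood of the identity into `H`, and its
derivative fixes every vector killed by `dπ`, so it pushes a curve of `K` with velocity `A` into `H`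
without changing the velocity. -/
theorem md_mk_eq_zero_iff
    (hπ : Manifold.IsSubmersion 𝓘(ℝ, E) 𝓘(ℝ, V) ∞ (fun x : K => (x : K ⧸ H))) (A : E) :
    (∃ γ : ℝ → K, γ 0 = 1 ∧ (∀ t, γ t ∈ H) ∧
      HasMFDerivAt 𝓘(ℝ, ℝ) 𝓘(ℝ, E) γ 0 ((1 : ℝ →L[ℝ] ℝ).smulRight A)) ↔
      md E V (fun k : K => (k : K ⧸ H)) 1 A = 0 := by
  have hπd : ∀ g : K, MDifferentiableAt 𝓘(ℝ, E) 𝓘(ℝ, V) (fun x : K => (x : K ⧸ H)) g :=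
    fun g => hπ.contMDiff.mdifferentiableAt (by simp)
  constructor
  · rintro ⟨γ, hγ0, hγH, hγ⟩
    have h1 : HasMFDerivAt 𝓘(ℝ, ℝ) 𝓘(ℝ, V) (fun t => (γ t : K ⧸ H)) 0 _ :=
      (hπd (γ 0)).hasMFDerivAt.comp (0 : ℝ) hγ
    have h2 : (fun t => (γ t : K ⧸ H)) = fun _ => ((1 : K) : K ⧸ H) := by
      funext t
      rw [QuotientGroup.eq]
      simpa using hγH t
    rw [h2] at h1
    have h3 := hasMFDerivAt_unique h1 (hasMFDerivAt_const _ _)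
    have h4 : md E V (fun k : K => (k : K ⧸ H)) (γ 0) ((1 : ℝ) • A) = 0 :=
      congrArg (fun L : ℝ →L[ℝ] V => L 1) h3
    rwa [one_smul, hγ0] at h4
  · intro hA
    obtain ⟨U, hU, h1U, σ, hσ, hσU, hσ1⟩ := exists_local_section hπ (1 : K)
    obtain ⟨δ, hδ0, hδd⟩ := exists_curve_hasMFDerivAt (1 : K) A
    have hσs := hσ.contMDiffAt (hU.mem_nhds h1U)
    have hσπ : ContMDiffAt 𝓘(ℝ, E) 𝓘(ℝ, E) ∞ (fun k : K => σ (k : K ⧸ H)) 1 :=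
      ContMDiffAt.comp (1 : K) (g := σ) (f := fun k : K => (k : K ⧸ H))
        hσs hπ.contMDiff.contMDiffAt
    let ρ : K → K := fun k => (σ (k : K ⧸ H))⁻¹ * k
    have hρ : MDifferentiableAt 𝓘(ℝ, E) 𝓘(ℝ, E) ρ 1 :=
      (hσπ.inv.mul contMDiffAt_id).mdifferentiableAt (by simp)
    have hρ1 : ρ 1 = 1 := by simp [ρ, hσ1]
    have hρA : md E E ρ 1 A = A := by
      have h2 := md_mul (hσπ.mdifferentiableAt (by simp)) hρ A
      -- Differentiating `σ(π k) ρ(k) = k` at the identity in the direction `A`, the first factor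
      -- contributes nothing because `dπ A = 0`.
      have h3 : (fun k : K => σ (k : K ⧸ H) * ρ k) = fun k => k := by
        funext k; simp [ρ]
      rw [h3, md_id, md_comp_apply (1 : K) (g := σ) (f := fun k : K => (k : K ⧸ H))
        (hσs.mdifferentiableAt (by simp)) (hπd 1), hA, map_zero, map_zero, zero_add] at h2
      simp only [hσ1, one_mul, md_id] at h2
      exact h2.symm
    have hev : ∀ᶠ t in 𝓝 (0 : ℝ), (δ t : K ⧸ H) ∈ U := by
      refine hδd.continuousAt.eventually
        ((hπ.contMDiff.continuous.continuousAt (x := δ 0)).preimage_mem_nhds (hU.mem_nhds ?_))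
      rw [hδ0]; exact h1U
    classical
    -- The curve must lie in `H` for all times, not only near `0`; outside the domain of the section
    -- it is set to `1`.
    refine ⟨fun t => if (δ t : K ⧸ H) ∈ U then ρ (δ t) else 1, ?_, ?_, ?_⟩
    · simp [hδ0, hρ1]
    · intro t
      by_cases ht : (δ t : K ⧸ H) ∈ U
      · simp only [ht, if_true, ρ]
        exact QuotientGroup.eq.1 (hσU _ ht)
      · simp only [ht, if_false]
        exact H.one_mem
    · have h2 : HasMFDerivAt 𝓘(ℝ, E) 𝓘(ℝ, E) ρ (δ 0) (md E E ρ 1) := by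
        rw [hδ0]; exact hρ.hasMFDerivAt
      have h3 := (h2.comp (0 : ℝ) hδd).congr_of_eventuallyEq
        (f₁ := fun t => if (δ t : K ⧸ H) ∈ U then ρ (δ t) else 1)
        (hev.mono fun t ht => if_pos ht)
      refine h3.congr_mfderiv ?_
      refine ContinuousLinearMap.ext fun t => ?_
      have h4 : ∀ t : ℝ, md E E ρ 1 (t • A) = t • A := fun t => by rw [map_smul, hρA]
      exact h4 t

end Homogeneous

/-! ### The form `η` on `ℝⁿ` -/

section Eta

variable {m : ℕ}

theorem eta_comm (v w : Mink m) : eta v w = eta w v := by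
  simp only [eta, mul_comm]
  ring

theorem eta_add_left (v v' w : Mink m) : eta (v + v') w = eta v w + eta v' w := by
  simp only [eta, PiLp.add_apply, add_mul, Finset.sum_add_distrib]
  ring

theorem eta_add_right (v w w' : Mink m) : eta v (w + w') = eta v w + eta v w' := by
  rw [eta_comm, eta_add_left, eta_comm w, eta_comm w']

theorem eta_smul_right (c : ℝ) (v w : Mink m) : eta v (c • w) = c * eta v w := by
  rw [eta_comm, eta_smul_left, eta_comm]

theorem eta_neg_left (v w : Mink m) : eta (-v) w = -eta v w := by
  rw [← neg_one_smul ℝ, eta_smul_left, neg_one_mul]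

theorem eta_neg_right (v w : Mink m) : eta v (-w) = -eta v w := by
  rw [eta_comm, eta_neg_left, eta_comm]

/-- `η` as a continuous bilinear map. -/
def etaL (m : ℕ) : Mink m →L[ℝ] Mink m →L[ℝ] ℝ :=
  LinearMap.toContinuousLinearMap
    (LinearMap.toContinuousLinearMap.toLinearMap ∘ₗ
      (LinearMap.mk₂ ℝ (eta (m := m)) eta_add_left eta_smul_left eta_add_right eta_smul_right))

theorem etaL_apply (v w : Mink m) : etaL m v w = eta v w := rfl

theorem eta_kvec_left (v : Mink m) : eta (kvec m) v = v 1 := by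
  simp [eta, kvec, Fin.succ_ne_zero]

theorem eta_of_perp {v w : Mink m} (hv : v 1 = 0) (hw : w 1 = 0) :
    eta v w = ∑ i : Fin m, v i.succ.succ * w i.succ.succ := by
  simp [eta, hv, hw]

theorem mem_span_kvec_iff (v : Mink m) :
    v ∈ Submodule.span ℝ {kvec m} ↔ v 1 = 0 ∧ ∀ i : Fin m, v i.succ.succ = 0 := by
  rw [Submodule.mem_span_singleton]
  constructor
  · rintro ⟨c, rfl⟩
    simp [kvec, Fin.succ_ne_zero]
  · rintro ⟨h1, h2⟩
    refine ⟨v 0, ?_⟩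
    ext j
    refine Fin.cases (by simp [kvec]) (fun j => Fin.cases ?_ (fun i => ?_) j) j
    · simpa [kvec] using h1.symm
    · simp [kvec, h2]

/-- On `k^⊥` the form is the sum of squares of the last `m` coordinates, so it is definite modulo
`k`. -/
theorem mem_span_kvec_of_eta_self {v : Mink m} (h1 : v 1 = 0) (h : eta v v = 0) :
    v ∈ Submodule.span ℝ {kvec m} := by
  refine (mem_span_kvec_iff v).2 ⟨h1, ?_⟩
  rw [eta_of_perp h1 h1, Finset.sum_eq_zero_iff_of_nonneg fun i _ => mul_self_nonneg _] at h
  exact fun i => mul_self_eq_zero.1 (h i (Finset.mem_univ i))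

end Eta

/-! ### Normal form of quadruples -/

section LinearAlgebra

/-- Parseval's identity: the functionals are the inner products with an orthonormal basis. -/
theorem exists_sum_mul_of_posDef {F : Type*} [AddCommGroup F] [Module ℝ F] [FiniteDimensional ℝ F]
    {m : ℕ} (hm : Module.finrank ℝ F = m) (ip : F →ₗ[ℝ] F →ₗ[ℝ] ℝ)
    (hs : ∀ v w, ip v w = ip w v) (hp : ∀ v, v ≠ 0 → 0 < ip v v) :
    ∃ f : Fin m → F →ₗ[ℝ] ℝ, ∀ v w, ip v w = ∑ i, f i v * f i w := by
  let c : InnerProductSpace.Core ℝ F :=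
    { inner := fun v w => ip v w
      conj_inner_symm := fun v w => hs w v
      re_inner_nonneg := fun v => by
        by_cases hv : v = 0
        · simp [hv]
        · exact (hp v hv).le
      add_left := fun v v' w => by simp
      smul_left := fun v w r => by simp
      definite := fun v hv => by
        by_contra h
        exact (hp v h).ne' hv }
  let _ : NormedAddCommGroup F := c.toNormedAddCommGroup
  let _ : InnerProductSpace ℝ F := InnerProductSpace.ofCore c.toCore
  let b := (stdOrthonormalBasis ℝ F).reindex (finCongr hm)
  refine ⟨fun i => ip (b i), fun v w => ?_⟩
  have h := (b.sum_inner_mul_inner v w).symm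
  refine Eq.trans (show ip v w = _ from h) (Finset.sum_congr rfl fun i _ => ?_)
  exact congrArg (fun r => r * ip (b i) w) (hs v (b i))

theorem exists_continuousLinearEquiv_of_ker_eq {W V : Type*} [AddCommGroup W] [Module ℝ W]
    [NormedAddCommGroup V] [NormedSpace ℝ V] [FiniteDimensional ℝ V] {B B' : W →ₗ[ℝ] V}
    (hB : Function.Surjective B) (hB' : Function.Surjective B')
    (h : ∀ A, B A = 0 ↔ B' A = 0) : ∃ n : V ≃L[ℝ] V, ∀ A, n (B A) = B' A := by
  have hk : B.ker = B'.ker := Submodule.ext h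
  let e := ((B.quotKerEquivOfSurjective hB).symm.trans (Submodule.quotEquivOfEq _ _ hk)).trans
    (B'.quotKerEquivOfSurjective hB')
  refine ⟨e.toContinuousLinearEquiv, fun A => ?_⟩
  have : (B.quotKerEquivOfSurjective hB).symm (B A) = Submodule.Quotient.mk A := by
    rw [LinearEquiv.symm_apply_eq]
    rfl
  simp [e, this]

/-- The coordinates of `B` are built along the flag `h ≤ a ≤ b ≤ W`. Choose `A` spanning `a` modulo
`h`. The coordinates are a functional `α` with `α A = 1` vanishing on `h`, the functional `ℓ = β(A,
·)` with kernel `b`, and orthonormal coordinates of `b/a` extended to `W`. The kernel of `B` is `h`,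
so surjectivity is a dimension count. -/
theorem exists_adapted_map {W : Type*} [AddCommGroup W] [Module ℝ W] [FiniteDimensional ℝ W] {m : ℕ}
    {h a b : Submodule ℝ W} (hha : h ≤ a) (hab : a ≤ b)
    (hfW : Module.finrank ℝ (W ⧸ h) = m + 2)
    (hfa : Module.finrank ℝ (a ⧸ h.submoduleOf a) = 1)
    (hfb : Module.finrank ℝ (W ⧸ b) = 1)
    (ip : (b ⧸ a.submoduleOf b) →ₗ[ℝ] (b ⧸ a.submoduleOf b) →ₗ[ℝ] ℝ)
    (hs : ∀ v w, ip v w = ip w v) (hp : ∀ v, v ≠ 0 → 0 < ip v v)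
    (β : ((a ⧸ h.submoduleOf a) ⊗[ℝ] (W ⧸ b)) →ₗ[ℝ] ℝ) (hβ : β ≠ 0) :
    ∃ B : W →ₗ[ℝ] Mink m, Function.Surjective B ∧ (∀ z, B z = 0 ↔ z ∈ h) ∧
      (∀ z, z ∈ a ↔ B z ∈ Submodule.span ℝ {kvec m}) ∧
      (∀ z, z ∈ b ↔ eta (kvec m) (B z) = 0) ∧
      (∀ x y : b, ip (Submodule.Quotient.mk x) (Submodule.Quotient.mk y) = eta (B x) (B y)) ∧
      ∀ (x : a) (z : W), β (Submodule.Quotient.mk x ⊗ₜ[ℝ] Submodule.Quotient.mk z) =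
        eta (B x) (B z) := by
  have e1 := h.finrank_quotient_add_finrank
  have e2 := (h.submoduleOf a).finrank_quotient_add_finrank
  have e3 := (a.submoduleOf b).finrank_quotient_add_finrank
  have e4 := b.finrank_quotient_add_finrank
  rw [(Submodule.submoduleOfEquivOfLe hha).finrank_eq] at e2
  rw [(Submodule.submoduleOfEquivOfLe hab).finrank_eq] at e3
  obtain ⟨f, hf⟩ := exists_sum_mul_of_posDef (m := m) (by omega) ip hs hp
  obtain ⟨A', hA'⟩ : ∃ v : a ⧸ h.submoduleOf a, v ≠ 0 := by
    have : Nontrivial (a ⧸ h.submoduleOf a) := Module.nontrivial_of_finrank_pos (R := ℝ) (by omega)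
    exact exists_ne 0
  obtain ⟨A, rfl⟩ := Submodule.Quotient.mk_surjective _ A'
  have hAh : (A : W) ∉ h := fun hA => hA' ((Submodule.Quotient.mk_eq_zero _).2 hA)
  have hspan := (finrank_eq_one_iff_of_nonzero' _ hA').1 hfa
  let ℓ : W →ₗ[ℝ] ℝ := (β ∘ₗ TensorProduct.mk ℝ _ _ (Submodule.Quotient.mk A)) ∘ₗ b.mkQ
  have hℓ : ∀ z, ℓ z = β (Submodule.Quotient.mk A ⊗ₜ Submodule.Quotient.mk z) := fun z => rfl
  -- As `A` spans `a/h`, vanishing of `β(A, ·)` would force `β = 0`.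
  obtain ⟨z₁, hz₁⟩ : ∃ z, ℓ z ≠ 0 := by
    by_contra! hc
    refine hβ (TensorProduct.ext' fun x z => ?_)
    obtain ⟨z, rfl⟩ := Submodule.Quotient.mk_surjective _ z
    obtain ⟨c, rfl⟩ := hspan x
    rw [← TensorProduct.smul_tmul', map_smul, ← hℓ, hc, smul_zero, LinearMap.zero_apply]
  have hℓb : ∀ z, z ∈ b ↔ ℓ z = 0 := by
    have h1 : ∀ z ∈ b, ℓ z = 0 := fun z hz => by
      rw [hℓ, (Submodule.Quotient.mk_eq_zero _).2 hz, TensorProduct.tmul_zero, map_zero]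
    refine fun z => ⟨h1 z, fun hz => ?_⟩
    have hz₁b : (Submodule.Quotient.mk z₁ : W ⧸ b) ≠ 0 := fun h0 =>
      hz₁ (h1 _ ((Submodule.Quotient.mk_eq_zero _).1 h0))
    obtain ⟨c, hc⟩ := (finrank_eq_one_iff_of_nonzero' _ hz₁b).1 hfb (Submodule.Quotient.mk z)
    rw [hℓ, ← hc, TensorProduct.tmul_smul, map_smul, ← hℓ, smul_eq_mul] at hz
    have : c = 0 := (mul_eq_zero.1 hz).resolve_right hz₁
    rw [this, zero_smul] at hc
    exact (Submodule.Quotient.mk_eq_zero _).1 hc.symm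
  let z₀ : W := (ℓ z₁)⁻¹ • z₁
  have hz₀ : ℓ z₀ = 1 := by simp [z₀, hz₁]
  obtain ⟨α', hα'A, hα'h⟩ := Submodule.exists_le_ker_of_notMem hAh
  let α : W →ₗ[ℝ] ℝ := (α' A)⁻¹ • α'
  have hαA : α A = 1 := by simp [α, hα'A]
  have hαh : ∀ z ∈ h, α z = 0 := fun z hz => by
    have : α' z = 0 := hα'h hz
    simp [α, this]
  -- The projection onto `b` along `z₀`. It serves only to extend functionals from `b` to `W`, so
  -- the choice of `z₀` with `ℓ z₀ = 1` does not matter.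
  let pb : W →ₗ[ℝ] b := (LinearMap.id - ℓ.smulRight z₀).codRestrict b fun z => by
    rw [hℓb]; simp [hz₀]
  have hpb : ∀ x : b, pb x = x := fun x => by
    ext
    simp [pb, (hℓb x).1 x.2]
  let g : Fin m → W →ₗ[ℝ] ℝ := fun i => (f i ∘ₗ (a.submoduleOf b).mkQ) ∘ₗ pb
  have hg : ∀ i (x : b), g i x = f i (Submodule.Quotient.mk x) := fun i x => by
    simp [g, hpb]
  have hip : ∀ x y : b, ip (Submodule.Quotient.mk x) (Submodule.Quotient.mk y) =
      ∑ i, g i x * g i y := fun x y => by simp only [hf, hg]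
  let B : W →ₗ[ℝ] Mink m := (WithLp.linearEquiv 2 ℝ (Fin (m + 2) → ℝ)).symm.toLinearMap ∘ₗ
    LinearMap.pi (Fin.cons α (Fin.cons ℓ g) : Fin (m + 2) → W →ₗ[ℝ] ℝ)
  have hB0 : ∀ z, B z 0 = α z := fun z => rfl
  have hB1 : ∀ z, B z 1 = ℓ z := fun z => rfl
  have hB2 : ∀ z (i : Fin m), B z i.succ.succ = g i z := fun z i => rfl
  have ha : ∀ z, z ∈ a ↔ ℓ z = 0 ∧ ∀ i, g i z = 0 := by
    intro z
    rw [← hℓb]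
    constructor
    · intro hz
      refine ⟨hab hz, fun i => ?_⟩
      rw [hg i ⟨z, hab hz⟩, (Submodule.Quotient.mk_eq_zero (a.submoduleOf b)).2 hz, map_zero]
    · rintro ⟨hzb, hz⟩
      by_contra hza
      have h1 := hp (Submodule.Quotient.mk ⟨z, hzb⟩)
        fun h0 => hza ((Submodule.Quotient.mk_eq_zero (a.submoduleOf b)).1 h0)
      rw [hip] at h1
      simp [hz] at h1
  have hdecomp : ∀ x : a, ∃ c : ℝ, (Submodule.Quotient.mk x : a ⧸ h.submoduleOf a) =
      c • Submodule.Quotient.mk A ∧ (x : W) - c • (A : W) ∈ h ∧ α x = c := by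
    intro x
    obtain ⟨c, hc⟩ := hspan (Submodule.Quotient.mk x)
    have h1 : (x : W) - c • (A : W) ∈ h := by
      rw [← Submodule.Quotient.mk_smul, eq_comm, Submodule.Quotient.eq] at hc
      exact hc
    refine ⟨c, hc.symm, h1, ?_⟩
    have h2 := hαh _ h1
    rw [map_sub, map_smul, hαA] at h2
    simpa [sub_eq_zero] using h2
  have hker : ∀ z, B z = 0 ↔ z ∈ h := by
    intro z
    constructor
    · intro hz
      have h0 : α z = 0 := by rw [← hB0, hz]; rfl
      have hza : z ∈ a := (ha z).2 ⟨by rw [← hB1, hz]; rfl, fun i => by rw [← hB2, hz]; rfl⟩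
      obtain ⟨c, -, h1, h2⟩ := hdecomp ⟨z, hza⟩
      simp only [h0] at h2
      simpa [← h2] using h1
    · intro hz
      obtain ⟨h1, h2⟩ := (ha z).1 (hha hz)
      ext j
      refine Fin.cases ?_ (fun j => Fin.cases ?_ (fun i => ?_) j) j
      · exact (hB0 z).trans (hαh z hz)
      · exact (hB1 z).trans h1
      · exact (hB2 z i).trans (h2 i)
  refine ⟨B, ?_, hker, ?_, ?_, ?_, ?_⟩
  · rw [← LinearMap.range_eq_top]
    apply Submodule.eq_top_of_finrank_eq
    have h1 := LinearMap.finrank_range_add_finrank_ker B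
    have h2 : B.ker = h := Submodule.ext hker
    rw [h2] at h1
    simp only [finrank_euclideanSpace, Fintype.card_fin]
    omega
  · intro z
    rw [mem_span_kvec_iff, ha]
    rfl
  · intro z
    rw [eta_kvec_left, hB1, hℓb]
  · intro x y
    rw [hip, eta_of_perp ((hB1 _).trans ((hℓb _).1 x.2)) ((hB1 _).trans ((hℓb _).1 y.2))]
    rfl
  · intro x z
    obtain ⟨c, h1, -, h2⟩ := hdecomp x
    obtain ⟨h3, h4⟩ := (ha x).1 x.2
    rw [h1, ← TensorProduct.smul_tmul', map_smul, ← hℓ]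
    simp only [eta, hB0, hB1, hB2, h2, h3, h4]
    simp

end LinearAlgebra

/-! ### Adapted maps, the group `GN`, and invariant quadruples -/

section Adapted

variable {E : Type*} [NormedAddCommGroup E] [NormedSpace ℝ E] [FiniteDimensional ℝ E]
  {K : Type*} [TopologicalSpace K] [ChartedSpace E K] [Group K] [LieGroup 𝓘(ℝ, E) ∞ K]
  {H : Subgroup K} {m : ℕ}

instance : FiniteDimensional ℝ (LieAlg E K) := inferInstanceAs (FiniteDimensional ℝ E)

/-- `B` identifies `𝔨/𝔥` with `ℝⁿ` in such a way that the quadruple `Q` corresponds to the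
standard data on `ℝⁿ`. -/
structure Adapted (Q : InvariantQuadruple E H) (B : LieAlg E K →ₗ[ℝ] Mink m) : Prop where
  surjective : Function.Surjective B
  eq_zero_iff : ∀ z, B z = 0 ↔ z ∈ subgroupLieAlg H
  a_iff : ∀ z, z ∈ Q.a ↔ B z ∈ Submodule.span ℝ {kvec m}
  b_iff : ∀ z, z ∈ Q.b ↔ eta (kvec m) (B z) = 0
  ip_eq : ∀ x y : Q.b,
    Q.ip (Submodule.Quotient.mk x) (Submodule.Quotient.mk y) = eta (B x) (B y)
  β_eq : ∀ (x : Q.a) (z : LieAlg E K),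
    Q.β (Submodule.Quotient.mk x ⊗ₜ[ℝ] Submodule.Quotient.mk z) = eta (B x) (B z)

variable {Q : InvariantQuadruple E H} {B B' : LieAlg E K →ₗ[ℝ] Mink m}

theorem exists_adapted (Q : InvariantQuadruple E H) {p : LieAlg E K →ₗ[ℝ] Mink m}
    (hp : Function.Surjective p) (hk : ∀ z, p z = 0 ↔ z ∈ subgroupLieAlg H) :
    ∃ B : LieAlg E K →ₗ[ℝ] Mink m, Adapted Q B := by
  have hk' : p.ker = subgroupLieAlg H := Submodule.ext hk
  have hf : Module.finrank ℝ (LieAlg E K ⧸ subgroupLieAlg (E := E) H) = m + 2 := by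
    rw [← hk', (p.quotKerEquivOfSurjective hp).finrank_eq]
    simp
  obtain ⟨B, h1, h2, h3, h4, h5, h6⟩ := exists_adapted_map Q.le_a Q.a_le_b hf Q.finrank_a
    Q.finrank_b Q.ip Q.ip_symm Q.ip_pos Q.β Q.β_ne_zero
  exact ⟨B, h1, h2, h3, h4, h5, h6⟩

/-- The two maps have the same kernel `𝔥`, so they differ by an automorphism of `ℝⁿ`. The three
conditions defining `GN` hold because both maps compute `𝔞`, `(·,·)` and `β` of the same quadruple.
-/
theorem Adapted.exists_GN (h : Adapted Q B) (h' : Adapted Q B') :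
    ∃ n ∈ GN m, ∀ z, n (B z) = B' z := by
  obtain ⟨n, hn⟩ := exists_continuousLinearEquiv_of_ker_eq h.surjective h'.surjective
    fun A => (h.eq_zero_iff A).trans (h'.eq_zero_iff A).symm
  refine ⟨n, ⟨?_, fun w w' hw hw' => ?_, fun z => ?_⟩, hn⟩
  · obtain ⟨A, hA⟩ := h.surjective (kvec m)
    have h1 : B' A ∈ Submodule.span ℝ {kvec m} := by
      rw [← h'.a_iff, h.a_iff, hA]
      exact Submodule.mem_span_singleton_self _
    rwa [← hn, hA] at h1
  · obtain ⟨x, rfl⟩ := h.surjective w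
    obtain ⟨y, rfl⟩ := h.surjective w'
    rw [hn, hn]
    exact (h'.ip_eq ⟨x, (h.b_iff x).2 hw⟩ ⟨y, (h.b_iff y).2 hw'⟩).symm.trans
      (h.ip_eq ⟨x, (h.b_iff x).2 hw⟩ ⟨y, (h.b_iff y).2 hw'⟩)
  · obtain ⟨A, hA⟩ := h.surjective (kvec m)
    obtain ⟨z, rfl⟩ := h.surjective z
    have hAa : A ∈ Q.a := (h.a_iff A).2 (hA ▸ Submodule.mem_span_singleton_self _)
    rw [← hA, hn, hn]
    exact (h'.β_eq ⟨A, hAa⟩ z).symm.trans (h.β_eq ⟨A, hAa⟩ z)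

theorem GN_apply_mem_span_iff {n : Mink m ≃L[ℝ] Mink m} (hn : n ∈ GN m) (v : Mink m) :
    n v ∈ Submodule.span ℝ {kvec m} ↔ v ∈ Submodule.span ℝ {kvec m} := by
  obtain ⟨c, hc, hk⟩ := IsGN.exists_smul hn
  simp only [Submodule.mem_span_singleton]
  constructor
  · rintro ⟨r, hr⟩
    refine ⟨c⁻¹ * r, n.injective ?_⟩
    rw [← hr, map_smul, hk, smul_smul]
    congr 1
    field_simp
  · rintro ⟨r, rfl⟩
    exact ⟨r * c, by rw [map_smul, hk, smul_smul]⟩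

theorem eta_GN_of_mem_span {n : Mink m ≃L[ℝ] Mink m} (hn : n ∈ GN m) {v : Mink m}
    (hv : v ∈ Submodule.span ℝ {kvec m}) (w : Mink m) : eta (n v) (n w) = eta v w := by
  obtain ⟨r, rfl⟩ := Submodule.mem_span_singleton.1 hv
  rw [map_smul, eta_smul_left, eta_smul_left, hn.2.2]

theorem Adapted.comp_GN (h : Adapted Q B) {n : Mink m ≃L[ℝ] Mink m} (hn : n ∈ GN m)
    (hB' : ∀ z, B' z = n (B z)) : Adapted Q B' where
  surjective := fun v => by
    obtain ⟨z, hz⟩ := h.surjective (n.symm v)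
    exact ⟨z, by rw [hB', hz, n.apply_symm_apply]⟩
  eq_zero_iff := fun z => by rw [hB', ← h.eq_zero_iff, n.map_eq_zero_iff]
  a_iff := fun z => by rw [h.a_iff, hB', GN_apply_mem_span_iff hn]
  b_iff := fun z => by rw [h.b_iff, hB', IsGN.perp hn]
  ip_eq := fun x y => by
    rw [h.ip_eq, hB', hB', hn.2.1 _ _ ((h.b_iff _).1 x.2) ((h.b_iff _).1 y.2)]
  β_eq := fun x z => by
    rw [h.β_eq, hB', hB', eta_GN_of_mem_span hn ((h.a_iff _).1 x.2)]

theorem Ad_inv_Ad (k : K) (z : LieAlg E K) : Ad k⁻¹ (Ad k z) = z := by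
  have hc : ∀ k : K, ContMDiff 𝓘(ℝ, E) 𝓘(ℝ, E) ∞ (fun x : K => k * x * k⁻¹) := fun k =>
    (contMDiff_mul_right (a := k⁻¹)).comp (contMDiff_mul_left (a := k))
  have h1 := md_comp_apply (E := E) (E' := E) (E'' := E) (g := fun x : K => k⁻¹ * x * k⁻¹⁻¹)
    (f := fun x : K => k * x * k⁻¹) 1
    ((hc k⁻¹).mdifferentiableAt (by simp)) ((hc k).mdifferentiableAt (by simp)) z
  have h2 : (fun y : K => k⁻¹ * (k * y * k⁻¹) * k⁻¹⁻¹) = fun y => y := by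
    funext y; group
  rw [h2, md_id, mul_one, mul_inv_cancel] at h1
  exact h1.symm

/-- This is where the `Ad(H)`-invariance of the quadruple is used; together with `Adapted.exists_GN`
it places the isotropy action in `GN`. -/
theorem Adapted.comp_Ad (h : Adapted Q B) {k : K} (hk : k ∈ H)
    (hB' : ∀ z, B' z = B (Ad k z)) (hs : Function.Surjective B')
    (hz : ∀ z, B' z = 0 ↔ z ∈ subgroupLieAlg H) : Adapted Q B' where
  surjective := hs
  eq_zero_iff := hz
  a_iff := fun z => by
    rw [hB', ← h.a_iff]
    refine ⟨Q.Ad_mem_a k hk z, fun hz' => ?_⟩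
    have h1 := Q.Ad_mem_a k⁻¹ (H.inv_mem hk) _ hz'
    rwa [Ad_inv_Ad] at h1
  b_iff := fun z => by
    rw [hB', ← h.b_iff]
    refine ⟨Q.Ad_mem_b k hk z, fun hz' => ?_⟩
    have h1 := Q.Ad_mem_b k⁻¹ (H.inv_mem hk) _ hz'
    rwa [Ad_inv_Ad] at h1
  ip_eq := fun x y => by
    rw [hB', hB', ← Q.ip_Ad k hk x y]
    exact h.ip_eq _ _
  β_eq := fun x z => by
    rw [hB', hB', ← Q.β_Ad k hk x z]
    exact h.β_eq _ _

theorem Adapted.eq {Q' : InvariantQuadruple E H} (h : Adapted Q B) (h' : Adapted Q' B) :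
    Q = Q' := by
  have ha : Q.a = Q'.a := Submodule.ext fun z => by rw [h.a_iff, h'.a_iff]
  have hb : Q.b = Q'.b := Submodule.ext fun z => by rw [h.b_iff, h'.b_iff]
  have hi := h.ip_eq
  have hi' := h'.ip_eq
  have hβ := h.β_eq
  have hβ' := h'.β_eq
  clear h h'
  cases Q
  cases Q'
  obtain rfl : _ = _ := ha
  obtain rfl : _ = _ := hb
  congr 1
  · refine LinearMap.ext fun v => LinearMap.ext fun w => ?_
    obtain ⟨x, rfl⟩ := Submodule.Quotient.mk_surjective _ v
    obtain ⟨y, rfl⟩ := Submodule.Quotient.mk_surjective _ w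
    exact (hi x y).trans (hi' x y).symm
  · refine TensorProduct.ext' fun v w => ?_
    obtain ⟨x, rfl⟩ := Submodule.Quotient.mk_surjective _ v
    obtain ⟨z, rfl⟩ := Submodule.Quotient.mk_surjective _ w
    exact (hβ x z).trans (hβ' x z).symm

set_option maxHeartbeats 800000 in
-- The standard data of `ℝⁿ` are pulled back along `B`. On `k^⊥/ℝk` the form is a sum of squares,
-- and on `ℝk ⊗ ℝⁿ/k^⊥` it is the product of coordinate `0` of the first vector and coordinate `1`
-- of the second; `GN` preserves both, which gives the invariance under `Ad(H)`.
theorem exists_quadruple (hs : Function.Surjective B)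
    (hk : ∀ z, B z = 0 ↔ z ∈ subgroupLieAlg H)
    (hAd : ∀ k ∈ H, ∃ n ∈ GN m, ∀ z, B (Ad k z) = n (B z)) :
    ∃ Q : InvariantQuadruple E H, Adapted Q B := by
  let a : Submodule ℝ (LieAlg E K) := (Submodule.span ℝ {kvec m}).comap B
  let ℓ : LieAlg E K →ₗ[ℝ] ℝ := (etaL m (kvec m)).toLinearMap ∘ₗ B
  let b : Submodule ℝ (LieAlg E K) := ℓ.ker
  have hℓ : ∀ z, ℓ z = B z 1 := fun z => eta_kvec_left _
  have hb1 : ∀ x : b, B x 1 = 0 := fun x => (hℓ x).symm.trans x.2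
  have hha : subgroupLieAlg H ≤ a := fun z hz => by
    rw [← hk] at hz
    simp [a, hz]
  have hab : a ≤ b := fun z hz => by
    rw [LinearMap.mem_ker, hℓ]
    exact ((mem_span_kvec_iff _).1 hz).1
  let coord : Fin m → Mink m →ₗ[ℝ] ℝ := fun i => (EuclideanSpace.proj i.succ.succ).toLinearMap
  let g : (b ⧸ a.submoduleOf b) →ₗ[ℝ] Fin m → ℝ := (a.submoduleOf b).liftQ
    ((LinearMap.pi fun i => coord i ∘ₗ B) ∘ₗ b.subtype) (fun z hz => by
      ext i
      exact ((mem_span_kvec_iff _).1 hz).2 i)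
  have hg : ∀ (x : b) i, g (Submodule.Quotient.mk x) i = B x i.succ.succ := fun x i => rfl
  have hginj : ∀ v, g v = 0 → v = 0 := fun v hv => by
    obtain ⟨x, rfl⟩ := Submodule.Quotient.mk_surjective _ v
    refine (Submodule.Quotient.mk_eq_zero _).2 ((mem_span_kvec_iff _).2 ⟨hb1 x, fun i => ?_⟩)
    exact (hg x i).symm.trans (congrFun hv i)
  let ip : (b ⧸ a.submoduleOf b) →ₗ[ℝ] (b ⧸ a.submoduleOf b) →ₗ[ℝ] ℝ :=
    LinearMap.mk₂ ℝ (fun v w => ∑ i, g v i * g w i)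
      (fun v v' w => by simp [add_mul, Finset.sum_add_distrib])
      (fun c v w => by simp [Finset.mul_sum, mul_assoc])
      (fun v w w' => by simp [mul_add, Finset.sum_add_distrib])
      (fun c v w => by
        simp only [map_smul, Pi.smul_apply, smul_eq_mul, Finset.mul_sum]
        exact Finset.sum_congr rfl fun i _ => mul_left_comm _ _ _)
  have hipg : ∀ v w, ip v w = ∑ i, g v i * g w i := fun v w => rfl
  have hip : ∀ x y : b, ip (Submodule.Quotient.mk x) (Submodule.Quotient.mk y) =
      eta (B x) (B y) := fun x y => by rw [eta_of_perp (hb1 x) (hb1 y)]; rfl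
  let p : (a ⧸ (subgroupLieAlg H).submoduleOf a) →ₗ[ℝ] ℝ :=
    ((subgroupLieAlg H).submoduleOf a).liftQ
      ((EuclideanSpace.proj (0 : Fin (m + 2))).toLinearMap ∘ₗ B ∘ₗ a.subtype) (fun z hz => by
        have : B z = 0 := (hk _).2 hz
        simp [this])
  let q : (LieAlg E K ⧸ b) →ₗ[ℝ] ℝ := b.liftQ ℓ le_rfl
  let β : ((a ⧸ (subgroupLieAlg H).submoduleOf a) ⊗[ℝ] (LieAlg E K ⧸ b)) →ₗ[ℝ] ℝ :=
    LinearMap.mul' ℝ ℝ ∘ₗ TensorProduct.map p q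
  have hβ : ∀ (x : a) (z : LieAlg E K),
      β (Submodule.Quotient.mk x ⊗ₜ[ℝ] Submodule.Quotient.mk z) = eta (B x) (B z) := fun x z => by
    obtain ⟨h1, h2⟩ := (mem_span_kvec_iff _).1 x.2
    have h3 : β (Submodule.Quotient.mk x ⊗ₜ[ℝ] Submodule.Quotient.mk z) = B x 0 * ℓ z := rfl
    rw [h3, hℓ]
    simp [eta, h1, h2]
  obtain ⟨A, hA⟩ := hs (kvec m)
  have hAa : A ∈ a := by simp [a, hA, Submodule.mem_span_singleton_self]
  obtain ⟨z₀, hz₀⟩ := hs (EuclideanSpace.single 1 1)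
  have hAd_a : ∀ k ∈ H, ∀ z ∈ a, Ad k z ∈ a := fun k hkH z hz => by
    obtain ⟨n, hn, hnB⟩ := hAd k hkH
    have : B (Ad k z) ∈ Submodule.span ℝ {kvec m} := by
      rw [hnB, GN_apply_mem_span_iff hn]; exact hz
    exact this
  have hAd_b : ∀ k ∈ H, ∀ z ∈ b, Ad k z ∈ b := fun k hkH z hz => by
    obtain ⟨n, hn, hnB⟩ := hAd k hkH
    have : eta (kvec m) (B (Ad k z)) = 0 := by
      rw [hnB, IsGN.perp hn]; exact hz
    exact this
  have hfa : Module.finrank ℝ (a ⧸ (subgroupLieAlg H).submoduleOf a) = 1 := by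
    let f : a →ₗ[ℝ] Submodule.span ℝ {kvec m} := B.restrict fun z hz => hz
    have hf : Function.Surjective f := fun ⟨v, hv⟩ => by
      obtain ⟨z, rfl⟩ := hs v
      exact ⟨⟨z, hv⟩, rfl⟩
    have hker : (subgroupLieAlg H).submoduleOf a = f.ker := by
      ext z
      rw [LinearMap.mem_ker, ← Subtype.coe_inj]
      exact (hk z).symm
    rw [((Submodule.quotEquivOfEq _ _ hker).trans (f.quotKerEquivOfSurjective hf)).finrank_eq]
    exact finrank_span_singleton kvec_ne_zero
  have hfb : Module.finrank ℝ (LieAlg E K ⧸ b) = 1 := by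
    have hℓs : Function.Surjective ℓ := fun r => by
      obtain ⟨z, hz⟩ := hs (EuclideanSpace.single 1 r)
      exact ⟨z, by rw [hℓ, hz]; simp⟩
    rw [(ℓ.quotKerEquivOfSurjective hℓs).finrank_eq, Module.finrank_self]
  refine ⟨⟨a, b, hha, hab, hfa, hfb, hAd_a, hAd_b, ip, fun v w => ?_, fun v hv => ?_,
    fun k hkH x y => ?_, β, ?_, fun k hkH x z => ?_⟩, hs, hk, fun _ => Iff.rfl, fun _ => Iff.rfl,
    hip, hβ⟩
  · rw [hipg, hipg]
    exact Finset.sum_congr rfl fun i _ => mul_comm (g v i) (g w i)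
  · have h1 : 0 ≤ ∑ i, g v i * g v i := Finset.sum_nonneg fun i _ => mul_self_nonneg _
    rw [hipg]
    refine lt_of_le_of_ne h1 fun h2 => hv (hginj v ?_)
    have h3 := (Finset.sum_eq_zero_iff_of_nonneg fun i _ => mul_self_nonneg (g v i)).1 h2.symm
    exact funext fun i => mul_self_eq_zero.1 (h3 i (Finset.mem_univ i))
  · obtain ⟨n, hn, hnB⟩ := hAd k hkH
    rw [hip, hip, hnB, hnB]
    exact hn.2.1 _ _ x.2 y.2
  · intro h0
    have h1 := hβ ⟨A, hAa⟩ z₀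
    rw [h0, hA, hz₀, eta_kvec_left] at h1
    simp at h1
  · obtain ⟨n, hn, hnB⟩ := hAd k hkH
    rw [hβ, hβ, hnB, hnB]
    exact eta_GN_of_mem_span hn x.2 _

/-- Given that `𝔟` is a subalgebra, well-definedness of `ad A` on `𝔟/𝔞` need not be demanded
separately: it follows from skewness of the degenerate form on `𝔟`, whose radical is `𝔞`. -/
theorem Adapted.isKundt_iff (h : Adapted Q B) : Q.IsKundt ↔
    (∀ x ∈ Q.b, ∀ y ∈ Q.b, ⁅x, y⁆ ∈ Q.b) ∧
      ∀ A ∈ Q.a, ∀ x ∈ Q.b, ∀ y ∈ Q.b, eta (B ⁅A, x⁆) (B y) + eta (B x) (B ⁅A, y⁆) = 0 := by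
  refine and_congr_right fun hb => ⟨fun hD A hA x hx y hy => ?_, fun hS A hA => ?_⟩
  · obtain ⟨D, hD1, hD2⟩ := hD A hA
    have hAx := hb A (Q.a_le_b hA) x hx
    have hAy := hb A (Q.a_le_b hA) y hy
    have h1 := hD2 (Submodule.Quotient.mk ⟨x, hx⟩) (Submodule.Quotient.mk ⟨y, hy⟩)
    rw [hD1 ⟨x, hx⟩ ⟨_, hAx⟩ rfl, hD1 ⟨y, hy⟩ ⟨_, hAy⟩ rfl, h.ip_eq, h.ip_eq] at h1
    rw [h1, neg_add_cancel]
  · have : LieGroup 𝓘(ℝ, E) (minSmoothness ℝ 3) K := by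
      simpa using (inferInstance : LieGroup 𝓘(ℝ, E) 3 K)
    have : CompleteSpace E := FiniteDimensional.complete ℝ E
    let ad : Q.b →ₗ[ℝ] Q.b :=
      { toFun := fun x => ⟨⁅A, (x : LieAlg E K)⁆, hb A (Q.a_le_b hA) x x.2⟩
        map_add' := fun x y => Subtype.ext (lie_add A (x : LieAlg E K) y)
        map_smul' := fun c x => Subtype.ext (lie_smul c A (x : LieAlg E K)) }
    -- For `x ∈ 𝔞`, skewness with `y = [A, x]` gives `η(B[A,x], B[A,x]) = -η(Bx, B[A,[A,x]])`. This
    -- vanishes as `Bx ∈ ℝk` and `[A,[A,x]] ∈ 𝔟`, and definiteness modulo `k` puts `[A, x]` in `𝔞`.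
    have hada : Q.a.submoduleOf Q.b ≤ (Q.a.submoduleOf Q.b).comap ad := fun x hx => by
      have hAx := hb A (Q.a_le_b hA) x x.2
      have h1 := hS A hA x x.2 _ hAx
      have hxa : B x ∈ Submodule.span ℝ {kvec m} := (h.a_iff _).1 hx
      obtain ⟨c, hc⟩ := Submodule.mem_span_singleton.1 hxa
      rw [← hc, eta_smul_left, (h.b_iff _).1 (hb A (Q.a_le_b hA) _ hAx), mul_zero, add_zero] at h1
      refine (h.a_iff _).2 (mem_span_kvec_of_eta_self ?_ h1)
      rw [← eta_kvec_left]
      exact (h.b_iff _).1 hAx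
    refine ⟨(Q.a.submoduleOf Q.b).mapQ _ ad hada, fun x y hxy => ?_, fun v w => ?_⟩
    · rw [Submodule.mapQ_apply]
      congr 1
      exact Subtype.ext hxy.symm
    · obtain ⟨x, rfl⟩ := Submodule.Quotient.mk_surjective _ v
      obtain ⟨y, rfl⟩ := Submodule.Quotient.mk_surjective _ w
      rw [Submodule.mapQ_apply, Submodule.mapQ_apply, h.ip_eq, h.ip_eq]
      exact eq_neg_of_add_eq_zero_left (hS A hA x x.2 y y.2)

end Adapted

/-! ### The distributions `λ` and `Λ` in a single frame -/

section Frames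

variable {m : ℕ} {M : Type*} [TopologicalSpace M] [ChartedSpace (Mink m) M]
  [IsManifold 𝓘(ℝ, Mink m) ∞ M] {P : GStructure (GN m) M} {x : M}

theorem mem_nullLine_iff {u : Mink m ≃L[ℝ] TangentSpace 𝓘(ℝ, Mink m) x} (hu : u ∈ P.frames x)
    (w : TangentSpace 𝓘(ℝ, Mink m) x) :
    w ∈ nullLine P x ↔ u.symm w ∈ Submodule.span ℝ {kvec m} := by
  constructor
  · rintro ⟨u', hu', v, hv, rfl⟩
    obtain ⟨a, ha, rfl⟩ := P.exists_eq_comp x u hu u' hu'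
    have : u.symm (a.trans u v) = a v := u.symm_apply_apply (a v)
    rw [this, GN_apply_mem_span_iff ha]
    exact hv
  · exact fun h => ⟨u, hu, _, h, u.apply_symm_apply w⟩

theorem mem_nullPerp_iff {u : Mink m ≃L[ℝ] TangentSpace 𝓘(ℝ, Mink m) x} (hu : u ∈ P.frames x)
    (w : TangentSpace 𝓘(ℝ, Mink m) x) :
    w ∈ nullPerp P x ↔ eta (kvec m) (u.symm w) = 0 := by
  constructor
  · rintro ⟨u', hu', v, hv, rfl⟩
    obtain ⟨a, ha, rfl⟩ := P.exists_eq_comp x u hu u' hu'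
    have : u.symm (a.trans u v) = a v := u.symm_apply_apply (a v)
    rw [this, IsGN.perp ha]
    exact hv
  · exact fun h => ⟨u, hu, _, h, u.apply_symm_apply w⟩

theorem exists_mem_frames (P : GStructure (GN m) M) (x : M) : ∃ u, u ∈ P.frames x := by
  obtain ⟨U, -, hx, s, hs, -⟩ := P.exists_section x
  exact ⟨s x, hs x hx⟩

end Frames

/-! ### The bijection between invariant structures and quadruples -/

section Bijection

variable {E : Type*} [NormedAddCommGroup E] [NormedSpace ℝ E] [FiniteDimensional ℝ E]
  {K : Type*} [TopologicalSpace K] [ChartedSpace E K] [Group K] [LieGroup 𝓘(ℝ, E) ∞ K]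
  {H : Subgroup K} {m : ℕ} [ChartedSpace (Mink m) (K ⧸ H)]
  [IsManifold 𝓘(ℝ, Mink m) ∞ (K ⧸ H)]

/-- The map `𝔨 → ℝⁿ` given by `dπ` and a frame at the origin. -/
def frameMap (E : Type*) [NormedAddCommGroup E] [NormedSpace ℝ E]
    {K : Type*} [TopologicalSpace K] [ChartedSpace E K] [Group K]
    {H : Subgroup K} {m : ℕ} [ChartedSpace (Mink m) (K ⧸ H)]
    (u : Mink m ≃L[ℝ] TangentSpace 𝓘(ℝ, Mink m) ((1 : K) : K ⧸ H)) :
    LieAlg E K →ₗ[ℝ] Mink m :=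
  (u.symm : _ →L[ℝ] Mink m).toLinearMap ∘ₗ (dproj E H m).toLinearMap

theorem dproj_surjective
    (hπ : Manifold.IsSubmersion 𝓘(ℝ, E) 𝓘(ℝ, Mink m) ∞ (fun x : K => (x : K ⧸ H))) :
    Function.Surjective (dproj E H m) :=
  md_mk_surjective hπ 1

theorem dproj_eq_zero_iff
    (hπ : Manifold.IsSubmersion 𝓘(ℝ, E) 𝓘(ℝ, Mink m) ∞ (fun x : K => (x : K ⧸ H)))
    (z : LieAlg E K) : dproj E H m z = 0 ↔ z ∈ subgroupLieAlg H :=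
  (md_mk_eq_zero_iff hπ z).symm

theorem frameMap_surjective
    (hπ : Manifold.IsSubmersion 𝓘(ℝ, E) 𝓘(ℝ, Mink m) ∞ (fun x : K => (x : K ⧸ H)))
    (u : Mink m ≃L[ℝ] TangentSpace 𝓘(ℝ, Mink m) ((1 : K) : K ⧸ H)) :
    Function.Surjective (frameMap E u) :=
  u.symm.surjective.comp (dproj_surjective hπ)

theorem frameMap_eq_zero_iff
    (hπ : Manifold.IsSubmersion 𝓘(ℝ, E) 𝓘(ℝ, Mink m) ∞ (fun x : K => (x : K ⧸ H)))
    (u : Mink m ≃L[ℝ] TangentSpace 𝓘(ℝ, Mink m) ((1 : K) : K ⧸ H)) (z : LieAlg E K) :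
    frameMap E u z = 0 ↔ z ∈ subgroupLieAlg H :=
  (u.symm.map_eq_zero_iff (x := dproj E H m z)).trans (dproj_eq_zero_iff hπ z)

theorem corresponds_of_adapted {P : GStructure (GN m) (K ⧸ H)} {Q : InvariantQuadruple E H}
    {u : Mink m ≃L[ℝ] TangentSpace 𝓘(ℝ, Mink m) ((1 : K) : K ⧸ H)} (hu : u ∈ P.frames _)
    (h : Adapted Q (frameMap E u)) : Corresponds P Q := by
  have h' : ∀ u' ∈ P.frames ((1 : K) : K ⧸ H), Adapted Q (frameMap E u') := fun u' hu' => by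
    obtain ⟨a, ha, rfl⟩ := P.exists_eq_comp _ u hu u' hu'
    exact h.comp_GN ((GN m).inv_mem ha) fun z => rfl
  exact ⟨fun z => (h.a_iff z).trans (mem_nullLine_iff hu _).symm,
    fun z => (h.b_iff z).trans (mem_nullPerp_iff hu _).symm,
    fun u' hu' => (h' u' hu').ip_eq, fun u' hu' => (h' u' hu').β_eq⟩

theorem Corresponds.adapted {P : GStructure (GN m) (K ⧸ H)} {Q : InvariantQuadruple E H}
    (hπ : Manifold.IsSubmersion 𝓘(ℝ, E) 𝓘(ℝ, Mink m) ∞ (fun x : K => (x : K ⧸ H)))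
    (h : Corresponds P Q) {u : Mink m ≃L[ℝ] TangentSpace 𝓘(ℝ, Mink m) ((1 : K) : K ⧸ H)}
    (hu : u ∈ P.frames _) : Adapted Q (frameMap E u) :=
  ⟨frameMap_surjective hπ u, frameMap_eq_zero_iff hπ u,
    fun z => (h.a_iff z).trans (mem_nullLine_iff hu _),
    fun z => (h.b_iff z).trans (mem_nullPerp_iff hu _), h.ip_eq u hu, h.β_eq u hu⟩

theorem IsInvariantStructure.exists_frame {P : GStructure (GN m) (K ⧸ H)}
    (hP : IsInvariantStructure P) (g : K) {x y : K ⧸ H} (hxy : g • x = y)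
    {u : Mink m ≃L[ℝ] TangentSpace 𝓘(ℝ, Mink m) x} (hu : u ∈ P.frames x) :
    ∃ u' ∈ P.frames y, ∀ v : Mink m,
      u' v = md (Mink m) (Mink m) (fun y : K ⧸ H => g • y) x (u v) := by
  subst hxy
  exact hP g x u hu

theorem smul_mk_one (g : K) : g • ((1 : K) : K ⧸ H) = (g : K ⧸ H) :=
  congrArg (fun k : K => (k : K ⧸ H)) (mul_one g)

theorem inv_smul_mk (g : K) : g⁻¹ • (g : K ⧸ H) = ((1 : K) : K ⧸ H) :=
  congrArg (fun k : K => (k : K ⧸ H)) (inv_mul_cancel g)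

theorem smul_mk_one_of_mem {h : K} (hh : h ∈ H) :
    h • ((1 : K) : K ⧸ H) = ((1 : K) : K ⧸ H) := by
  rw [smul_mk_one, QuotientGroup.eq]
  simpa using hh

/-- For `h ∈ H` the translate of a frame `u` at the origin is again a frame there, hence `u ∘ n`
with `n ∈ GN`. So `Ad h` acts through `GN` in the frame, as `exists_quadruple` requires. -/
theorem existsUnique_quadruple
    (hπ : Manifold.IsSubmersion 𝓘(ℝ, E) 𝓘(ℝ, Mink m) ∞ (fun x : K => (x : K ⧸ H)))
    {P : GStructure (GN m) (K ⧸ H)} (hP : IsInvariantStructure P) :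
    ∃! Q : InvariantQuadruple E H, Corresponds P Q := by
  have := contMDiffSMul_quotient hπ
  obtain ⟨u, hu⟩ := exists_mem_frames P ((1 : K) : K ⧸ H)
  obtain ⟨Q, hQ⟩ := exists_quadruple (H := H) (B := frameMap E u) (frameMap_surjective hπ u)
    (frameMap_eq_zero_iff hπ u) (fun k hk => by
      obtain ⟨u', hu', hk'⟩ := hP.exists_frame k (smul_mk_one_of_mem hk) hu
      obtain ⟨n, hn, rfl⟩ := P.exists_eq_comp _ u hu u' hu'
      refine ⟨n, hn, fun z => ?_⟩
      have h1 := hk' (frameMap E u z)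
      have h2 : u (frameMap E u z) = dproj E H m z := u.apply_symm_apply _
      have h3 : u (n (frameMap E u z)) = dproj E H m (Ad k z) :=
        (h1.trans (congrArg (md (Mink m) (Mink m) (fun y : K ⧸ H => k • y) _) h2)).trans
          (md_smul_md_mk_one hπ.contMDiff hk z)
      exact (u.symm_apply_eq.2 h3.symm))
  refine ⟨Q, corresponds_of_adapted hu hQ, fun Q' hQ' => (hQ'.adapted hπ hu).eq hQ⟩

/-- Injectivity: a frame is translated to the origin, where both structures give maps adapted to `Q`
and so the same `GN`-orbit of frames, and translated back. -/
theorem frames_subset_of_corresponds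
    (hπ : Manifold.IsSubmersion 𝓘(ℝ, E) 𝓘(ℝ, Mink m) ∞ (fun x : K => (x : K ⧸ H)))
    {P P' : GStructure (GN m) (K ⧸ H)} (hP : IsInvariantStructure P)
    (hP' : IsInvariantStructure P') {Q : InvariantQuadruple E H} (h : Corresponds P Q)
    (h' : Corresponds P' Q) (x : K ⧸ H) : P.frames x ⊆ P'.frames x := by
  have := contMDiffSMul_quotient hπ
  intro u hu
  obtain ⟨g, rfl⟩ := QuotientGroup.mk_surjective x
  obtain ⟨u₁, hu₁, h₁⟩ := hP.exists_frame g⁻¹ (inv_smul_mk g) hu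
  obtain ⟨u₂, hu₂⟩ := exists_mem_frames P' ((1 : K) : K ⧸ H)
  obtain ⟨n, hn, hnB⟩ := (h.adapted hπ hu₁).exists_GN (h'.adapted hπ hu₂)
  have h₂ : u₁ = n.trans u₂ := by
    refine ContinuousLinearEquiv.ext (funext fun v => ?_)
    obtain ⟨z, rfl⟩ := frameMap_surjective (E := E) hπ u₁ v
    have h3 : u₁ (frameMap E u₁ z) = dproj E H m z := u₁.apply_symm_apply _
    have h4 : u₂ (frameMap E u₂ z) = dproj E H m z := u₂.apply_symm_apply _
    rw [h3, ← h4, ← hnB]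
    rfl
  have h₃ : u₁ ∈ P'.frames ((1 : K) : K ⧸ H) := h₂ ▸ P'.comp_mem _ u₂ hu₂ n hn
  obtain ⟨u₄, hu₄, h₄⟩ := hP'.exists_frame g (smul_mk_one g) h₃
  have h₅ : u = u₄ := by
    refine ContinuousLinearEquiv.ext (funext fun v => ?_)
    refine ((h₄ v).trans ?_).symm
    have h6 := md_smul_md_inv_smul E (Mink m) g ((1 : K) : K ⧸ H) (u v)
    rw [smul_mk_one] at h6
    exact (congrArg (md (Mink m) (Mink m) (fun y : K ⧸ H => g • y) _) (h₁ v)).trans h6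
  rw [h₅]
  exact hu₄

/-- The derivative of a translation of `K/H` as a linear isomorphism. -/
def translationEquiv [ContMDiffSMul 𝓘(ℝ, E) 𝓘(ℝ, Mink m) ∞ K (K ⧸ H)] (g : K) (x : K ⧸ H) :
    Mink m ≃L[ℝ] Mink m :=
  ContinuousLinearEquiv.equivOfInverse (md (Mink m) (Mink m) (fun y : K ⧸ H => g • y) x)
    (md (Mink m) (Mink m) (fun y : K ⧸ H => g⁻¹ • y) (g • x))
    (md_inv_smul_md_smul E (Mink m) g x) (md_smul_md_inv_smul E (Mink m) g x)

theorem tangentBundle_mk_congr {V : Type*} [NormedAddCommGroup V] [NormedSpace ℝ V] {M : Type*}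
    [TopologicalSpace M] [ChartedSpace V M] {x y : M} (h : x = y) (w : V) :
    (⟨x, w⟩ : TangentBundle 𝓘(ℝ, V) M) = ⟨y, w⟩ := by
  subst h; rfl

/-- Surjectivity: the frames over `gH` are the maps `dL_g ∘ u₀ ∘ n` with `n ∈ GN`, where `u₀ ∘ B =
dπ` for an adapted `B`. Local sections of `π` provide smooth local frames. -/
theorem exists_invariantStructure
    (hπ : Manifold.IsSubmersion 𝓘(ℝ, E) 𝓘(ℝ, Mink m) ∞ (fun x : K => (x : K ⧸ H)))
    (Q : InvariantQuadruple E H) :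
    ∃ P : GStructure (GN m) (K ⧸ H), IsInvariantStructure P ∧ Corresponds P Q := by
  have := contMDiffSMul_quotient hπ
  obtain ⟨B, hB⟩ := exists_adapted Q (p := (dproj E H m).toLinearMap) (dproj_surjective hπ)
    (dproj_eq_zero_iff hπ)
  obtain ⟨u₀, hu₀⟩ : ∃ n : Mink m ≃L[ℝ] Mink m, ∀ z, n (B z) = dproj E H m z :=
    exists_continuousLinearEquiv_of_ker_eq (B' := (dproj E H m).toLinearMap) hB.surjective
      (dproj_surjective hπ) fun z => (hB.eq_zero_iff z).trans (dproj_eq_zero_iff hπ z).symm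
  let D : K → K ⧸ H → Mink m →L[ℝ] Mink m := fun g x =>
    md (Mink m) (Mink m) (fun y : K ⧸ H => g • y) x
  let o : K ⧸ H := ((1 : K) : K ⧸ H)
  -- The isotropy action lies in `GN` when read in `u₀`, because `B ∘ Ad k` is adapted to the same
  -- quadruple. Hence another representative of the coset `gH` yields the same orbit of frames.
  have hiso : ∀ k ∈ H, ∃ n ∈ GN m, ∀ v, D k o (u₀ v) = u₀ (n v) := fun k hk => by
    have h1 : ∀ z, D k o (dproj E H m z) = dproj E H m (Ad k z) :=
      md_smul_md_mk_one hπ.contMDiff hk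
    have hs : Function.Surjective (B ∘ₗ (Ad (E := E) k).toLinearMap) := fun v => by
      obtain ⟨z, rfl⟩ := hB.surjective v
      refine ⟨Ad k⁻¹ z, ?_⟩
      have := Ad_inv_Ad (E := E) k⁻¹ z
      rw [inv_inv] at this
      exact congrArg B this
    obtain ⟨n, hn, hnB⟩ := hB.exists_GN (hB.comp_Ad (B' := B ∘ₗ (Ad (E := E) k).toLinearMap) hk
      (fun _ => rfl) hs fun z => by
        have h2 : u₀ (B (Ad k z)) = D k o (dproj E H m z) := (hu₀ _).trans (h1 z).symm
        have h3 : B (Ad k z) = 0 ↔ u₀ (B (Ad k z)) = 0 := (u₀.map_eq_zero_iff).symm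
        refine h3.trans ((by rw [h2] : _ ↔ D k o (dproj E H m z) = 0).trans ?_)
        rw [← dproj_eq_zero_iff hπ]
        exact (translationEquiv (E := E) k o).map_eq_zero_iff (x := dproj E H m z))
    refine ⟨n, hn, fun v => ?_⟩
    obtain ⟨z, rfl⟩ := hB.surjective v
    rw [hnB]
    exact ((congrArg (D k o) (hu₀ z)).trans (h1 z)).trans (hu₀ _).symm
  let F : ∀ x : K ⧸ H, Set (Mink m ≃L[ℝ] Mink m) := fun x =>
    {u | ∃ g : K, (g : K ⧸ H) = x ∧ ∃ n ∈ GN m, ∀ v, u v = D g o (u₀ (n v))}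
  have hF : ∀ (x : K ⧸ H) (u u' : Mink m ≃L[ℝ] Mink m), u ∈ F x → u' ∈ F x →
      ∃ a ∈ GN m, u' = a.trans u := by
    rintro x u u' ⟨g, rfl, n, hn, hu⟩ ⟨g', hg', n', hn', hu'⟩
    have hk : g⁻¹ * g' ∈ H := QuotientGroup.eq.1 hg'.symm
    obtain ⟨l, hl, hlu⟩ := hiso _ hk
    refine ⟨n⁻¹ * l * n', mul_mem (mul_mem (inv_mem hn) hl) hn', ?_⟩
    refine ContinuousLinearEquiv.ext (funext fun v => ?_)
    have h1 := md_mul_smul E (Mink m) g (g⁻¹ * g') o (u₀ (n' v))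
    rw [mul_inv_cancel_left, smul_mk_one_of_mem hk] at h1
    refine (hu' v).trans (h1.trans ?_)
    refine (congrArg (D g o) (hlu (n' v))).trans ?_
    have h2 : n ((n⁻¹ * l * n') v) = l (n' v) := n.apply_symm_apply _
    refine Eq.trans ?_ (hu ((n⁻¹ * l * n') v)).symm
    rw [h2]
  let P : GStructure (GN m) (K ⧸ H) :=
    { frames := F
      comp_mem := by
        rintro x u ⟨g, hg, n, hn, hu⟩ a ha
        exact ⟨g, hg, n * a, mul_mem hn ha, fun v => hu (a v)⟩
      exists_eq_comp := fun x u hu u' hu' => hF x u u' hu hu'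
      exists_section := fun x => by
        obtain ⟨g, rfl⟩ := QuotientGroup.mk_surjective x
        obtain ⟨U, hU, hgU, σ, hσ, hσU, -⟩ := exists_local_section hπ g
        refine ⟨U, hU, hgU, fun y => u₀.trans (translationEquiv (E := E) (σ y) o), fun y hy =>
          ⟨σ y, hσU y hy, 1, one_mem _, fun v => rfl⟩, fun v y hy => ?_⟩
        refine ContMDiffAt.contMDiffWithinAt ?_
        have h1 : ContMDiffAt 𝓘(ℝ, Mink m) 𝓘(ℝ, Mink m).tangent ∞
            (fun _ : K ⧸ H => (⟨o, u₀ v⟩ : TangentBundle 𝓘(ℝ, Mink m) (K ⧸ H))) y :=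
          contMDiffAt_const
        refine (contMDiffAt_md_smul E (Mink m) (n := ⊤) (hσ.contMDiffAt (hU.mem_nhds hy))
          (f := fun _ => o) (z := fun _ => u₀ v) h1).congr_of_eventuallyEq ?_
        filter_upwards [hU.mem_nhds hy] with z hz
        exact tangentBundle_mk_congr ((hσU z hz).symm.trans (smul_mk_one _).symm) _ }
  refine ⟨P, ?_, ?_⟩
  · rintro g x u ⟨g', rfl, n, hn, hu⟩
    refine ⟨(u : Mink m ≃L[ℝ] Mink m).trans (translationEquiv (E := E) g (g' : K ⧸ H)),
      ⟨g * g', rfl, n, hn, fun v => ?_⟩, fun v => rfl⟩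
    have h1 := md_mul_smul E (Mink m) g g' o (u₀ (n v))
    rw [smul_mk_one] at h1
    exact (congrArg (D g (g' : K ⧸ H)) (hu v)).trans h1.symm
  · have hu₀' : u₀ ∈ F o := ⟨1, rfl, 1, one_mem _, fun v => (md_one_smul (Mink m) K o (u₀ v)).symm⟩
    refine corresponds_of_adapted (u := u₀) hu₀' ?_
    refine hB.comp_GN (one_mem _) fun z => ?_
    exact u₀.symm_apply_eq.2 (hu₀ z).symm

theorem exists_equiv_quadruples
    (hπ : Manifold.IsSubmersion 𝓘(ℝ, E) 𝓘(ℝ, Mink m) ∞ (fun x : K => (x : K ⧸ H))) :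
    ∃ Φ : {P : GStructure (GN m) (K ⧸ H) // IsInvariantStructure P} ≃ InvariantQuadruple E H,
      ∀ P Q, Φ P = Q ↔ Corresponds P.1 Q := by
  choose f hf hfu using fun P : {P : GStructure (GN m) (K ⧸ H) // IsInvariantStructure P} =>
    existsUnique_quadruple (E := E) hπ P.2
  refine ⟨Equiv.ofBijective f ⟨fun P P' h => ?_, fun Q => ?_⟩, fun P Q => ?_⟩
  · have h1 := hf P
    have h2 := hf P'
    rw [← h] at h2
    refine Subtype.ext (GStructure.ext (funext fun x => Set.Subset.antisymm ?_ ?_))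
    · exact frames_subset_of_corresponds hπ P.2 P'.2 h1 h2 x
    · exact frames_subset_of_corresponds hπ P'.2 P.2 h2 h1 x
  · obtain ⟨P, hP, hPQ⟩ := exists_invariantStructure hπ Q
    exact ⟨⟨P, hP⟩, (hfu ⟨P, hP⟩ Q hPQ).symm⟩
  · constructor
    · rintro rfl
      exact hf P
    · exact fun h => (hfu P Q h).symm

end Bijection

/-! ### Product rule for operator-valued functions -/

section ClmApply

variable {E : Type*} [NormedAddCommGroup E] [NormedSpace ℝ E] [FiniteDimensional ℝ E]
  {D : Type*} [NormedAddCommGroup D] [NormedSpace ℝ D]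
  {F : Type*} [NormedAddCommGroup F] [NormedSpace ℝ F]
  {M : Type*} [TopologicalSpace M] [ChartedSpace D M] [IsManifold 𝓘(ℝ, D) ∞ M]

/-- In finite dimension an operator is a finite tuple of its values on a basis, so pointwise
differentiability suffices. -/
theorem differentiableAt_of_clm_apply {f : D → E →L[ℝ] F} {x : D}
    (h : ∀ A, DifferentiableAt ℝ (fun y => f y A) x) : DifferentiableAt ℝ f x := by
  let d := Module.finrank ℝ E
  have hd : d = Module.finrank ℝ (Fin d → ℝ) := (Module.finrank_fin_fun ℝ).symm
  let e₁ := ContinuousLinearEquiv.ofFinrankEq hd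
  let e₂ := (e₁.arrowCongr (1 : F ≃L[ℝ] F)).trans (ContinuousLinearEquiv.piRing (Fin d))
  rw [← Function.id_comp f, ← e₂.symm_comp_self]
  exact e₂.symm.differentiableAt.comp x (differentiableAt_pi.2 fun i => h _)

theorem mdifferentiableAt_of_clm_apply {f : M → E →L[ℝ] F} {x : M}
    (h : ∀ A, MDifferentiableAt 𝓘(ℝ, D) 𝓘(ℝ, F) (fun y => f y A) x) :
    MDifferentiableAt 𝓘(ℝ, D) 𝓘(ℝ, E →L[ℝ] F) f x :=
  mdifferentiableAt_of_comp_chart_symm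
    (differentiableAt_of_clm_apply fun A => differentiableAt_comp_chart_symm (h A))

theorem MDifferentiableAt.clm_apply' {f : M → E →L[ℝ] F} {ζ : M → E} {x : M}
    (h : ∀ A, MDifferentiableAt 𝓘(ℝ, D) 𝓘(ℝ, F) (fun y => f y A) x)
    (hζ : MDifferentiableAt 𝓘(ℝ, D) 𝓘(ℝ, E) ζ x) :
    MDifferentiableAt 𝓘(ℝ, D) 𝓘(ℝ, F) (fun y => f y (ζ y)) x :=
  mdifferentiableAt_of_comp_chart_symm (DifferentiableAt.clm_apply
    (differentiableAt_comp_chart_symm (mdifferentiableAt_of_clm_apply h))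
    (differentiableAt_comp_chart_symm hζ))

theorem md_clm_apply {f : M → E →L[ℝ] F} {ζ : M → E} {x : M}
    (h : ∀ A, MDifferentiableAt 𝓘(ℝ, D) 𝓘(ℝ, F) (fun y => f y A) x)
    (hζ : MDifferentiableAt 𝓘(ℝ, D) 𝓘(ℝ, E) ζ x) (w : D) :
    md D F (fun y => f y (ζ y)) x w =
      f x (md D E ζ x w) + md D F (fun y => f y (ζ x)) x w := by
  have hf := differentiableAt_comp_chart_symm (mdifferentiableAt_of_clm_apply h)
  have hz := differentiableAt_comp_chart_symm hζ
  rw [md_eq_fderiv_chart (MDifferentiableAt.clm_apply' h hζ), md_eq_fderiv_chart hζ,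
    md_eq_fderiv_chart (h _)]
  have h1 := fderiv_clm_apply hf hz
  have h2 := fderiv_clm_apply (u := fun _ => ζ x) hf (differentiableAt_const _)
  refine (congrArg (fun L : D →L[ℝ] F => L w) h1).trans
    (Eq.trans ?_ (congrArg (fun L : D →L[ℝ] F => _ + L w) h2).symm)
  simp

end ClmApply

/-! ### Vector fields on a Lie group in the left invariant framing -/

section LieGroupFields

variable {E : Type*} [NormedAddCommGroup E] [NormedSpace ℝ E] [FiniteDimensional ℝ E]
  {K : Type*} [TopologicalSpace K] [ChartedSpace E K] [Group K] [LieGroup 𝓘(ℝ, E) ∞ K]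

/-- The derivative at the identity of left translation by `g`. -/
def Lm (E : Type*) [NormedAddCommGroup E] [NormedSpace ℝ E] {K : Type*} [TopologicalSpace K]
    [ChartedSpace E K] [Group K] (g : K) : E →L[ℝ] E :=
  md E E (fun k : K => g * k) 1

/-- The vector field on `K` whose coefficient in the left invariant framing is `ξ`. -/
def lfield (ξ : K → E) (g : K) : TangentSpace 𝓘(ℝ, E) g := Lm E g (ξ g)

theorem contMDiffAt_Lm {F : Type*} [NormedAddCommGroup F] [NormedSpace ℝ F]
    {HN : Type*} [TopologicalSpace HN] {J : ModelWithCorners ℝ F HN}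
    {N : Type*} [TopologicalSpace N] [ChartedSpace HN N] {n : ℕ∞} {q : N} {k : N → K}
    (hk : ContMDiffAt J 𝓘(ℝ, E) n k q) {z : N → E} (hz : ContMDiffAt J 𝓘(ℝ, E) n z q) :
    ContMDiffAt J 𝓘(ℝ, E).tangent n
      (fun p => (⟨k p, Lm E (k p) (z p)⟩ : TangentBundle 𝓘(ℝ, E) K)) q := by
  have h := contMDiffAt_md_partial E E (a := fun p : K × K => p.1 * p.2)
    (contMDiff_mul 𝓘(ℝ, E) ∞) hk (f := fun _ => (1 : K)) (z := z)
    (contMDiffAt_tangentBundle_const_iff.2 hz)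
  exact h.congr_of_eventuallyEq
    (Filter.Eventually.of_forall fun p => tangentBundle_mk_congr (mul_one _).symm _)

theorem contMDiffAt_md_chart_Lm (x : K) {n : ℕ∞} (A : E) :
    ContMDiffAt 𝓘(ℝ, E) 𝓘(ℝ, E) n
      (fun y : K => (md E E (extChartAt 𝓘(ℝ, E) x) y ∘L Lm E y) A) x :=
  (contMDiffAt_tangentBundle_iff.1 (contMDiffAt_Lm (k := fun y : K => y) (q := x)
    contMDiffAt_id (contMDiffAt_const (c := A)))).2

theorem mdifferentiableAt_lfield {ξ : K → E} {g : K}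
    (hξ : MDifferentiableAt 𝓘(ℝ, E) 𝓘(ℝ, E) ξ g) :
    MDifferentiableAt 𝓘(ℝ, E) 𝓘(ℝ, E).tangent
      (fun y => (⟨y, lfield ξ y⟩ : TangentBundle 𝓘(ℝ, E) K)) g := by
  refine mdifferentiableAt_tangentBundle_iff.2 ⟨mdifferentiableAt_id, ?_⟩
  exact MDifferentiableAt.clm_apply'
    (f := fun y : K => md E E (extChartAt 𝓘(ℝ, E) g) y ∘L Lm E y) (fun A => (contMDiffAt_md_chart_Lm (n := 1) g A).mdifferentiableAt (by simp)) hξ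

/-- The bracket of the Lie algebra of `K`, on the model space. -/
def brk (K : Type*) [TopologicalSpace K] [ChartedSpace E K] [Group K] (A B : E) : E :=
  @Bracket.bracket (LieAlg E K) (LieAlg E K) _ A B

theorem brk_add_left (A A' B : E) : brk K (A + A') B = brk K A B + brk K A' B := by
  have : LieGroup 𝓘(ℝ, E) (minSmoothness ℝ 3) K := by
    simpa using (inferInstance : LieGroup 𝓘(ℝ, E) 3 K)
  have : CompleteSpace E := FiniteDimensional.complete ℝ E
  exact add_lie (L := LieAlg E K) (M := LieAlg E K) A A' B

theorem brk_smul_left (c : ℝ) (A B : E) : brk K (c • A) B = c • brk K A B := by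
  have : LieGroup 𝓘(ℝ, E) (minSmoothness ℝ 3) K := by
    simpa using (inferInstance : LieGroup 𝓘(ℝ, E) 3 K)
  have : CompleteSpace E := FiniteDimensional.complete ℝ E
  exact smul_lie (R := ℝ) (L := LieAlg E K) (M := LieAlg E K) c A B

variable (K) in
/-- The bracket with `A` as a continuous linear map of the model space. -/
def adL (A : E) : E →L[ℝ] E :=
  have : LieGroup 𝓘(ℝ, E) (minSmoothness ℝ 3) K := by
    simpa using (inferInstance : LieGroup 𝓘(ℝ, E) 3 K)
  have : CompleteSpace E := FiniteDimensional.complete ℝ E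
  LinearMap.toContinuousLinearMap
    { toFun := brk K A
      map_add' := fun B B' => lie_add (L := LieAlg E K) (M := LieAlg E K) A B B'
      map_smul' := fun c B => lie_smul (R := ℝ) (L := LieAlg E K) (M := LieAlg E K) c A B }

theorem adL_apply (A B : E) : adL K A B = brk K A B := rfl

theorem mlieBracket_lfield_const (A B : E) (g : K) :
    VectorField.mlieBracket 𝓘(ℝ, E) (lfield fun _ : K => A) (lfield fun _ => B) g =
      Lm E g (brk K A B) := by
  have : LieGroup 𝓘(ℝ, E) (minSmoothness ℝ 3) K := by
    simpa using (inferInstance : LieGroup 𝓘(ℝ, E) 3 K)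
  have : CompleteSpace E := FiniteDimensional.complete ℝ E
  exact (congrFun (mulInvariantVector_mlieBracket (I := 𝓘(ℝ, E)) (G := K) A B) g).symm

/-- The chart formula for the bracket splits by the product rule into derivatives of the
coefficients and derivatives of the framing. The second kind depends only on the values `ξ g` and `ζ
g`, so it agrees with the bracket of the constant-coefficient fields, which is left invariant. -/
theorem mlieBracket_lfield {ξ ζ : K → E} {g : K} (hξ : MDifferentiableAt 𝓘(ℝ, E) 𝓘(ℝ, E) ξ g)
    (hζ : MDifferentiableAt 𝓘(ℝ, E) 𝓘(ℝ, E) ζ g) :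
    VectorField.mlieBracket 𝓘(ℝ, E) (lfield ξ) (lfield ζ) g =
      Lm E g (md E E ζ g (Lm E g (ξ g)) - md E E ξ g (Lm E g (ζ g)) +
        brk K (ξ g) (ζ g)) := by
  have : CompleteSpace E := FiniteDimensional.complete ℝ E
  let f : K → E := extChartAt 𝓘(ℝ, E) g
  let Φ : K → E →L[ℝ] E := fun y => md E E f y ∘L Lm E y
  have hf : ContMDiffAt 𝓘(ℝ, E) 𝓘(ℝ, E) 2 f g := contMDiffAt_extChartAt
  have hΦ : ∀ A, MDifferentiableAt 𝓘(ℝ, E) 𝓘(ℝ, E) (fun y => Φ y A) g := fun A =>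
    (contMDiffAt_md_chart_Lm (n := 1) g A).mdifferentiableAt (by simp)
  have hfg : md E E f g = ContinuousLinearMap.id ℝ E := md_chart_self g
  have hΦg : ∀ w, Φ g w = Lm E g w := fun w =>
    congrArg (fun L : E →L[ℝ] E => L (Lm E g w)) hfg
  have key : ∀ (ξ ζ : K → E), MDifferentiableAt 𝓘(ℝ, E) 𝓘(ℝ, E) ξ g →
      MDifferentiableAt 𝓘(ℝ, E) 𝓘(ℝ, E) ζ g →
      (VectorField.mlieBracket 𝓘(ℝ, E) (lfield ξ) (lfield ζ) g : E) =
        Lm E g (md E E ζ g (Lm E g (ξ g))) + md E E (fun y => Φ y (ζ g)) g (Lm E g (ξ g)) -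
        (Lm E g (md E E ξ g (Lm E g (ζ g))) + md E E (fun y => Φ y (ξ g)) g (Lm E g (ζ g))) := by
    intro ξ ζ hξ hζ
    have h1 := md_mlieBracket hf (mdifferentiableAt_lfield hξ) (mdifferentiableAt_lfield hζ)
    have h2 : (VectorField.mlieBracket 𝓘(ℝ, E) (lfield ξ) (lfield ζ) g : E) =
      md E E f g (VectorField.mlieBracket 𝓘(ℝ, E) (lfield ξ) (lfield ζ) g) :=
        (congrArg (fun L : E →L[ℝ] E =>
          L (VectorField.mlieBracket 𝓘(ℝ, E) (lfield ξ) (lfield ζ) g)) hfg).symm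
    refine h2.trans (h1.trans ?_)
    have h3 := md_clm_apply hΦ hζ (Lm E g (ξ g))
    have h4 := md_clm_apply hΦ hξ (Lm E g (ζ g))
    rw [hΦg] at h3 h4
    exact congrArg₂ (fun a b : E => a - b) h3 h4
  have h5 := key (fun _ => ξ g) (fun _ => ζ g) mdifferentiableAt_const mdifferentiableAt_const
  have h6 := key ξ ζ hξ hζ
  have h7 : (VectorField.mlieBracket 𝓘(ℝ, E) (lfield fun _ : K => ξ g) (lfield fun _ => ζ g) g : E)
    = _ := mlieBracket_lfield_const (ξ g) (ζ g) g
  simp only [md_const, zero_apply, map_zero, zero_add] at h5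
  refine h6.trans ?_
  rw [map_add, map_sub, ← h7, h5]
  abel

end LieGroupFields

/-! ### Right invariant fields and the derivative of `Ad(g⁻¹)` -/

section AdInverse

variable {E : Type*} [NormedAddCommGroup E] [NormedSpace ℝ E] [FiniteDimensional ℝ E]
  {K : Type*} [TopologicalSpace K] [ChartedSpace E K] [Group K] [LieGroup 𝓘(ℝ, E) ∞ K]

/-- `Ad(g⁻¹)` on the model space. -/
def adInv (E : Type*) [NormedAddCommGroup E] [NormedSpace ℝ E] {K : Type*} [TopologicalSpace K]
    [ChartedSpace E K] [Group K] (g : K) : E →L[ℝ] E :=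
  md E E (fun x : K => g⁻¹ * x * g⁻¹⁻¹) 1

theorem contMDiff_adInv (z : E) :
    ContMDiff 𝓘(ℝ, E) 𝓘(ℝ, E) ∞ (fun g : K => adInv E g z) := by
  intro g
  have hc : ContMDiff (𝓘(ℝ, E).prod 𝓘(ℝ, E)) 𝓘(ℝ, E) ∞
      (fun p : K × K => p.1⁻¹ * p.2 * p.1⁻¹⁻¹) :=
    (contMDiff_fst.inv.mul contMDiff_snd).mul contMDiff_fst.inv.inv
  have h := contMDiffAt_md_partial E E (J := 𝓘(ℝ, E)) (n := ⊤) (q := g) hc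
    (k := fun g => g) contMDiffAt_id (f := fun _ => (1 : K)) (z := fun _ => z)
    (contMDiffAt_tangentBundle_const_iff.2 contMDiffAt_const)
  refine (contMDiffAt_tangentBundle_const_iff (x := (1 : K))).1 (h.congr_of_eventuallyEq
    (Filter.Eventually.of_forall fun p => ?_))
  exact tangentBundle_mk_congr (by simp) _

theorem mdifferentiableAt_mul_left (g x : K) :
    MDifferentiableAt 𝓘(ℝ, E) 𝓘(ℝ, E) (fun k : K => g * k) x :=
  (contMDiff_mul_left (I := 𝓘(ℝ, E)) (n := ∞) (a := g)).mdifferentiableAt (by simp)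

theorem mdifferentiableAt_mul_right (g x : K) :
    MDifferentiableAt 𝓘(ℝ, E) 𝓘(ℝ, E) (fun k : K => k * g) x :=
  (contMDiff_mul_right (I := 𝓘(ℝ, E)) (n := ∞) (a := g)).mdifferentiableAt (by simp)

/-- The right invariant field of `z` has coefficient `Ad(g⁻¹) z` in the left invariant framing. -/
theorem Lm_adInv (g : K) (z : E) :
    Lm E g (adInv E g z) = md E E (fun k : K => k * g) 1 z := by
  have hc : ContMDiff 𝓘(ℝ, E) 𝓘(ℝ, E) ∞ (fun x : K => g⁻¹ * x * g⁻¹⁻¹) :=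
    (contMDiff_mul_right (a := g⁻¹⁻¹)).comp (contMDiff_mul_left (a := g⁻¹))
  have h := md_comp_apply (E := E) (E' := E) (E'' := E) (g := fun k : K => g * k)
    (f := fun x : K => g⁻¹ * x * g⁻¹⁻¹) 1 (mdifferentiableAt_mul_left g _)
    (hc.mdifferentiableAt (by simp)) z
  have h1 : (fun y : K => g * (g⁻¹ * y * g⁻¹⁻¹)) = fun y => y * g := by funext y; group
  have h2 : g⁻¹ * 1 * g⁻¹⁻¹ = 1 := by group
  rw [h1, h2] at h
  exact h.symm

theorem Lm_mul (g h : K) (A : E) : Lm E (g * h) A = md E E (fun k : K => g * k) h (Lm E h A) := by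
  have h1 := md_comp_apply (E := E) (E' := E) (E'' := E) (g := fun k : K => g * k)
    (f := fun x : K => h * x) 1 (mdifferentiableAt_mul_left g _) (mdifferentiableAt_mul_left h _) A
  simp only [← mul_assoc, mul_one] at h1
  exact h1

theorem Lm_one (A : E) : Lm E (1 : K) A = A := by
  unfold Lm
  simp only [one_mul, md_id]
  rfl

theorem md_inv_mul_Lm (g : K) (A : E) : md E E (fun k : K => g⁻¹ * k) g (Lm E g A) = A := by
  rw [← Lm_mul, inv_mul_cancel, Lm_one]

theorem Lm_md_inv_mul (g : K) (w : E) : Lm E g (md E E (fun k : K => g⁻¹ * k) g w) = w := by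
  have h1 := md_comp_apply (E := E) (E' := E) (E'' := E) (g := fun k : K => g * k)
    (f := fun x : K => g⁻¹ * x) g (mdifferentiableAt_mul_left g _)
    (mdifferentiableAt_mul_left g⁻¹ _) w
  simp only [mul_inv_cancel_left, inv_mul_cancel, md_id] at h1
  exact h1.symm

/-- Symmetry of second derivatives, with `P` and `Q` known expressions for the two partial
derivatives along the axes. It yields both the commutation of left and right translations and the
linearization of a flow. -/
theorem differentiableAt_of_mixed_partials {E₁ E₂ F : Type*} [NormedAddCommGroup E₁]
    [NormedSpace ℝ E₁] [NormedAddCommGroup E₂] [NormedSpace ℝ E₂] [NormedAddCommGroup F]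
    [NormedSpace ℝ F] {G : E₁ × E₂ → F} {P : E₁ → F} {Q : E₂ → F} {a₀ z : E₁} {b₀ A : E₂}
    (hG : ContDiffAt ℝ 2 G (a₀, b₀))
    (hP : ∀ᶠ a in 𝓝 a₀, fderiv ℝ G (a, b₀) (0, A) = P a)
    (hQ : ∀ᶠ b in 𝓝 b₀, fderiv ℝ G (a₀, b) (z, 0) = Q b) :
    DifferentiableAt ℝ P a₀ ∧ fderiv ℝ P a₀ z = fderiv ℝ Q b₀ A := by
  have hs := hG.isSymmSndFDerivAt (by simp)
  have hd : DifferentiableAt ℝ (fderiv ℝ G) (a₀, b₀) :=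
    (hG.fderiv_right (m := 1) (by norm_num)).differentiableAt (by simp)
  have h1 : HasFDerivAt P (((fderiv ℝ (fderiv ℝ G) (a₀, b₀)).flip (0, A)).comp
      (ContinuousLinearMap.inl ℝ E₁ E₂)) a₀ := by
    have h2 : HasFDerivAt (fun p => fderiv ℝ G p (0, A))
        ((fderiv ℝ (fderiv ℝ G) (a₀, b₀)).flip (0, A)) (a₀, b₀) := by
      simpa using hd.hasFDerivAt.clm_apply (hasFDerivAt_const ((0, A) : E₁ × E₂) (a₀, b₀))
    exact (HasFDerivAt.comp a₀ (f := fun a => (a, b₀)) h2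
      (hasFDerivAt_prodMk_left a₀ b₀)).congr_of_eventuallyEq (hP.mono fun a ha => ha.symm)
  have h1' : HasFDerivAt Q (((fderiv ℝ (fderiv ℝ G) (a₀, b₀)).flip (z, 0)).comp
      (ContinuousLinearMap.inr ℝ E₁ E₂)) b₀ := by
    have h2 : HasFDerivAt (fun p => fderiv ℝ G p (z, 0))
        ((fderiv ℝ (fderiv ℝ G) (a₀, b₀)).flip (z, 0)) (a₀, b₀) := by
      simpa using hd.hasFDerivAt.clm_apply (hasFDerivAt_const ((z, 0) : E₁ × E₂) (a₀, b₀))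
    exact (HasFDerivAt.comp b₀ (f := fun b => (a₀, b)) h2
      (hasFDerivAt_prodMk_right a₀ b₀)).congr_of_eventuallyEq (hQ.mono fun a ha => ha.symm)
  refine ⟨h1.differentiableAt, ?_⟩
  rw [h1.fderiv, h1'.fderiv]
  exact hs.eq (z, 0) (0, A)

/-- Left and right invariant vector fields commute. -/
theorem mlieBracket_lfield_adInv (A z : E) (g : K) :
    VectorField.mlieBracket 𝓘(ℝ, E) (lfield fun _ : K => A) (lfield fun k => adInv E k z) g = 0 := by
  have : CompleteSpace E := FiniteDimensional.complete ℝ E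
  have hXd := mdifferentiableAt_lfield (ξ := fun _ : K => A) (g := g) mdifferentiableAt_const
  have hYd := mdifferentiableAt_lfield (ξ := fun k : K => adInv E k z) (g := g)
    ((contMDiff_adInv z).mdifferentiableAt (by simp))
  let f : K → E := extChartAt 𝓘(ℝ, E) g
  have hf : ContMDiffAt 𝓘(ℝ, E) 𝓘(ℝ, E) ∞ f g := contMDiffAt_extChartAt
  have hf2 : ContMDiffAt 𝓘(ℝ, E) 𝓘(ℝ, E) 2 f g := contMDiffAt_extChartAt
  have hfe : ∀ᶠ y in 𝓝 g, MDifferentiableAt 𝓘(ℝ, E) 𝓘(ℝ, E) f y :=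
    Filter.Eventually.mono (chart_source_mem_nhds E g) fun y hy => mdifferentiableAt_extChartAt hy
  let θ : E → K := (extChartAt 𝓘(ℝ, E) (1 : K)).symm
  let e₀ : E := extChartAt 𝓘(ℝ, E) (1 : K) 1
  have hθ0 : θ e₀ = 1 := extChartAt_to_inv (I := 𝓘(ℝ, E)) (1 : K)
  have hθ : ContMDiffAt 𝓘(ℝ, E) 𝓘(ℝ, E) ∞ θ e₀ :=
    (contMDiffOn_extChartAt_symm (n := ∞) (1 : K)).contMDiffAt (extChartAt_target_mem_nhds (1 : K))
  have hθd : MDifferentiableAt 𝓘(ℝ, E) 𝓘(ℝ, E) θ e₀ := hθ.mdifferentiableAt (by simp)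
  have hθ' : ∀ w, md E E θ e₀ w = w := fun w =>
    congrArg (fun L : E →L[ℝ] E => L w) (md_chart_symm_self (1 : K))
  let X : K → E := fun y => md E E f y (Lm E y A)
  let Y : K → E := fun y => md E E f y (Lm E y (adInv E y z))
  have hX : MDifferentiableAt 𝓘(ℝ, E) 𝓘(ℝ, E) X g := mdifferentiableAt_md_apply hf2 hXd
  have hY : MDifferentiableAt 𝓘(ℝ, E) 𝓘(ℝ, E) Y g := mdifferentiableAt_md_apply hf2 hYd
  -- Varying the left factor gives the right invariant field and varying the right factor the left
  -- invariant one, so the vanishing of the bracket is equality of the mixed partials of `G`.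
  let G : E × E → E := fun p => f (θ p.1 * g * θ p.2)
  have hG : ContDiffAt ℝ ∞ G (e₀, e₀) := by
    rw [← contMDiffAt_iff_contDiffAt]
    have h1 : ContMDiffAt 𝓘(ℝ, E × E) 𝓘(ℝ, E) ∞ (fun p : E × E => θ p.1 * g * θ p.2) (e₀, e₀) :=
      ((ContMDiffAt.comp (e₀, e₀) (g := θ) hθ contDiff_fst.contMDiff.contMDiffAt).mul
        contMDiffAt_const).mul
        (ContMDiffAt.comp (e₀, e₀) (g := θ) hθ contDiff_snd.contMDiff.contMDiffAt)
    refine ContMDiffAt.comp (e₀, e₀) (g := f) ?_ h1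
    simpa [hθ0] using hf
  have hGd : ∀ᶠ p in 𝓝 (e₀, e₀), DifferentiableAt ℝ G p := by
    filter_upwards [(hG.of_le (m := 1) (by simp)).eventually (by simp)] with p hp
    exact hp.differentiableAt (by simp)
  have hP : ∀ᶠ a in 𝓝 e₀, fderiv ℝ G (a, e₀) (0, A) = X (θ a * g) := by
    have hc : ContinuousAt (fun a : E => (a, e₀)) e₀ := by fun_prop
    have hc2 : ContinuousAt (fun a : E => θ a * g) e₀ :=
      (hθ.mul (contMDiffAt_const (c := g))).continuousAt
    have hfe' : ∀ᶠ y in 𝓝 (θ e₀ * g), MDifferentiableAt 𝓘(ℝ, E) 𝓘(ℝ, E) f y := by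
      simpa [hθ0] using hfe
    filter_upwards [hc.eventually hGd, hc2.eventually hfe'] with a ha hfa
    have h1 := (ha.hasFDerivAt.comp e₀ (hasFDerivAt_prodMk_right a e₀)).fderiv
    have h2 : fderiv ℝ (G ∘ fun b => (a, b)) e₀ A = fderiv ℝ G (a, e₀) (0, A) := by
      rw [h1]; simp
    rw [← h2, ← md_eq_fderiv]
    have h3 := md_comp_apply (E := E) (E' := E) (E'' := E) (g := fun k : K => f (θ a * g * k))
      (f := θ) e₀ (by
        refine MDifferentiableAt.comp (θ e₀) (g := f) ?_ (mdifferentiableAt_mul_left _ _)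
        simpa [hθ0] using hfa) hθd A
    refine h3.trans ?_
    rw [hθ', hθ0]
    have h4 := md_comp_apply (E := E) (E' := E) (E'' := E) (g := f)
      (f := fun k : K => θ a * g * k) 1 (by simpa using hfa) (mdifferentiableAt_mul_left _ _) A
    rw [mul_one] at h4
    exact h4
  have hQ : ∀ᶠ b in 𝓝 e₀, fderiv ℝ G (e₀, b) (z, 0) = Y (g * θ b) := by
    have hc : ContinuousAt (fun b : E => (e₀, b)) e₀ := by fun_prop
    have hc2 : ContinuousAt (fun b : E => g * θ b) e₀ :=
      ((contMDiffAt_const (c := g)).mul hθ).continuousAt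
    have hfe' : ∀ᶠ y in 𝓝 (g * θ e₀), MDifferentiableAt 𝓘(ℝ, E) 𝓘(ℝ, E) f y := by
      simpa [hθ0] using hfe
    filter_upwards [hc.eventually hGd, hc2.eventually hfe'] with b hb hfb
    have h1 := (HasFDerivAt.comp e₀ (f := fun a => (a, b)) hb.hasFDerivAt
      (hasFDerivAt_prodMk_left e₀ b)).fderiv
    have h2 : fderiv ℝ (G ∘ fun a => (a, b)) e₀ z = fderiv ℝ G (e₀, b) (z, 0) := by
      rw [h1]; simp
    rw [← h2, ← md_eq_fderiv]
    have h5 : (G ∘ fun a => (a, b)) = fun a => f (θ a * (g * θ b)) := by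
      funext a; simp [G, mul_assoc]
    have h3 := md_comp_apply (E := E) (E' := E) (E'' := E) (g := fun k : K => f (k * (g * θ b)))
      (f := θ) e₀ (by
        refine MDifferentiableAt.comp (θ e₀) (g := f) ?_ (mdifferentiableAt_mul_right _ _)
        simpa [hθ0] using hfb) hθd z
    rw [h5]
    refine h3.trans ?_
    rw [hθ', hθ0]
    have h4 := md_comp_apply (E := E) (E' := E) (E'' := E) (g := f)
      (f := fun k : K => k * (g * θ b)) 1 (by simpa using hfb) (mdifferentiableAt_mul_right _ _) z
    rw [one_mul, ← Lm_adInv] at h4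
    exact h4
  have hmix := (differentiableAt_of_mixed_partials (hG.of_le
    (WithTop.coe_le_coe.2 le_top : ((2 : ℕ∞) : WithTop ℕ∞) ≤ ∞)) hP hQ).2
  rw [← md_eq_fderiv, ← md_eq_fderiv] at hmix
  have h6 := md_comp_apply (E := E) (E' := E) (E'' := E) (g := X) (f := fun a => θ a * g) e₀
    (by simpa [hθ0] using hX)
    (MDifferentiableAt.comp e₀ (g := fun k : K => k * g) (mdifferentiableAt_mul_right g _) hθd) z
  have h7 := md_comp_apply (E := E) (E' := E) (E'' := E) (g := Y) (f := fun a => g * θ a) e₀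
    (by simpa [hθ0] using hY)
    (MDifferentiableAt.comp e₀ (g := fun k : K => g * k) (mdifferentiableAt_mul_left g _) hθd) A
  rw [md_comp_apply (E := E) (E' := E) (E'' := E) (g := fun k : K => k * g) (f := θ) e₀
    (mdifferentiableAt_mul_right g _) hθd, hθ', hθ0, one_mul, ← Lm_adInv] at h6
  rw [md_comp_apply (E := E) (E' := E) (E'' := E) (g := fun k : K => g * k) (f := θ) e₀
    (mdifferentiableAt_mul_left g _) hθd, hθ', hθ0, mul_one] at h7
  have h8 := md_mlieBracket hf2 hXd hYd
  have h9 := congrArg (fun L : E →L[ℝ] E => L (VectorField.mlieBracket 𝓘(ℝ, E)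
    (lfield fun _ : K => A) (lfield fun k => adInv E k z) g)) (md_chart_self (E := E) g)
  refine h9.symm.trans (h8.trans ?_)
  exact sub_eq_zero.2 (h7.symm.trans (hmix.symm.trans h6))

/-- The left invariant field `A` commutes with the right invariant field of `z`. Writing their
bracket with `mlieBracket_lfield` leaves the derivative of `Ad(g⁻¹) z` plus `[A, Ad(g⁻¹) z]`. -/
theorem md_adInv (A z : E) (g : K) :
    md E E (fun k : K => adInv E k z) g (Lm E g A) = - brk K A (adInv E g z) := by
  have h1 := mlieBracket_lfield (ξ := fun _ : K => A) (ζ := fun k : K => adInv E k z) (g := g)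
    mdifferentiableAt_const ((contMDiff_adInv z).mdifferentiableAt (by simp))
  rw [md_const, zero_apply, sub_zero] at h1
  have h2 : (0 : E) = _ := (mlieBracket_lfield_adInv A z g).symm.trans h1
  have h3 := congrArg (md E E (fun k : K => g⁻¹ * k) g) h2
  rw [md_inv_mul_Lm, map_zero] at h3
  exact eq_neg_of_add_eq_zero_left h3.symm

end AdInverse

/-! ### Brackets of related vector fields -/

section Related

variable {E : Type*} [NormedAddCommGroup E] [NormedSpace ℝ E] [CompleteSpace E]
  {V : Type*} [NormedAddCommGroup V] [NormedSpace ℝ V] [CompleteSpace V]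
  {N : Type*} [TopologicalSpace N] [ChartedSpace E N] [IsManifold 𝓘(ℝ, E) ∞ N]
  {M : Type*} [TopologicalSpace M] [ChartedSpace V M] [IsManifold 𝓘(ℝ, V) ∞ M]

/-- Brackets of related vector fields are related. -/
theorem md_mlieBracket_of_related {p : N → M} {g : N} (hp : ContMDiff 𝓘(ℝ, E) 𝓘(ℝ, V) ∞ p)
    {X' Y' : ∀ y : N, TangentSpace 𝓘(ℝ, E) y} {X Y : ∀ y : M, TangentSpace 𝓘(ℝ, V) y}
    (hX' : MDifferentiableAt 𝓘(ℝ, E) 𝓘(ℝ, E).tangent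
      (fun y => (⟨y, X' y⟩ : TangentBundle 𝓘(ℝ, E) N)) g)
    (hY' : MDifferentiableAt 𝓘(ℝ, E) 𝓘(ℝ, E).tangent
      (fun y => (⟨y, Y' y⟩ : TangentBundle 𝓘(ℝ, E) N)) g)
    (hX : MDifferentiableAt 𝓘(ℝ, V) 𝓘(ℝ, V).tangent
      (fun y => (⟨y, X y⟩ : TangentBundle 𝓘(ℝ, V) M)) (p g))
    (hY : MDifferentiableAt 𝓘(ℝ, V) 𝓘(ℝ, V).tangent
      (fun y => (⟨y, Y y⟩ : TangentBundle 𝓘(ℝ, V) M)) (p g))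
    (hXX' : ∀ᶠ y in 𝓝 g, md E V p y (X' y) = X (p y))
    (hYY' : ∀ᶠ y in 𝓝 g, md E V p y (Y' y) = Y (p y)) :
    md E V p g (VectorField.mlieBracket 𝓘(ℝ, E) X' Y' g) =
      VectorField.mlieBracket 𝓘(ℝ, V) X Y (p g) := by
  let f : M → V := extChartAt 𝓘(ℝ, V) (p g)
  have hf : ContMDiffAt 𝓘(ℝ, V) 𝓘(ℝ, V) 2 f (p g) := contMDiffAt_extChartAt
  have hfd : MDifferentiableAt 𝓘(ℝ, V) 𝓘(ℝ, V) f (p g) := hf.mdifferentiableAt (by simp)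
  have hfp : ContMDiffAt 𝓘(ℝ, E) 𝓘(ℝ, V) 2 (fun y => f (p y)) g :=
    hf.comp g (hp.contMDiffAt.of_le (WithTop.coe_le_coe.2 le_top : ((2 : ℕ∞) : WithTop ℕ∞) ≤ ∞))
  have hfg : md V V f (p g) = ContinuousLinearMap.id ℝ V := md_chart_self (p g)
  have h1 := md_mlieBracket hfp hX' hY'
  have h2 := md_mlieBracket hf hX hY
  have hev : ∀ᶠ y in 𝓝 g, MDifferentiableAt 𝓘(ℝ, V) 𝓘(ℝ, V) f (p y) := by
    refine hp.continuous.continuousAt.eventually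
      (Filter.Eventually.mono (chart_source_mem_nhds V (p g)) fun y hy => ?_)
    exact mdifferentiableAt_extChartAt hy
  have hrel : ∀ (Z' : ∀ y : N, TangentSpace 𝓘(ℝ, E) y) (Z : ∀ y : M, TangentSpace 𝓘(ℝ, V) y),
      (∀ᶠ y in 𝓝 g, md E V p y (Z' y) = Z (p y)) →
      (fun y => md E V (fun y => f (p y)) y (Z' y)) =ᶠ[𝓝 g] fun y => md V V f (p y) (Z (p y)) := by
    intro Z' Z h
    filter_upwards [h, hev] with y hy hy'
    exact (md_comp_apply y hy' (hp.mdifferentiableAt (by simp)) (Z' y)).trans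
      (congrArg (md V V f (p y)) hy)
  rw [md_congr (hrel Y' Y hYY'), md_congr (hrel X' X hXX')] at h1
  have h5 := (md_comp_apply g hfd (hp.mdifferentiableAt (by simp))
    (VectorField.mlieBracket 𝓘(ℝ, E) X' Y' g)).trans (congrArg (fun L : V →L[ℝ] V => L _) hfg)
  have h6 := congrArg
    (fun L : V →L[ℝ] V => L (VectorField.mlieBracket 𝓘(ℝ, V) X Y (p g))) hfg
  refine h5.symm.trans (h1.trans (Eq.trans ?_ (h6.symm.trans h2).symm))
  have h3 := md_comp_apply g (mdifferentiableAt_md_apply hf hY) (hp.mdifferentiableAt (by simp))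
    (X' g)
  have h4 := md_comp_apply g (mdifferentiableAt_md_apply hf hX) (hp.mdifferentiableAt (by simp))
    (Y' g)
  refine congrArg₂ (fun a b : V => a - b) (h3.trans ?_) (h4.trans ?_)
  · exact congrArg _ hXX'.self_of_nhds
  · exact congrArg _ hYY'.self_of_nhds

end Related

/-! ### Vector fields on `K/H` as functions on `K`, and integrability of `Λ` -/

section Coframe

variable {E : Type*} [NormedAddCommGroup E] [NormedSpace ℝ E] [FiniteDimensional ℝ E]
  {K : Type*} [TopologicalSpace K] [ChartedSpace E K] [Group K] [LieGroup 𝓘(ℝ, E) ∞ K]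
  {H : Subgroup K} {m : ℕ} [ChartedSpace (Mink m) (K ⧸ H)]
  [IsManifold 𝓘(ℝ, Mink m) ∞ (K ⧸ H)]

variable (H) in
/-- The frame at `gH` which is the translate by `g` of the frame `u₀` at the origin. -/
def frm (u₀ : Mink m ≃L[ℝ] Mink m) (g : K) : Mink m →L[ℝ] Mink m :=
  md (Mink m) (Mink m) (fun y : K ⧸ H => g • y) ((1 : K) : K ⧸ H) ∘L u₀

variable (H) in
/-- The inverse of the frame `frm H u₀ g`. -/
def cof (u₀ : Mink m ≃L[ℝ] Mink m) (g : K) : Mink m →L[ℝ] Mink m :=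
  u₀.symm ∘L md (Mink m) (Mink m) (fun y : K ⧸ H => g⁻¹ • y) (g : K ⧸ H)

variable (E H) in
/-- The linear map `𝔨 → ℝⁿ` obtained from `dπ` and the frame `u₀` at the origin. -/
def coB (u₀ : Mink m ≃L[ℝ] Mink m) : E →L[ℝ] Mink m :=
  u₀.symm ∘L md E (Mink m) (fun k : K => (k : K ⧸ H)) 1

variable {u₀ : Mink m ≃L[ℝ] Mink m}

theorem cof_frm [ContMDiffSMul 𝓘(ℝ, E) 𝓘(ℝ, Mink m) ∞ K (K ⧸ H)] (g : K) (v : Mink m) :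
    cof H u₀ g (frm H u₀ g v) = v := by
  have h := md_inv_smul_md_smul E (Mink m) g ((1 : K) : K ⧸ H) (u₀ v)
  rw [smul_mk_one] at h
  exact (congrArg u₀.symm h).trans (u₀.symm_apply_apply v)

theorem frm_cof [ContMDiffSMul 𝓘(ℝ, E) 𝓘(ℝ, Mink m) ∞ K (K ⧸ H)] (g : K) (w : Mink m) :
    frm H u₀ g (cof H u₀ g w) = w := by
  have h := md_smul_md_inv_smul E (Mink m) g ((1 : K) : K ⧸ H) w
  rw [smul_mk_one] at h
  refine Eq.trans ?_ h
  exact congrArg (md (Mink m) (Mink m) (fun y : K ⧸ H => g • y) ((1 : K) : K ⧸ H))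
    (u₀.apply_symm_apply _)

theorem frm_one (v : Mink m) : frm H u₀ (1 : K) v = u₀ v :=
  md_one_smul (Mink m) K ((1 : K) : K ⧸ H) (u₀ v)

theorem md_mk_Lm (hπ : Manifold.IsSubmersion 𝓘(ℝ, E) 𝓘(ℝ, Mink m) ∞ (fun x : K => (x : K ⧸ H)))
    (g : K) (A : E) :
    md E (Mink m) (fun k : K => (k : K ⧸ H)) g (Lm E g A) = frm H u₀ g (coB E H u₀ A) := by
  have := contMDiffSMul_quotient hπ
  have h := md_mk_mul_left hπ.contMDiff g 1 A
  rw [mul_one] at h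
  refine h.trans ?_
  exact congrArg (md (Mink m) (Mink m) (fun y : K ⧸ H => g • y) ((1 : K) : K ⧸ H))
    (u₀.apply_symm_apply _).symm

theorem coB_surjective
    (hπ : Manifold.IsSubmersion 𝓘(ℝ, E) 𝓘(ℝ, Mink m) ∞ (fun x : K => (x : K ⧸ H))) :
    Function.Surjective (coB E H u₀) :=
  u₀.symm.surjective.comp (md_mk_surjective hπ 1)

variable {P : GStructure (GN m) (K ⧸ H)}

theorem frames_mk_iff
    (hπ : Manifold.IsSubmersion 𝓘(ℝ, E) 𝓘(ℝ, Mink m) ∞ (fun x : K => (x : K ⧸ H)))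
    (hP : IsInvariantStructure P) (hu₀ : u₀ ∈ P.frames ((1 : K) : K ⧸ H)) (g : K)
    (u : Mink m ≃L[ℝ] TangentSpace 𝓘(ℝ, Mink m) (g : K ⧸ H)) :
    u ∈ P.frames (g : K ⧸ H) ↔ ∃ n ∈ GN m, ∀ v, u v = frm H u₀ g (n v) := by
  have := contMDiffSMul_quotient hπ
  obtain ⟨u₁, hu₁, h₁⟩ := hP.exists_frame g (smul_mk_one g) hu₀
  have h₁' : ∀ v, u₁ v = frm H u₀ g v := h₁
  constructor
  · intro hu
    obtain ⟨n, hn, rfl⟩ := P.exists_eq_comp _ u₁ hu₁ u hu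
    exact ⟨n, hn, fun v => h₁' (n v)⟩
  · rintro ⟨n, hn, h⟩
    have : u = n.trans u₁ :=
      ContinuousLinearEquiv.ext (funext fun v => (h v).trans (h₁' (n v)).symm)
    rw [this]
    exact P.comp_mem _ u₁ hu₁ n hn

theorem mem_nullPerp_mk_iff
    (hπ : Manifold.IsSubmersion 𝓘(ℝ, E) 𝓘(ℝ, Mink m) ∞ (fun x : K => (x : K ⧸ H)))
    (hP : IsInvariantStructure P) (hu₀ : u₀ ∈ P.frames ((1 : K) : K ⧸ H)) (g : K)
    (w : Mink m) : (w : TangentSpace 𝓘(ℝ, Mink m) (g : K ⧸ H)) ∈ nullPerp P (g : K ⧸ H) ↔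
      eta (kvec m) (cof H u₀ g w) = 0 := by
  have := contMDiffSMul_quotient hπ
  obtain ⟨u₁, hu₁, h₁⟩ := hP.exists_frame g (smul_mk_one g) hu₀
  have h₁' : ∀ v, u₁ v = frm H u₀ g v := h₁
  refine (mem_nullPerp_iff hu₁ _).trans ?_
  have : u₁.symm w = cof H u₀ g w :=
    u₁.symm_apply_eq.2 ((frm_cof (E := E) g w).symm.trans (h₁' _).symm)
  rw [this]

theorem mem_nullLine_mk_iff
    (hπ : Manifold.IsSubmersion 𝓘(ℝ, E) 𝓘(ℝ, Mink m) ∞ (fun x : K => (x : K ⧸ H)))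
    (hP : IsInvariantStructure P) (hu₀ : u₀ ∈ P.frames ((1 : K) : K ⧸ H)) (g : K)
    (w : Mink m) : (w : TangentSpace 𝓘(ℝ, Mink m) (g : K ⧸ H)) ∈ nullLine P (g : K ⧸ H) ↔
      cof H u₀ g w ∈ Submodule.span ℝ {kvec m} := by
  have := contMDiffSMul_quotient hπ
  obtain ⟨u₁, hu₁, h₁⟩ := hP.exists_frame g (smul_mk_one g) hu₀
  have h₁' : ∀ v, u₁ v = frm H u₀ g v := h₁
  refine (mem_nullLine_iff hu₁ _).trans ?_
  have : u₁.symm w = cof H u₀ g w :=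
    u₁.symm_apply_eq.2 ((frm_cof (E := E) g w).symm.trans (h₁' _).symm)
  rw [this]

theorem contMDiffAt_cof
    (hπ : Manifold.IsSubmersion 𝓘(ℝ, E) 𝓘(ℝ, Mink m) ∞ (fun x : K => (x : K ⧸ H)))
    {X : ∀ y : K ⧸ H, TangentSpace 𝓘(ℝ, Mink m) y} {g : K}
    (hX : ContMDiffAt 𝓘(ℝ, Mink m) 𝓘(ℝ, Mink m).tangent ∞
      (fun y => (⟨y, X y⟩ : TangentBundle 𝓘(ℝ, Mink m) (K ⧸ H))) (g : K ⧸ H)) :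
    ContMDiffAt 𝓘(ℝ, E) 𝓘(ℝ, Mink m) ∞ (fun k : K => cof H u₀ k (X (k : K ⧸ H))) g := by
  have := contMDiffSMul_quotient hπ
  have h1 : ContMDiffAt 𝓘(ℝ, E) 𝓘(ℝ, Mink m).tangent ∞
      (fun k : K => (⟨(k : K ⧸ H), X (k : K ⧸ H)⟩ : TangentBundle 𝓘(ℝ, Mink m) (K ⧸ H))) g :=
    ContMDiffAt.comp g (f := fun k : K => (k : K ⧸ H)) hX hπ.contMDiff.contMDiffAt
  have h2 := contMDiffAt_md_smul E (Mink m) (n := ⊤) (k := fun k : K => k⁻¹) (q := g)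
    contMDiffAt_id.inv h1
  have h3 : ContMDiffAt 𝓘(ℝ, E) 𝓘(ℝ, Mink m) ∞ (fun k : K =>
      md (Mink m) (Mink m) (fun y : K ⧸ H => k⁻¹ • y) (k : K ⧸ H) (X (k : K ⧸ H))) g := by
    refine (contMDiffAt_tangentBundle_const_iff (x := ((1 : K) : K ⧸ H))).1
      (h2.congr_of_eventuallyEq (Filter.Eventually.of_forall fun p => ?_))
    exact tangentBundle_mk_congr (inv_smul_mk p).symm _
  exact u₀.symm.contDiff.contMDiff.contMDiffAt.comp g h3

theorem md_clm_comp {F F' : Type*} [NormedAddCommGroup F] [NormedSpace ℝ F] [NormedAddCommGroup F']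
    [NormedSpace ℝ F'] (L : F →L[ℝ] F') {f : K → F} {x : K}
    (hf : MDifferentiableAt 𝓘(ℝ, E) 𝓘(ℝ, F) f x) (w : E) :
    md E F' (fun y => L (f y)) x w = L (md E F f x w) := by
  rw [md_comp_apply (E := E) (E' := F) (E'' := F') (g := L) x
    L.differentiableAt.mdifferentiableAt hf, md_eq_fderiv, L.fderiv]

/-- Both fields are lifted through `π` to fields on `K`. The bracket upstairs is known from
`mlieBracket_lfield`, and its image under `dπ` is the bracket downstairs. The lifts `x` and `y` at
`g` may be chosen freely modulo `𝔥`, a freedom used later. -/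
theorem cof_mlieBracket
    (hπ : Manifold.IsSubmersion 𝓘(ℝ, E) 𝓘(ℝ, Mink m) ∞ (fun x : K => (x : K ⧸ H)))
    {X Y : ∀ y : K ⧸ H, TangentSpace 𝓘(ℝ, Mink m) y} {g : K}
    (hX : ContMDiffAt 𝓘(ℝ, Mink m) 𝓘(ℝ, Mink m).tangent ∞
      (fun y => (⟨y, X y⟩ : TangentBundle 𝓘(ℝ, Mink m) (K ⧸ H))) (g : K ⧸ H))
    (hY : ContMDiffAt 𝓘(ℝ, Mink m) 𝓘(ℝ, Mink m).tangent ∞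
      (fun y => (⟨y, Y y⟩ : TangentBundle 𝓘(ℝ, Mink m) (K ⧸ H))) (g : K ⧸ H))
    {x y : E} (hx : coB E H u₀ x = cof H u₀ g (X (g : K ⧸ H)))
    (hy : coB E H u₀ y = cof H u₀ g (Y (g : K ⧸ H))) :
    cof H u₀ g (VectorField.mlieBracket 𝓘(ℝ, Mink m) X Y (g : K ⧸ H)) =
      md E (Mink m) (fun k : K => cof H u₀ k (Y (k : K ⧸ H))) g (Lm E g x) -
      md E (Mink m) (fun k : K => cof H u₀ k (X (k : K ⧸ H))) g (Lm E g y) +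
      coB E H u₀ (brk K x y) := by
  have := contMDiffSMul_quotient hπ
  have : CompleteSpace E := FiniteDimensional.complete ℝ E
  obtain ⟨J, hJ⟩ := (coB E H u₀).toLinearMap.exists_rightInverse_of_surjective
    (LinearMap.range_eq_top.2 (coB_surjective hπ))
  have hJ' : ∀ v, coB E H u₀ (J v) = v := fun v => congrArg (fun L : Mink m →ₗ[ℝ] Mink m => L v) hJ
  let J' : Mink m →L[ℝ] E := LinearMap.toContinuousLinearMap J
  -- A right inverse `J` of `dπ` in the frame gives a lift; the constant correction lies in the
  -- kernel and makes the value at `g` equal to the prescribed `x`.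
  let lift : (∀ y : K ⧸ H, TangentSpace 𝓘(ℝ, Mink m) y) → E → K → E := fun X x k =>
    J' (cof H u₀ k (X (k : K ⧸ H))) + (x - J' (coB E H u₀ x))
  have hB : ∀ X x k, coB E H u₀ (lift X x k) = cof H u₀ k (X (k : K ⧸ H)) := fun X x k => by
    have h1 := hJ' (cof H u₀ k (X (k : K ⧸ H)))
    have h2 := hJ' (coB E H u₀ x)
    simp only [lift, map_add, map_sub]
    rw [show coB E H u₀ (J' (cof H u₀ k (X (k : K ⧸ H)))) = _ from h1,
      show coB E H u₀ (J' (coB E H u₀ x)) = _ from h2, sub_self, add_zero]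
  have hg : ∀ X x, coB E H u₀ x = cof H u₀ g (X (g : K ⧸ H)) → lift X x g = x := fun X x h => by
    simp only [lift, h]
    abel
  have hrel : ∀ X x k, md E (Mink m) (fun k : K => (k : K ⧸ H)) k (lfield (lift X x) k) =
      X (k : K ⧸ H) := fun X x k => by
    refine (md_mk_Lm (u₀ := u₀) hπ k (lift X x k)).trans ?_
    rw [hB]
    exact frm_cof (E := E) k _
  have hd : ∀ (X : ∀ y : K ⧸ H, TangentSpace 𝓘(ℝ, Mink m) y) x,
      ContMDiffAt 𝓘(ℝ, Mink m) 𝓘(ℝ, Mink m).tangent ∞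
        (fun y => (⟨y, X y⟩ : TangentBundle 𝓘(ℝ, Mink m) (K ⧸ H))) (g : K ⧸ H) →
      MDifferentiableAt 𝓘(ℝ, E) 𝓘(ℝ, E) (lift X x) g := fun X x hX => by
    have h1 := J'.contDiff.contMDiff.contMDiffAt.comp g (contMDiffAt_cof (u₀ := u₀) hπ hX)
    exact (h1.add (contMDiffAt_const (c := x - J' (coB E H u₀ x)))).mdifferentiableAt (by simp)
  have hmd : ∀ (X : ∀ y : K ⧸ H, TangentSpace 𝓘(ℝ, Mink m) y) x,
      ContMDiffAt 𝓘(ℝ, Mink m) 𝓘(ℝ, Mink m).tangent ∞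
        (fun y => (⟨y, X y⟩ : TangentBundle 𝓘(ℝ, Mink m) (K ⧸ H))) (g : K ⧸ H) → ∀ w,
      coB E H u₀ (md E E (lift X x) g w) =
        md E (Mink m) (fun k : K => cof H u₀ k (X (k : K ⧸ H))) g w := fun X x hX w => by
    rw [← md_clm_comp _ (hd X x hX)]
    simp only [hB]
  have hbr := mlieBracket_lfield (hd X x hX) (hd Y y hY)
  have h1 := md_mlieBracket_of_related hπ.contMDiff (mdifferentiableAt_lfield (hd X x hX))
    (mdifferentiableAt_lfield (hd Y y hY)) (hX.mdifferentiableAt (by simp))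
    (hY.mdifferentiableAt (by simp)) (Filter.Eventually.of_forall (hrel X x))
    (Filter.Eventually.of_forall (hrel Y y))
  have h2 := congrArg (cof H u₀ g) (((congrArg (md E (Mink m) (fun k : K => (k : K ⧸ H)) g)
    hbr).symm.trans h1).symm.trans (md_mk_Lm (u₀ := u₀) hπ g _))
  refine h2.trans ((cof_frm (E := E) g _).trans ?_)
  rw [map_add, map_sub, hmd Y y hY, hmd X x hX, hg X x hx, hg Y y hy]

theorem md_eq_zero_of_eventually {F : Type*} [NormedAddCommGroup F] [NormedSpace ℝ F]
    (L : F →L[ℝ] ℝ) {f : K → F} {x : K} (hf : MDifferentiableAt 𝓘(ℝ, E) 𝓘(ℝ, F) f x)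
    (h : ∀ᶠ y in 𝓝 x, L (f y) = 0) (w : E) : L (md E F f x w) = 0 := by
  rw [← md_clm_comp L hf, md_congr (g := fun _ => (0 : ℝ)) h, md_const]
  rfl

variable (H) in
/-- The field of translates of the frame vector `u₀ v` along a section `σ`. -/
def frameField (u₀ : Mink m ≃L[ℝ] Mink m) (σ : K ⧸ H → K) (v : Mink m) (y : K ⧸ H) :
    TangentSpace 𝓘(ℝ, Mink m) y :=
  frm H u₀ (σ y) v

theorem contMDiffAt_frameField
    (hπ : Manifold.IsSubmersion 𝓘(ℝ, E) 𝓘(ℝ, Mink m) ∞ (fun x : K => (x : K ⧸ H)))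
    {U : Set (K ⧸ H)} (hU : IsOpen U) {σ : K ⧸ H → K}
    (hσ : ContMDiffOn 𝓘(ℝ, Mink m) 𝓘(ℝ, E) ∞ σ U) (hσU : ∀ y ∈ U, ((σ y : K) : K ⧸ H) = y)
    (v : Mink m) {y : K ⧸ H} (hy : y ∈ U) :
    ContMDiffAt 𝓘(ℝ, Mink m) 𝓘(ℝ, Mink m).tangent ∞
      (fun y => (⟨y, frameField H u₀ σ v y⟩ : TangentBundle 𝓘(ℝ, Mink m) (K ⧸ H))) y := by
  have := contMDiffSMul_quotient hπ
  have h1 : ContMDiffAt 𝓘(ℝ, Mink m) 𝓘(ℝ, Mink m).tangent ∞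
      (fun _ : K ⧸ H => (⟨((1 : K) : K ⧸ H), u₀ v⟩ : TangentBundle 𝓘(ℝ, Mink m) (K ⧸ H))) y :=
    contMDiffAt_const
  refine (contMDiffAt_md_smul E (Mink m) (n := ⊤) (hσ.contMDiffAt (hU.mem_nhds hy))
    (f := fun _ => ((1 : K) : K ⧸ H)) (z := fun _ => u₀ v) h1).congr_of_eventuallyEq ?_
  filter_upwards [hU.mem_nhds hy] with z hz
  exact tangentBundle_mk_congr ((hσU z hz).symm.trans (smul_mk_one _).symm) _

/-- A section of `Λ` has its coefficient function in `k^⊥`, hence also the derivatives of that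
function. In `cof_mlieBracket` only `B[x, y]` can leave `k^⊥`. -/
theorem isIntegrableDistribution_nullPerp_iff
    (hπ : Manifold.IsSubmersion 𝓘(ℝ, E) 𝓘(ℝ, Mink m) ∞ (fun x : K => (x : K ⧸ H)))
    (hP : IsInvariantStructure P) (hu₀ : u₀ ∈ P.frames ((1 : K) : K ⧸ H)) :
    IsIntegrableDistribution (nullPerp P) ↔
      ∀ x y : E, eta (kvec m) (coB E H u₀ x) = 0 → eta (kvec m) (coB E H u₀ y) = 0 →
        eta (kvec m) (coB E H u₀ (brk K x y)) = 0 := by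
  have := contMDiffSMul_quotient hπ
  constructor
  · intro hD x y hx hy
    obtain ⟨U, hU, h1U, σ, hσ, hσU, hσ1⟩ := exists_local_section hπ (1 : K)
    have hX := fun v y hy => contMDiffAt_frameField (u₀ := u₀) hπ hU hσ hσU v (y := y) hy
    have hperp : ∀ v, eta (kvec m) v = 0 → ∀ y ∈ U, frameField H u₀ σ v y ∈ nullPerp P y := by
      intro v hv y hy
      obtain ⟨u₁, hu₁, h₁⟩ := hP.exists_frame (σ y) ((smul_mk_one _).trans (hσU y hy)) hu₀
      exact ⟨u₁, hu₁, v, hv, h₁ v⟩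
    have h1 := hD U (frameField H u₀ σ (coB E H u₀ x)) (frameField H u₀ σ (coB E H u₀ y)) hU
      (fun z hz => (hX _ z hz).contMDiffWithinAt) (fun z hz => (hX _ z hz).contMDiffWithinAt)
      (hperp _ hx) (hperp _ hy) _ h1U
    have h2 := (mem_nullPerp_mk_iff hπ hP hu₀ 1 _).1 h1
    have hco : ∀ v, cof H u₀ (1 : K) (frameField H u₀ σ v ((1 : K) : K ⧸ H)) = v := fun v => by
      unfold frameField
      rw [hσ1]
      exact cof_frm (E := E) 1 v
    have h3 := cof_mlieBracket (u₀ := u₀) hπ (hX (coB E H u₀ x) _ h1U) (hX (coB E H u₀ y) _ h1U)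
      (hco _).symm (hco _).symm
    have hz : ∀ v, eta (kvec m) v = 0 → ∀ w, etaL m (kvec m) (md E (Mink m)
        (fun k : K => cof H u₀ k (frameField H u₀ σ v (k : K ⧸ H))) 1 w) = 0 := fun v hv w => by
      refine md_eq_zero_of_eventually _
        ((contMDiffAt_cof hπ (hX v _ h1U)).mdifferentiableAt (by simp)) ?_ w
      filter_upwards [(hπ.contMDiff.continuous.continuousAt (x := (1 : K))).preimage_mem_nhds
        (hU.mem_nhds h1U)] with k hk
      exact (mem_nullPerp_mk_iff hπ hP hu₀ k _).1 (hperp v hv _ hk)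
    have h4 := congrArg (etaL m (kvec m)) h3
    rw [map_add, map_sub, hz _ hx, hz _ hy, sub_zero, zero_add] at h4
    exact h4.symm.trans h2
  · intro hb U X Y hU hX hY hXp hYp y hy
    obtain ⟨g, rfl⟩ := QuotientGroup.mk_surjective y
    have hX' := hX.contMDiffAt (hU.mem_nhds hy)
    have hY' := hY.contMDiffAt (hU.mem_nhds hy)
    obtain ⟨x, hx⟩ := coB_surjective (u₀ := u₀) hπ (cof H u₀ g (X (g : K ⧸ H)))
    obtain ⟨y, hy'⟩ := coB_surjective (u₀ := u₀) hπ (cof H u₀ g (Y (g : K ⧸ H)))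
    refine (mem_nullPerp_mk_iff hπ hP hu₀ g _).2 ?_
    have h3 := cof_mlieBracket (u₀ := u₀) hπ hX' hY' hx hy'
    have hz : ∀ X : ∀ y : K ⧸ H, TangentSpace 𝓘(ℝ, Mink m) y, (∀ y ∈ U, X y ∈ nullPerp P y) →
        ContMDiffAt 𝓘(ℝ, Mink m) 𝓘(ℝ, Mink m).tangent ∞
          (fun y => (⟨y, X y⟩ : TangentBundle 𝓘(ℝ, Mink m) (K ⧸ H))) (g : K ⧸ H) →
        ∀ w, etaL m (kvec m) (md E (Mink m)
          (fun k : K => cof H u₀ k (X (k : K ⧸ H))) g w) = 0 := fun X hXp hX w => by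
      refine md_eq_zero_of_eventually _ ((contMDiffAt_cof hπ hX).mdifferentiableAt (by simp)) ?_ w
      filter_upwards [(hπ.contMDiff.continuous.continuousAt (x := g)).preimage_mem_nhds
        (hU.mem_nhds hy)] with k hk
      exact (mem_nullPerp_mk_iff hπ hP hu₀ k _).1 (hXp _ hk)
    have h4 := congrArg (etaL m (kvec m)) h3
    rw [map_add, map_sub, hz X hXp hX', hz Y hYp hY', sub_zero, zero_add] at h4
    refine h4.trans (hb x y ?_ ?_)
    · rw [hx]
      exact (mem_nullPerp_mk_iff hπ hP hu₀ g _).1 (hXp _ hy)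
    · rw [hy']
      exact (mem_nullPerp_mk_iff hπ hP hu₀ g _).1 (hYp _ hy)

end Coframe

/-! ### Derivative of a curve of operators and of a flow -/

section Flow

variable {V : Type*} [NormedAddCommGroup V] [NormedSpace ℝ V] [FiniteDimensional ℝ V]
  {M : Type*} [TopologicalSpace M] [ChartedSpace V M] [IsManifold 𝓘(ℝ, V) ∞ M]

/-- Inversion is smooth at the invertible operator `Θ 0`, so `ν = Θ⁻¹ a` is differentiable near it,
and the product rule determines its derivative. -/
theorem hasDerivAt_of_clm_apply_eq {Θ : ℝ → V →L[ℝ] V} {ν a : ℝ → V} {a' : V} {e : V ≃L[ℝ] V}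
    (hΘ : DifferentiableAt ℝ Θ 0) (h0 : Θ 0 = e) (ha : HasDerivAt a a' 0)
    (h : ∀ᶠ t in 𝓝 0, Θ t (ν t) = a t) :
    HasDerivAt ν (e.symm (a' - deriv Θ 0 (ν 0))) 0 := by
  have : CompleteSpace V := FiniteDimensional.complete ℝ V
  have hinv : DifferentiableAt ℝ (fun t => (Θ t).inverse) 0 := by
    have h1 := (contDiffAt_map_inverse (n := 1) e).differentiableAt (by simp)
    rw [← h0] at h1
    exact h1.comp (0 : ℝ) hΘ
  have hν : ν =ᶠ[𝓝 0] fun t => (Θ t).inverse (a t) := by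
    have h1 : ∀ᶠ t in 𝓝 0, Θ t ∈ Set.range ((↑) : (V ≃L[ℝ] V) → V →L[ℝ] V) := by
      refine hΘ.continuousAt.eventually ?_
      rw [h0]
      exact ContinuousLinearEquiv.nhds e
    filter_upwards [h, h1] with t ht ⟨e', he'⟩
    rw [← ht, ← he', ContinuousLinearMap.inverse_equiv]
    exact (e'.symm_apply_apply _).symm
  have hνd : DifferentiableAt ℝ ν 0 :=
    (hinv.clm_apply ha.differentiableAt).congr_of_eventuallyEq hν
  have h2 := (hΘ.hasDerivAt.clm_apply hνd.hasDerivAt).congr_of_eventuallyEq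
    (f₁ := a) (h.mono fun t ht => ht.symm)
  have h3 := ha.unique h2
  rw [h3, add_sub_cancel_left, h0]
  have h4 := e.symm_apply_apply (deriv ν 0)
  exact h4.symm ▸ hνd.hasDerivAt

/-- The linearized flow equation at time `0`: time and space derivatives of the flow, read in a
chart, commute. -/
theorem hasDerivAt_md_flow {φ : ℝ → M → M} {X : ∀ y : M, TangentSpace 𝓘(ℝ, V) y} {o : M}
    (hφ : ContMDiffAt (𝓘(ℝ, ℝ).prod 𝓘(ℝ, V)) 𝓘(ℝ, V) ∞ (fun q : ℝ × M => φ q.1 q.2) (0, o))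
    (hφ0 : ∀ᶠ y in 𝓝 o, φ 0 y = y)
    (hφX : ∀ᶠ y in 𝓝 o, HasMFDerivAt 𝓘(ℝ, ℝ) 𝓘(ℝ, V) (fun t => φ t y) 0
      ((1 : ℝ →L[ℝ] ℝ).smulRight (X (φ 0 y))))
    (hX : MDifferentiableAt 𝓘(ℝ, V) 𝓘(ℝ, V) (fun y => md V V (extChartAt 𝓘(ℝ, V) o) y (X y)) o)
    (z : V) :
    HasDerivAt (fun t => md V V (extChartAt 𝓘(ℝ, V) o) (φ t o) (md V V (φ t) o z))
      (md V V (fun y => md V V (extChartAt 𝓘(ℝ, V) o) y (X y)) o z) 0 := by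
  let f : M → V := extChartAt 𝓘(ℝ, V) o
  let θ : V → M := (extChartAt 𝓘(ℝ, V) o).symm
  let p₀ : V := f o
  have hf : ContMDiffAt 𝓘(ℝ, V) 𝓘(ℝ, V) ∞ f o := contMDiffAt_extChartAt
  have hfe : ∀ᶠ y in 𝓝 o, MDifferentiableAt 𝓘(ℝ, V) 𝓘(ℝ, V) f y :=
    Filter.Eventually.mono (chart_source_mem_nhds V o) fun y hy => mdifferentiableAt_extChartAt hy
  have hθ0 : θ p₀ = o := extChartAt_to_inv (I := 𝓘(ℝ, V)) o
  have hθ : ContMDiffAt 𝓘(ℝ, V) 𝓘(ℝ, V) ∞ θ p₀ :=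
    (contMDiffOn_extChartAt_symm (n := ∞) o).contMDiffAt (extChartAt_target_mem_nhds o)
  have hθd : MDifferentiableAt 𝓘(ℝ, V) 𝓘(ℝ, V) θ p₀ := hθ.mdifferentiableAt (by simp)
  have hθ' : ∀ w, md V V θ p₀ w = w := fun w =>
    congrArg (fun L : V →L[ℝ] V => L w) (md_chart_symm_self o)
  have hφo : φ 0 o = o := hφ0.self_of_nhds
  let G : ℝ × V → V := fun p => f (φ p.1 (θ p.2))
  have hG : ContDiffAt ℝ ∞ G (0, p₀) := by
    rw [← contMDiffAt_iff_contDiffAt]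
    have h1 : ContMDiffAt 𝓘(ℝ, ℝ × V) (𝓘(ℝ, ℝ).prod 𝓘(ℝ, V)) ∞
        (fun p : ℝ × V => (p.1, θ p.2)) (0, p₀) :=
      contDiff_fst.contMDiff.contMDiffAt.prodMk
        (ContMDiffAt.comp (0, p₀) (g := θ) hθ contDiff_snd.contMDiff.contMDiffAt)
    have h2 : ContMDiffAt 𝓘(ℝ, ℝ × V) 𝓘(ℝ, V) ∞ (fun p : ℝ × V => φ p.1 (θ p.2)) (0, p₀) :=
      ContMDiffAt.comp (0, p₀) (g := fun q : ℝ × M => φ q.1 q.2) (by rw [hθ0]; exact hφ) h1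
    exact ContMDiffAt.comp (0, p₀) (g := f) (by rw [hθ0, hφo]; exact hf) h2
  have hGd : ∀ᶠ p in 𝓝 ((0 : ℝ), p₀), DifferentiableAt ℝ G p := by
    filter_upwards [(hG.of_le (m := 1) (by simp)).eventually (by simp)] with p hp
    exact hp.differentiableAt (by simp)
  have hφc : ContinuousAt (fun t => φ t o) 0 :=
    ContinuousAt.comp (g := fun q : ℝ × M => φ q.1 q.2) (f := fun t : ℝ => (t, o))
      hφ.continuousAt (by fun_prop)
  have hφe : ∀ᶠ t in 𝓝 (0 : ℝ), MDifferentiableAt 𝓘(ℝ, V) 𝓘(ℝ, V) (φ t) o := by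
    obtain ⟨s, hs, hs'⟩ := (contMDiffAt_iff_contMDiffOn_nhds (n := 1) (by simp)).1
      (hφ.of_le (by simp))
    have hc : ContinuousAt (fun t : ℝ => (t, o)) 0 := by fun_prop
    filter_upwards [hc.eventually (eventually_mem_nhds_iff.2 hs)] with t ht
    exact ((hs'.contMDiffAt ht).comp o
      (contMDiffAt_const.prodMk contMDiffAt_id)).mdifferentiableAt (by simp)
  have hP : ∀ᶠ t in 𝓝 (0 : ℝ), fderiv ℝ G (t, p₀) (0, z) =
      md V V f (φ t o) (md V V (φ t) o z) := by
    have hc : ContinuousAt (fun t : ℝ => (t, p₀)) 0 := by fun_prop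
    have hfe' : ∀ᶠ t in 𝓝 (0 : ℝ), MDifferentiableAt 𝓘(ℝ, V) 𝓘(ℝ, V) f (φ t o) := by
      have h : ∀ᶠ y in 𝓝 (φ 0 o), MDifferentiableAt 𝓘(ℝ, V) 𝓘(ℝ, V) f y := by rw [hφo]; exact hfe
      exact hφc.eventually h
    filter_upwards [hc.eventually hGd, hfe', hφe] with t ht hft hφt
    have h1 := (HasFDerivAt.comp p₀ (f := fun p => (t, p)) ht.hasFDerivAt
      (hasFDerivAt_prodMk_right t p₀)).fderiv
    have h2 : fderiv ℝ (G ∘ fun p => (t, p)) p₀ z = fderiv ℝ G (t, p₀) (0, z) := by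
      rw [h1]; simp
    rw [← h2, ← md_eq_fderiv]
    have hφt' : MDifferentiableAt 𝓘(ℝ, V) 𝓘(ℝ, V) (φ t) (θ p₀) := by rw [hθ0]; exact hφt
    have hft' : MDifferentiableAt 𝓘(ℝ, V) 𝓘(ℝ, V) f (φ t (θ p₀)) := by rw [hθ0]; exact hft
    refine (md_comp_apply (E := V) (E' := V) (E'' := V) (g := fun y : M => f (φ t y))
      (f := θ) p₀ (MDifferentiableAt.comp (θ p₀) (g := f) hft' hφt') hθd z).trans ?_
    rw [hθ', md_comp_apply (E := V) (E' := V) (E'' := V) (g := f) (f := φ t) (θ p₀) hft' hφt', hθ0]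
  have hQ : ∀ᶠ p in 𝓝 p₀, fderiv ℝ G (0, p) (1, 0) = md V V f (θ p) (X (θ p)) := by
    have hc : ContinuousAt (fun p : V => ((0 : ℝ), p)) p₀ := by fun_prop
    have hθc : Filter.Tendsto θ (𝓝 p₀) (𝓝 o) := by
      have := hθ.continuousAt.tendsto
      rwa [hθ0] at this
    filter_upwards [hc.eventually hGd, hθc.eventually hfe, hθc.eventually hφ0, hθc.eventually hφX]
      with p hp hfp h0 hXp
    have h1 := (HasFDerivAt.comp (0 : ℝ) (f := fun t => (t, p)) hp.hasFDerivAt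
      (hasFDerivAt_prodMk_left (0 : ℝ) p))
    have h2 : HasMFDerivAt 𝓘(ℝ, V) 𝓘(ℝ, V) f (φ 0 (θ p)) (md V V f (φ 0 (θ p))) := by
      rw [h0]; exact hfp.hasMFDerivAt
    have h3 := hasMFDerivAt_iff_hasFDerivAt.1 (h2.comp (0 : ℝ) hXp)
    have h4 := congrArg (fun L : ℝ →L[ℝ] V => L 1) (h1.unique h3)
    have h5 : fderiv ℝ G (0, p) (1, 0) = md V V f (φ 0 (θ p)) ((1 : ℝ) • X (φ 0 (θ p))) := by
      refine Eq.trans ?_ h4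
      simp
    rw [h5, one_smul, h0]
  obtain ⟨h1, h2⟩ := differentiableAt_of_mixed_partials (hG.of_le
    (WithTop.coe_le_coe.2 le_top : ((2 : ℕ∞) : WithTop ℕ∞) ≤ ∞)) hP hQ
  have h3 : fderiv ℝ (fun p => md V V f (θ p) (X (θ p))) p₀ z =
      md V V (fun y => md V V f y (X y)) o z := by
    rw [← md_eq_fderiv]
    refine (md_comp_apply (E := V) (E' := V) (E'' := V) (g := fun y : M => md V V f y (X y))
      (f := θ) p₀ (by rw [hθ0]; exact hX) hθd z).trans ?_
    rw [hθ', hθ0]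
  rw [h3] at h2
  have h4 := h1.hasFDerivAt.hasDerivAt
  rw [h2] at h4
  exact h4

end Flow

/-! ### Infinitesimal automorphisms force skewness -/

section Skew

variable {E : Type*} [NormedAddCommGroup E] [NormedSpace ℝ E] [FiniteDimensional ℝ E]
  {K : Type*} [TopologicalSpace K] [ChartedSpace E K] [Group K] [LieGroup 𝓘(ℝ, E) ∞ K]
  {H : Subgroup K} {m : ℕ} [ChartedSpace (Mink m) (K ⧸ H)]
  [IsManifold 𝓘(ℝ, Mink m) ∞ (K ⧸ H)] {u₀ : Mink m ≃L[ℝ] Mink m}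
  {P : GStructure (GN m) (K ⧸ H)}

theorem cof_one (w : Mink m) : cof H u₀ (1 : K) w = u₀.symm w := by
  have h : ∀ (k : K) (x : K ⧸ H), k = 1 →
      md (Mink m) (Mink m) (fun y : K ⧸ H => k • y) x w = w := by
    rintro k x rfl
    exact md_one_smul (Mink m) K x w
  exact congrArg u₀.symm (h _ _ inv_one)

theorem exists_GN_of_mem_frames
    (hπ : Manifold.IsSubmersion 𝓘(ℝ, E) 𝓘(ℝ, Mink m) ∞ (fun x : K => (x : K ⧸ H)))
    (hP : IsInvariantStructure P) (hu₀ : u₀ ∈ P.frames ((1 : K) : K ⧸ H)) {g : K} {y : K ⧸ H}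
    (hy : (g : K ⧸ H) = y) {u : Mink m ≃L[ℝ] TangentSpace 𝓘(ℝ, Mink m) y} (hu : u ∈ P.frames y) :
    ∃ n ∈ GN m, ∀ v, u v = frm H u₀ g (n v) := by
  subst hy
  exact (frames_mk_iff hπ hP hu₀ g u).1 hu

theorem eta_derivative_zero {f g : ℝ → Mink m} {f' g' : Mink m} (hf : HasDerivAt f f' 0)
    (hg : HasDerivAt g g' 0) {c : ℝ} (h : ∀ᶠ t in 𝓝 0, eta (f t) (g t) = c) :
    eta f' (g 0) + eta (f 0) g' = 0 := by
  have h1 := ((etaL m).hasFDerivAt.comp_hasDerivAt (0 : ℝ) hf).clm_apply hg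
  have h2 : HasDerivAt (fun t => (etaL m) (f t) (g t)) 0 0 :=
    (hasDerivAt_const (0 : ℝ) c).congr_of_eventuallyEq h
  exact h1.unique h2

/-- The curve `n t` is `dφ_t` at the origin, written from the frame `u₀` to the translated frame at
the moving point. It lies in `GN` since the flow preserves `P`. Its derivative is the derivative of
`dφ_t` minus that of the moving frame, which is minus the bracket of `X` with the frame field. -/
theorem exists_hasDerivAt_flow
    (hπ : Manifold.IsSubmersion 𝓘(ℝ, E) 𝓘(ℝ, Mink m) ∞ (fun x : K => (x : K ⧸ H)))
    (hP : IsInvariantStructure P) (hu₀ : u₀ ∈ P.frames ((1 : K) : K ⧸ H))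
    {U : Set (K ⧸ H)} (hU : IsOpen U) (ho : ((1 : K) : K ⧸ H) ∈ U)
    {X : ∀ y : K ⧸ H, TangentSpace 𝓘(ℝ, Mink m) y}
    (hX : ContMDiffOn 𝓘(ℝ, Mink m) 𝓘(ℝ, Mink m).tangent ∞
      (fun y => (⟨y, X y⟩ : TangentBundle 𝓘(ℝ, Mink m) (K ⧸ H))) U)
    (haut : P.IsInfinitesimalAutOn X U)
    {U' : Set (K ⧸ H)} (hU' : IsOpen U') (ho' : ((1 : K) : K ⧸ H) ∈ U') {σ : K ⧸ H → K}
    (hσ : ContMDiffOn 𝓘(ℝ, Mink m) 𝓘(ℝ, E) ∞ σ U') (hσU : ∀ y ∈ U', ((σ y : K) : K ⧸ H) = y)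
    (hσ1 : σ ((1 : K) : K ⧸ H) = 1) :
    ∃ n : ℝ → Mink m → Mink m, (∀ᶠ t in 𝓝 0, ∃ l ∈ GN m, ∀ v, n t v = l v) ∧ (∀ v, n 0 v = v) ∧
      ∀ v, HasDerivAt (fun t => n t v) (- cof H u₀ (1 : K) (VectorField.mlieBracket 𝓘(ℝ, Mink m) X
        (frameField H u₀ σ v) ((1 : K) : K ⧸ H))) 0 := by
  have := contMDiffSMul_quotient hπ
  let o : K ⧸ H := ((1 : K) : K ⧸ H)
  obtain ⟨W, hW, hoW, ε, hε, φ, hφ, hφW⟩ := haut o ho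
  have hε0 : Set.Ioo (-ε) ε ∈ 𝓝 (0 : ℝ) := Ioo_mem_nhds (by linarith) hε
  have h0ε : (0 : ℝ) ∈ Set.Ioo (-ε) ε := ⟨by linarith, hε⟩
  have hφs : ContMDiffAt (𝓘(ℝ, ℝ).prod 𝓘(ℝ, Mink m)) 𝓘(ℝ, Mink m) ∞
      (fun q : ℝ × (K ⧸ H) => φ q.1 q.2) (0, o) :=
    hφ.contMDiffAt (prod_mem_nhds hε0 (hW.mem_nhds hoW))
  have hφo : φ 0 o = o := (hφW o hoW).1
  have hder : ∀ y ∈ W, HasMFDerivAt 𝓘(ℝ, ℝ) 𝓘(ℝ, Mink m) (fun t => φ t y) 0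
      ((1 : ℝ →L[ℝ] ℝ).smulRight (X (φ 0 y))) := fun y hy =>
    ((hφW y hy).2.1 0 h0ε).hasMFDerivAt hε0
  have hXo := hX.contMDiffAt (hU.mem_nhds ho)
  have hXd := hXo.mdifferentiableAt (by simp)
  let f : K ⧸ H → Mink m := extChartAt 𝓘(ℝ, Mink m) o
  have hf2 : ContMDiffAt 𝓘(ℝ, Mink m) 𝓘(ℝ, Mink m) 2 f o := contMDiffAt_extChartAt
  have hfo : md (Mink m) (Mink m) f o = ContinuousLinearMap.id ℝ (Mink m) := md_chart_self o
  have hflow := fun z => hasDerivAt_md_flow hφs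
    (Filter.eventually_of_mem (hW.mem_nhds hoW) fun y hy => (hφW y hy).1)
    (Filter.eventually_of_mem (hW.mem_nhds hoW) hder) (mdifferentiableAt_md_apply hf2 hXd) z
  have hZ := fun v => (contMDiffAt_frameField (u₀ := u₀) hπ hU' hσ hσU v ho').mdifferentiableAt
    (by simp : (∞ : WithTop ℕ∞) ≠ 0)
  -- The moving frame along the flow line, read in the chart at the origin.
  let Θ : ℝ → Mink m →L[ℝ] Mink m := fun t =>
    md (Mink m) (Mink m) f (φ t o) ∘L frm H u₀ (σ (φ t o))
  have hΘv : ∀ v, HasDerivAt (fun t => Θ t v) (md (Mink m) (Mink m)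
      (fun y => md (Mink m) (Mink m) f y (frameField H u₀ σ v y)) o (X o)) 0 := by
    intro v
    have h1 := (mdifferentiableAt_md_apply hf2 (hZ v)).hasMFDerivAt
    have h2 : HasMFDerivAt 𝓘(ℝ, Mink m) 𝓘(ℝ, Mink m)
        (fun y => md (Mink m) (Mink m) f y (frameField H u₀ σ v y)) (φ 0 o)
        (md (Mink m) (Mink m)
          (fun y => md (Mink m) (Mink m) f y (frameField H u₀ σ v y)) o) := by
      rw [hφo]; exact h1
    have h3 : HasDerivAt (fun t => Θ t v) _ 0 :=
      HasFDerivAt.hasDerivAt (hasMFDerivAt_iff_hasFDerivAt.1 (h2.comp (0 : ℝ) (hder o hoW)))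
    have h4 : md (Mink m) (Mink m)
        (fun y => md (Mink m) (Mink m) f y (frameField H u₀ σ v y)) o ((1 : ℝ) • X (φ 0 o)) =
        md (Mink m) (Mink m)
          (fun y => md (Mink m) (Mink m) f y (frameField H u₀ σ v y)) o (X o) := by
      rw [one_smul, hφo]
    exact h4 ▸ h3
  have hΘ : DifferentiableAt ℝ Θ 0 := differentiableAt_of_clm_apply fun v => (hΘv v).differentiableAt
  have hΘ0 : Θ 0 = (u₀ : Mink m →L[ℝ] Mink m) := by
    refine ContinuousLinearMap.ext fun v => ?_
    have h1 : Θ 0 v = md (Mink m) (Mink m) f (φ 0 o) (frm H u₀ (σ (φ 0 o)) v) := rfl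
    rw [h1, hφo, hfo, hσ1, frm_one]
    rfl
  let n : ℝ → Mink m → Mink m := fun t v =>
    cof H u₀ (σ (φ t o)) (md (Mink m) (Mink m) (φ t) o (u₀ v))
  have hn0 : ∀ v, n 0 v = v := fun v => by
    have h1 : md (Mink m) (Mink m) (φ 0) o (u₀ v) = u₀ v := by
      rw [md_congr (g := fun y => y)
        (Filter.eventually_of_mem (hW.mem_nhds hoW) fun y hy => (hφW y hy).1), md_id]
      rfl
    have h2 : n 0 v = cof H u₀ (σ (φ 0 o)) (md (Mink m) (Mink m) (φ 0) o (u₀ v)) := rfl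
    rw [h2, h1, hφo, hσ1, cof_one, u₀.symm_apply_apply]
  have hφU' : ∀ᶠ t in 𝓝 (0 : ℝ), φ t o ∈ U' := by
    have hc := (hder o hoW).continuousAt
    exact hc.eventually (hU'.mem_nhds (hφo.symm ▸ ho' : φ 0 o ∈ U'))
  refine ⟨n, ?_, hn0, fun v => ?_⟩
  · filter_upwards [hφU', hε0] with t ht htε
    obtain ⟨u', hu', h'⟩ := ((hφW o hoW).2.2 t htε).2 u₀ hu₀
    obtain ⟨l, hl, hlu⟩ := exists_GN_of_mem_frames hπ hP hu₀ (hσU _ ht) hu'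
    refine ⟨l, hl, fun v => ?_⟩
    have h1 : md (Mink m) (Mink m) (φ t) o (u₀ v) = frm H u₀ (σ (φ t o)) (l v) :=
      (h' v).symm.trans (hlu v)
    exact (congrArg _ h1).trans (cof_frm (E := E) _ _)
  · have h1 := hasDerivAt_of_clm_apply_eq (ν := fun t => n t v) hΘ hΘ0 (hflow (u₀ v))
      (Filter.Eventually.of_forall fun t =>
        congrArg (md (Mink m) (Mink m) f (φ t o)) (frm_cof (E := E) _ _))
    have h2 : deriv Θ 0 (n 0 v) = md (Mink m) (Mink m)
        (fun y => md (Mink m) (Mink m) f y (frameField H u₀ σ v y)) o (X o) := by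
      rw [hn0]
      have h3 := hΘ.hasDerivAt.clm_apply (hasDerivAt_const (0 : ℝ) v)
      rw [map_zero, add_zero] at h3
      exact h3.unique (hΘv v)
    rw [h2] at h1
    refine HasDerivAt.congr_deriv h1 ?_
    have h4 := md_mlieBracket hf2 hXd (hZ v)
    have h5 : frameField H u₀ σ v o = u₀ v := by
      unfold frameField
      rw [hσ1]
      exact frm_one v
    rw [h5] at h4
    have h6 : (VectorField.mlieBracket 𝓘(ℝ, Mink m) X (frameField H u₀ σ v) o : Mink m) = _ :=
      (congrArg (fun L : Mink m →L[ℝ] Mink m =>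
        L (VectorField.mlieBracket 𝓘(ℝ, Mink m) X (frameField H u₀ σ v) o)) hfo).symm.trans h4
    refine Eq.trans ?_ (congrArg (fun w : Mink m => - w)
      ((cof_one (H := H) (K := K) (u₀ := u₀) _).trans (congrArg u₀.symm h6)).symm)
    rw [← map_neg]
    congr 1
    exact (neg_sub _ _).symm

/-- `cof_mlieBracket` expresses `B[A, x]` by three terms: the bracket of `X` with a frame field, a
derivative of the coefficients of that frame field, and a derivative of the coefficient of `X`. The
first two are skew in `(x, y)` as derivatives of expressions preserving `η` on `k^⊥`; the last is
orthogonal to `k^⊥`. -/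
theorem skew_of_infinitesimalAut
    (hπ : Manifold.IsSubmersion 𝓘(ℝ, E) 𝓘(ℝ, Mink m) ∞ (fun x : K => (x : K ⧸ H)))
    (hP : IsInvariantStructure P) (hu₀ : u₀ ∈ P.frames ((1 : K) : K ⧸ H))
    {U : Set (K ⧸ H)} (hU : IsOpen U) (ho : ((1 : K) : K ⧸ H) ∈ U)
    {X : ∀ y : K ⧸ H, TangentSpace 𝓘(ℝ, Mink m) y}
    (hX : ContMDiffOn 𝓘(ℝ, Mink m) 𝓘(ℝ, Mink m).tangent ∞
      (fun y => (⟨y, X y⟩ : TangentBundle 𝓘(ℝ, Mink m) (K ⧸ H))) U)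
    (hXl : ∀ y ∈ U, X y ∈ nullLine P y)
    (haut : P.IsInfinitesimalAutOn X U) {A x y : E}
    (hA : coB E H u₀ A = cof H u₀ (1 : K) (X ((1 : K) : K ⧸ H)))
    (hx : eta (kvec m) (coB E H u₀ x) = 0) (hy : eta (kvec m) (coB E H u₀ y) = 0) :
    eta (coB E H u₀ (brk K A x)) (coB E H u₀ y) +
      eta (coB E H u₀ x) (coB E H u₀ (brk K A y)) = 0 := by
  have := contMDiffSMul_quotient hπ
  obtain ⟨U', hU', ho', σ, hσ, hσU, hσ1⟩ := exists_local_section hπ (1 : K)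
  obtain ⟨n, hn, hn0, hnd⟩ := exists_hasDerivAt_flow hπ hP hu₀ hU ho hX haut hU' ho' hσ hσU hσ1
  have hXo := hX.contMDiffAt (hU.mem_nhds ho)
  have hZ := fun v => contMDiffAt_frameField (u₀ := u₀) hπ hU' hσ hσU v ho'
  have hπc : ∀ {s : Set (K ⧸ H)}, IsOpen s → ((1 : K) : K ⧸ H) ∈ s →
      ∀ᶠ k : K in 𝓝 (1 : K), (k : K ⧸ H) ∈ s := fun hs h1 =>
    (hπ.contMDiff.continuous.continuousAt (x := (1 : K))).preimage_mem_nhds (hs.mem_nhds h1)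
  let Z : Mink m → K → Mink m := fun v k => cof H u₀ k (frameField H u₀ σ v (k : K ⧸ H))
  have hZ1 : ∀ v, Z v 1 = v := fun v => by
    have h1 : Z v 1 = cof H u₀ (1 : K) (frm H u₀ (σ ((1 : K) : K ⧸ H)) v) := rfl
    rw [h1, hσ1, cof_frm (E := E)]
  have hZd : ∀ v, MDifferentiableAt 𝓘(ℝ, E) 𝓘(ℝ, Mink m) (Z v) 1 := fun v =>
    (contMDiffAt_cof hπ (hZ v)).mdifferentiableAt (by simp)
  have hbr : ∀ x, coB E H u₀ (brk K A x) =
      cof H u₀ (1 : K) (VectorField.mlieBracket 𝓘(ℝ, Mink m) X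
        (frameField H u₀ σ (coB E H u₀ x)) ((1 : K) : K ⧸ H)) -
      md E (Mink m) (Z (coB E H u₀ x)) 1 A +
      md E (Mink m) (fun k : K => cof H u₀ k (X (k : K ⧸ H))) 1 x := fun x => by
    have h1 := cof_mlieBracket (u₀ := u₀) hπ hXo (hZ (coB E H u₀ x)) hA (hZ1 _).symm
    rw [Lm_one, Lm_one] at h1
    rw [h1]
    abel
  -- The coefficient of `X` stays in `ℝk`, so its pairing with any `v ∈ k^⊥` vanishes identically.
  have hline : ∀ x v, eta (kvec m) v = 0 →
      eta (md E (Mink m) (fun k : K => cof H u₀ k (X (k : K ⧸ H))) 1 x) v = 0 := by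
    intro x v hv
    rw [eta_comm]
    refine md_eq_zero_of_eventually (etaL m v)
      ((contMDiffAt_cof hπ hXo).mdifferentiableAt (by simp)) ?_ x
    filter_upwards [hπc hU ho] with k hk
    obtain ⟨c, hc⟩ := Submodule.mem_span_singleton.1
      ((mem_nullLine_mk_iff hπ hP hu₀ k _).1 (hXl _ hk))
    rw [etaL_apply, ← hc, eta_smul_right, eta_comm, hv, mul_zero]
  have hflow : ∀ v w, eta (kvec m) v = 0 → eta (kvec m) w = 0 →
      eta (cof H u₀ (1 : K) (VectorField.mlieBracket 𝓘(ℝ, Mink m) X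
        (frameField H u₀ σ v) ((1 : K) : K ⧸ H))) w +
      eta v (cof H u₀ (1 : K) (VectorField.mlieBracket 𝓘(ℝ, Mink m) X
        (frameField H u₀ σ w) ((1 : K) : K ⧸ H))) = 0 := by
    intro v w hv hw
    have h1 := eta_derivative_zero (hnd v) (hnd w) (c := eta v w) (by
      filter_upwards [hn] with t ⟨l, hl, hlv⟩
      rw [hlv, hlv]
      exact hl.2.1 v w hv hw)
    rw [hn0, hn0, eta_neg_left, eta_neg_right] at h1
    linarith
  -- The frames translated by `k` and by `σ(kH)` both belong to `P` and differ by an element of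
  -- `GN`, so `η` of the coefficients is constant.
  have hsec : ∀ v w, eta (kvec m) v = 0 → eta (kvec m) w = 0 →
      eta (md E (Mink m) (Z v) 1 A) w + eta v (md E (Mink m) (Z w) 1 A) = 0 := by
    intro v w hv hw
    have h1 := md_clm_apply (f := fun k : K => etaL m (Z v k)) (ζ := Z w) (x := 1)
      (fun u => ((etaL m).flip u).differentiableAt.mdifferentiableAt.comp 1 (hZd v)) (hZd w) A
    have h2 : (fun k : K => etaL m (Z v k) (Z w k)) =ᶠ[𝓝 1] fun _ => eta v w := by
      filter_upwards [hπc hU' ho'] with k hk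
      obtain ⟨u₁, hu₁, h₁⟩ := hP.exists_frame (σ (k : K ⧸ H))
        ((smul_mk_one _).trans (hσU _ hk)) hu₀
      obtain ⟨l, hl, hlu⟩ := exists_GN_of_mem_frames hπ hP hu₀ rfl hu₁
      have h3 : ∀ v, Z v k = l v := fun v => by
        have h4 : frameField H u₀ σ v (k : K ⧸ H) = frm H u₀ k (l v) :=
          (h₁ v).symm.trans (hlu v)
        exact (congrArg (cof H u₀ k) h4).trans (cof_frm (E := E) k _)
      rw [h3, h3]
      exact hl.2.1 v w hv hw
    rw [md_congr h2, md_const, hZ1] at h1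
    have h5 := md_clm_comp (F' := ℝ) ((etaL m).flip w) (hZd v) A
    have h6 : (0 : ℝ) = eta v (md E (Mink m) (Z w) 1 A) + eta (md E (Mink m) (Z v) 1 A) w := by
      refine h1.trans ?_
      rw [hZ1]
      exact congrArg (fun r : ℝ => eta v (md E (Mink m) (Z w) 1 A) + r) h5
    linarith
  have e1 := hflow _ _ hx hy
  have e2 := hsec _ _ hx hy
  have e3 := hline x _ hy
  have e4 := hline y _ hx
  rw [hbr x, hbr y]
  simp only [eta_add_left, eta_add_right, sub_eq_add_neg, eta_neg_left, eta_neg_right]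
  rw [eta_comm (coB E H u₀ x) (md E (Mink m) (fun k : K => cof H u₀ k (X (k : K ⧸ H))) 1 y), e3, e4]
  linarith

end Skew

/-! ### Integral curves of left invariant fields -/

section IntegralCurve

variable {E : Type*} [NormedAddCommGroup E] [NormedSpace ℝ E] [FiniteDimensional ℝ E]
  {K : Type*} [TopologicalSpace K] [ChartedSpace E K] [Group K] [LieGroup 𝓘(ℝ, E) ∞ K]

/-- Bootstrapping: if the curve is of class `C^n`, so is its velocity, a smooth function of the
position, and the curve is of class `C^{n+1}`. -/
theorem contMDiffAt_integralCurve {γ : ℝ → K} {A : E} {s : Set ℝ} (hs : IsOpen s)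
    (hγ : ∀ t ∈ s, HasMFDerivAt 𝓘(ℝ, ℝ) 𝓘(ℝ, E) γ t
      ((1 : ℝ →L[ℝ] ℝ).smulRight (Lm E (γ t) A))) (n : ℕ) :
    ∀ t ∈ s, ContMDiffAt 𝓘(ℝ, ℝ) 𝓘(ℝ, E) n γ t := by
  induction n with
  | zero =>
    intro t ht
    rw [contMDiffAt_iff_target]
    refine ⟨(hγ t ht).continuousAt, ?_⟩
    rw [contMDiffAt_iff_contDiffAt]
    refine contDiffAt_zero.2 ⟨s ∩ γ ⁻¹' (extChartAt 𝓘(ℝ, E) (γ t)).source, ?_, ?_⟩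
    · exact Filter.inter_mem (hs.mem_nhds ht)
        ((hγ t ht).continuousAt.preimage_mem_nhds (extChartAt_source_mem_nhds (γ t)))
    · intro r hr
      exact ((continuousAt_extChartAt' hr.2).comp (hγ r hr.1).continuousAt).continuousWithinAt
  | succ n ih =>
    intro t ht
    rw [contMDiffAt_iff_target]
    refine ⟨(hγ t ht).continuousAt, ?_⟩
    rw [contMDiffAt_iff_contDiffAt]
    let f : K → E := extChartAt 𝓘(ℝ, E) (γ t)
    have hL := (contMDiffAt_tangentBundle_iff.1
      (contMDiffAt_Lm (n := (n : ℕ∞)) (ih t ht) (contMDiffAt_const (c := A)))).2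
    have hL' : ContDiffAt ℝ n (fun r => md E E f (γ r) (Lm E (γ r) A)) t :=
      contMDiffAt_iff_contDiffAt.1 hL
    refine contDiffAt_succ_iff_hasFDerivAt.2
      ⟨fun r => (1 : ℝ →L[ℝ] ℝ).smulRight (md E E f (γ r) (Lm E (γ r) A)),
        ⟨s ∩ γ ⁻¹' (chartAt E (γ t)).source, ?_, fun r hr => ?_⟩, ?_⟩
    · exact Filter.inter_mem (hs.mem_nhds ht)
        ((hγ t ht).continuousAt.preimage_mem_nhds (chart_source_mem_nhds E (γ t)))
    · have h1 : HasMFDerivAt 𝓘(ℝ, E) 𝓘(ℝ, E) f (γ r) (md E E f (γ r)) :=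
        (mdifferentiableAt_extChartAt (I := 𝓘(ℝ, E)) hr.2).hasMFDerivAt
      have h2 := hasMFDerivAt_iff_hasFDerivAt.1 (h1.comp r (hγ r hr.1))
      refine h2.congr_fderiv ?_
      refine ContinuousLinearMap.ext fun c => ?_
      exact (md E E f (γ r)).map_smul c (Lm E (γ r) A)
    · exact contDiffAt_const.smulRight hL'

theorem exists_integralCurve (A : E) :
    ∃ γ : ℝ → K, ∃ δ : ℝ, 0 < δ ∧ γ 0 = 1 ∧ ∀ t, |t| < δ →
      ContMDiffAt 𝓘(ℝ, ℝ) 𝓘(ℝ, E) ∞ γ t ∧ md ℝ E γ t 1 = Lm E (γ t) A := by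
  have : CompleteSpace E := FiniteDimensional.complete ℝ E
  have hv : ContMDiffAt 𝓘(ℝ, E) 𝓘(ℝ, E).tangent 1
      (fun x : K => (⟨x, lfield (fun _ => A) x⟩ : TangentBundle 𝓘(ℝ, E) K)) 1 :=
    contMDiffAt_Lm (n := 1) contMDiffAt_id (contMDiffAt_const (c := A))
  obtain ⟨γ, hγ0, hγ⟩ := exists_isMIntegralCurveAt_of_contMDiffAt_boundaryless (0 : ℝ) hv
  obtain ⟨δ, hδ, hγδ⟩ := isMIntegralCurveAt_iff'.1 hγ
  have hd : ∀ t ∈ Metric.ball (0 : ℝ) δ, HasMFDerivAt 𝓘(ℝ, ℝ) 𝓘(ℝ, E) γ t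
      ((1 : ℝ →L[ℝ] ℝ).smulRight (Lm E (γ t) A)) := fun t ht =>
    (hγδ t ht).hasMFDerivAt (Metric.isOpen_ball.mem_nhds ht)
  refine ⟨γ, δ, hδ, hγ0, fun t ht => ?_⟩
  have ht' : t ∈ Metric.ball (0 : ℝ) δ := by simpa using ht
  refine ⟨contMDiffAt_infty.2 fun n =>
    contMDiffAt_integralCurve Metric.isOpen_ball hd n t ht', ?_⟩
  have h1 : md ℝ E γ t = (1 : ℝ →L[ℝ] ℝ).smulRight (Lm E (γ t) A) := (hd t ht').mfderiv
  rw [h1]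
  simp

/-- An integral curve of the left invariant vector field `A`, parametrized such that its speed
`ρ` satisfies `ρ' = κ ρ²`. -/
theorem exists_reparametrized_integralCurve (A : E) (κ : ℝ) :
    ∃ q : ℝ → K, ∃ ρ : ℝ → ℝ, ∃ δ : ℝ, 0 < δ ∧ q 0 = 1 ∧ ρ 0 = 1 ∧ ∀ s, |s| < δ →
      ContMDiffAt 𝓘(ℝ, ℝ) 𝓘(ℝ, E) ∞ q s ∧ md ℝ E q s 1 = Lm E (q s) (ρ s • A) ∧
      HasDerivAt ρ (κ * ρ s ^ 2) s ∧ ρ s ≠ 0 := by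
  obtain ⟨γ, δ, hδ, hγ0, hγ⟩ := exists_integralCurve (K := K) A
  obtain ⟨r, hr0, δ₁, hδ₁, hr⟩ : ∃ r : ℝ → ℝ, r 0 = 0 ∧ ∃ δ₁ : ℝ, 0 < δ₁ ∧ ∀ s, |s| < δ₁ →
      1 - κ * s ≠ 0 ∧ ContDiffAt ℝ ∞ r s ∧ HasDerivAt r (1 - κ * s)⁻¹ s := by
    rcases eq_or_ne κ 0 with rfl | hκ
    · exact ⟨id, rfl, 1, one_pos, fun s _ =>
        ⟨by simp, contDiffAt_id, by simpa using hasDerivAt_id s⟩⟩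
    -- The equation `ρ' = κ ρ²` with `ρ 0 = 1` has solution `ρ = 1/(1 - κ s)`, and `r` is its
    -- primitive vanishing at `0`. The bound `|κ|⁻¹` keeps `1 - κ s` positive.
    · refine ⟨fun s => - Real.log (1 - κ * s) / κ, by simp, |κ|⁻¹, by positivity, fun s hs => ?_⟩
      have h1 : |κ * s| < 1 := by
        rw [abs_mul]
        calc |κ| * |s| < |κ| * |κ|⁻¹ := by gcongr
          _ = 1 := mul_inv_cancel₀ (by simpa using hκ)
      have h2 : 1 - κ * s ≠ 0 := by
        have := (abs_lt.1 h1).2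
        linarith
      refine ⟨h2, ?_, ?_⟩
      · have h3 : ContDiffAt ℝ ∞ (fun s => 1 - κ * s) s := by fun_prop
        exact ((h3.log h2).neg).div_const κ
      · have h3 : HasDerivAt (fun s => 1 - κ * s) (-κ) s := by
          simpa using ((hasDerivAt_id s).const_mul κ).const_sub 1
        refine (((h3.log h2).neg).div_const κ).congr_deriv ?_
        field_simp
  have hrc : ContinuousAt r 0 := (hr 0 (by simpa using hδ₁)).2.1.continuousAt
  obtain ⟨δ₂, hδ₂, hr2⟩ := Metric.continuousAt_iff.1 hrc δ hδ
  refine ⟨fun s => γ (r s), fun s => (1 - κ * s)⁻¹, min δ₁ δ₂, lt_min hδ₁ hδ₂, by simp [hr0, hγ0],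
    by simp, fun s hs => ?_⟩
  obtain ⟨h1, h2, h3⟩ := hr s (hs.trans_le (min_le_left _ _))
  have h4 : |r s| < δ := by
    have := hr2 (x := s) (by simpa using hs.trans_le (min_le_right _ _))
    simpa [hr0] using this
  obtain ⟨h5, h6⟩ := hγ _ h4
  refine ⟨h5.comp s h2.contMDiffAt, ?_, ?_, inv_ne_zero h1⟩
  · have h7 := md_comp_apply (E := ℝ) (E' := ℝ) (E'' := E) (g := γ) (f := r) s
      (h5.mdifferentiableAt (by simp)) (h2.contMDiffAt.mdifferentiableAt (by simp)) 1
    have h8 : md ℝ ℝ r s 1 = (1 - κ * s)⁻¹ • (1 : ℝ) := by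
      rw [md_eq_fderiv, smul_eq_mul, mul_one]
      simpa using h3.deriv
    rw [h8, map_smul, h6] at h7
    exact h7.trans ((Lm E (γ (r s))).map_smul _ _).symm
  · have h7 : HasDerivAt (fun s => 1 - κ * s) (-κ) s := by
      simpa using ((hasDerivAt_id s).const_mul κ).const_sub 1
    refine (h7.inv h1).congr_deriv ?_
    field_simp

/-- The left logarithmic derivative of a product is that of the second factor plus `Ad` of its
inverse applied to that of the first. -/
theorem md_mul_Lm {F : Type*} [NormedAddCommGroup F] [NormedSpace ℝ F]
    {N : Type*} [TopologicalSpace N] [ChartedSpace F N] {p q : N → K} {x : N}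
    (hp : MDifferentiableAt 𝓘(ℝ, F) 𝓘(ℝ, E) p x) (hq : MDifferentiableAt 𝓘(ℝ, F) 𝓘(ℝ, E) q x)
    {w : F} {ζ χ : E} (hζ : md F E p x w = Lm E (p x) ζ) (hχ : md F E q x w = Lm E (q x) χ) :
    md F E (fun y => p y * q y) x w = Lm E (p x * q x) (adInv E (q x) ζ + χ) := by
  rw [md_mul hp hq, hζ, hχ, map_add, Lm_mul, Lm_mul, Lm_adInv]
  congr 1
  have h1 := md_comp_apply (E := E) (E' := E) (E'' := E) (g := fun k : K => k * q x)
    (f := fun k : K => p x * k) 1 (mdifferentiableAt_mul_right _ _)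
    (mdifferentiableAt_mul_left _ _) ζ
  have h2 := md_comp_apply (E := E) (E' := E) (E'' := E) (g := fun k : K => p x * k)
    (f := fun k : K => k * q x) 1 (mdifferentiableAt_mul_left _ _)
    (mdifferentiableAt_mul_right _ _) ζ
  simp only [mul_one, one_mul, mul_assoc] at h1 h2
  exact h1.symm.trans h2

end IntegralCurve

/-! ### Maps with prescribed derivative and the inverse function theorem -/

section LocalDiffeo

variable {V : Type*} [NormedAddCommGroup V] [NormedSpace ℝ V] [FiniteDimensional ℝ V]
  {M : Type*} [TopologicalSpace M] [ChartedSpace V M] [IsManifold 𝓘(ℝ, V) ∞ M]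

theorem exists_map_md_eq {D : Type*} [NormedAddCommGroup D] [NormedSpace ℝ D] (x : M)
    (L : D →L[ℝ] V) :
    ∃ h : D → M, ∃ δ : ℝ, 0 < δ ∧ h 0 = x ∧ md D V h 0 = L ∧
      ∀ c ∈ Metric.ball 0 δ, ContMDiffAt 𝓘(ℝ, D) 𝓘(ℝ, V) ∞ h c := by
  let f : M → V := extChartAt 𝓘(ℝ, V) x
  let θ : V → M := (extChartAt 𝓘(ℝ, V) x).symm
  let l : D → V := fun c => f x + L c
  have hl : ContDiff ℝ ∞ l := by fun_prop
  have hl0 : l 0 = f x := by simp [l]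
  have hθ : ∀ᶠ y in 𝓝 (f x), ContMDiffAt 𝓘(ℝ, V) 𝓘(ℝ, V) ∞ θ y := by
    filter_upwards [eventually_mem_nhds_iff.2 (extChartAt_target_mem_nhds (I := 𝓘(ℝ, V)) x)]
      with y hy
    exact (contMDiffOn_extChartAt_symm (n := ∞) x).contMDiffAt hy
  have hl1 : Filter.Tendsto l (𝓝 0) (𝓝 (f x)) := by
    rw [← hl0]; exact hl.continuous.continuousAt
  obtain ⟨δ, hδ, h⟩ := Metric.eventually_nhds_iff_ball.1 (hl1.eventually hθ)
  refine ⟨fun c => θ (l c), δ, hδ, ?_, ?_, fun c hc => (h c hc).comp c hl.contMDiff.contMDiffAt⟩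
  · exact (congrArg θ hl0).trans (extChartAt_to_inv (I := 𝓘(ℝ, V)) x)
  · have h1 := md_comp (E := D) (E' := V) (E'' := V) (g := θ) (f := l) 0
      ((h 0 (Metric.mem_ball_self hδ)).mdifferentiableAt (by simp))
      (hl.contMDiff.contMDiffAt.mdifferentiableAt (by simp))
    rw [hl0, md_chart_symm_self, md_eq_fderiv] at h1
    refine h1.trans ?_
    have h2 : HasFDerivAt l L 0 := L.hasFDerivAt.const_add (f x)
    rw [h2.fderiv]
    rfl

/-- The inverse function theorem in a chart. The parameter domain is made an exact ball, which lets
short coordinate translations serve as a flow. -/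
theorem exists_localInverse {Ψ : V → M} {δ : ℝ} (hδ : 0 < δ)
    (hΨ : ∀ v ∈ Metric.ball 0 δ, ContMDiffAt 𝓘(ℝ, V) 𝓘(ℝ, V) ∞ Ψ v) {e : V ≃L[ℝ] V}
    (he : md V V Ψ 0 = e) :
    ∃ R : ℝ, 0 < R ∧ R ≤ δ ∧ ∃ U : Set M, IsOpen U ∧ ∃ ψ : M → V,
      ContMDiffOn 𝓘(ℝ, V) 𝓘(ℝ, V) ∞ ψ U ∧ (∀ y ∈ U, ψ y ∈ Metric.ball 0 R ∧ Ψ (ψ y) = y) ∧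
      ∀ v ∈ Metric.ball 0 R, Ψ v ∈ U ∧ ψ (Ψ v) = v := by
  have : CompleteSpace V := FiniteDimensional.complete ℝ V
  have h0 := hΨ 0 (Metric.mem_ball_self hδ)
  let c := chartAt V (Ψ 0)
  let F : V → V := fun v => c (Ψ v)
  have hc : ∀ y ∈ c.source, ContMDiffAt 𝓘(ℝ, V) 𝓘(ℝ, V) ∞ c y := fun y hy =>
    (contMDiffOn_chart (n := ∞) (I := 𝓘(ℝ, V)) (x := Ψ 0)).contMDiffAt (c.open_source.mem_nhds hy)
  have hF : ∀ v ∈ Metric.ball 0 δ, Ψ v ∈ c.source → ContDiffAt ℝ ∞ F v := fun v hv hv' =>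
    contMDiffAt_iff_contDiffAt.1 ((hc _ hv').comp v (hΨ v hv))
  have hs0 : Ψ 0 ∈ c.source := mem_chart_source V (Ψ 0)
  have hF0 := hF 0 (Metric.mem_ball_self hδ) hs0
  have hF0' : HasFDerivAt F (e : V →L[ℝ] V) 0 := by
    have h1 := md_comp (E := V) (E' := V) (E'' := V) (g := c) (f := Ψ) 0
      ((hc _ hs0).mdifferentiableAt (by simp)) (h0.mdifferentiableAt (by simp))
    have h2 : md V V c (Ψ 0) = ContinuousLinearMap.id ℝ V := by
      have := md_chart_self (E := V) (Ψ 0)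
      simpa using this
    rw [h2, he, md_eq_fderiv] at h1
    have h3 := (hF0.differentiableAt (by simp)).hasFDerivAt
    exact h3.congr_fderiv h1
  let G := hF0.toOpenPartialHomeomorph F hF0' (by simp)
  have hG : ∀ v, G v = F v := fun v => rfl
  have hGs : (0 : V) ∈ G.source := hF0.mem_toOpenPartialHomeomorph_source hF0' (by simp)
  have hinv : ∀ᶠ v in 𝓝 (0 : V), ∃ e' : V ≃L[ℝ] V, (e' : V →L[ℝ] V) = fderiv ℝ F v := by
    have h1 : ContinuousAt (fderiv ℝ F) 0 :=
      (hF0.fderiv_right (m := 0) (by simp)).continuousAt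
    have h2 : Set.range ((↑) : (V ≃L[ℝ] V) → V →L[ℝ] V) ∈ 𝓝 (fderiv ℝ F 0) := by
      rw [hF0'.fderiv]; exact ContinuousLinearEquiv.nhds e
    exact h1.eventually h2
  have hev : ∀ᶠ v in 𝓝 (0 : V), v ∈ Metric.ball 0 δ ∧ Ψ v ∈ c.source ∧ v ∈ G.source ∧
      ∃ e' : V ≃L[ℝ] V, (e' : V →L[ℝ] V) = fderiv ℝ F v := by
    filter_upwards [Metric.ball_mem_nhds (0 : V) hδ,
      h0.continuousAt.preimage_mem_nhds (c.open_source.mem_nhds hs0),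
      G.open_source.mem_nhds hGs, hinv] with v h1 h2 h3 h4 using ⟨h1, h2, h3, h4⟩
  obtain ⟨R, hR, hR'⟩ := Metric.eventually_nhds_iff_ball.1 hev
  let R' := min R δ
  have hB : ∀ v ∈ Metric.ball (0 : V) R', v ∈ Metric.ball 0 δ ∧ Ψ v ∈ c.source ∧ v ∈ G.source ∧
      ∃ e' : V ≃L[ℝ] V, (e' : V →L[ℝ] V) = fderiv ℝ F v := fun v hv =>
    hR' v (Metric.ball_subset_ball (min_le_left _ _) hv)
  let T : Set V := G.target ∩ G.symm ⁻¹' Metric.ball 0 R'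
  have hT : IsOpen T := G.isOpen_inter_preimage_symm Metric.isOpen_ball
  refine ⟨R', lt_min hR hδ, min_le_right _ _, c.source ∩ c ⁻¹' T,
    c.isOpen_inter_preimage hT, fun y => G.symm (c y), ?_, ?_, ?_⟩
  · rintro y ⟨hy, hy'⟩
    obtain ⟨h1, h2, h3, e', he'⟩ := hB _ hy'.2
    have h4 : HasFDerivAt G (e' : V →L[ℝ] V) (G.symm (c y)) := by
      rw [he']; exact ((hF _ h1 h2).differentiableAt (by simp)).hasFDerivAt
    have h5 := G.contDiffAt_symm hy'.1 h4 (hF _ h1 h2)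
    exact (h5.contMDiffAt.comp y (hc y hy)).contMDiffWithinAt
  · rintro y ⟨hy, hy'⟩
    refine ⟨hy'.2, c.injOn (hB _ hy'.2).2.1 hy ?_⟩
    exact G.right_inv hy'.1
  · intro v hv
    obtain ⟨h1, h2, h3, -⟩ := hB v hv
    have h4 : G.symm (c (Ψ v)) = v := G.left_inv h3
    refine ⟨⟨h2, ?_, ?_⟩, h4⟩
    · exact G.map_source h3
    · change G.symm (c (Ψ v)) ∈ Metric.ball (0 : V) R'
      rw [h4]
      exact hv

end LocalDiffeo

/-! ### Coordinate vector fields and their flows -/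

section CoordinateFlow

variable {V : Type*} [NormedAddCommGroup V] [NormedSpace ℝ V]
  {M : Type*} [TopologicalSpace M] [ChartedSpace V M] [IsManifold 𝓘(ℝ, V) ∞ M]
  {G : Subgroup (V ≃L[ℝ] V)} {P : GStructure G M} {Ψ : V → M} {R : ℝ} {U : Set M} {ψ : M → V}

theorem contMDiffOn_coordinateField
    (hΨ : ∀ v ∈ Metric.ball 0 R, ContMDiffAt 𝓘(ℝ, V) 𝓘(ℝ, V) ∞ Ψ v) (hU : IsOpen U)
    (hψ : ContMDiffOn 𝓘(ℝ, V) 𝓘(ℝ, V) ∞ ψ U)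
    (hψU : ∀ y ∈ U, ψ y ∈ Metric.ball 0 R ∧ Ψ (ψ y) = y) (k : V) :
    ContMDiffOn 𝓘(ℝ, V) 𝓘(ℝ, V).tangent ∞
      (fun y => (⟨y, md V V Ψ (ψ y) k⟩ : TangentBundle 𝓘(ℝ, V) M)) U := by
  intro y hy
  have h1 : ContMDiffAt 𝓘(ℝ, V) 𝓘(ℝ, V).tangent ∞
      (fun y => (⟨ψ y, k⟩ : TangentBundle 𝓘(ℝ, V) V)) y := by
    refine contMDiffAt_tangentBundle_iff.2 ⟨hψ.contMDiffAt (hU.mem_nhds hy), ?_⟩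
    have h2 : ∀ a b : V, md V V (extChartAt 𝓘(ℝ, V) a) b k = k := fun a b => by
      simp only [extChartAt_model_space_eq_id]
      exact congrArg (fun L : V →L[ℝ] V => L k) (md_id b)
    simp only [h2]
    exact contMDiffAt_const
  have h3 := tangentMap_contMDiffAt (n := ⊤) Metric.isOpen_ball
    (fun v hv => (hΨ v hv).contMDiffWithinAt) (hψU y hy).1 h1
  refine (h3.congr_of_eventuallyEq ?_).contMDiffWithinAt
  filter_upwards [hU.mem_nhds hy] with z hz
  exact tangentBundle_mk_congr (hψU z hz).2.symm _

/-- In the coordinates the flow is translation by `t k`, so only the invariance of the frames under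
these translations has to be supplied. -/
theorem isInfinitesimalAutOn_coordinateField
    (hΨ : ∀ v ∈ Metric.ball 0 R, ContMDiffAt 𝓘(ℝ, V) 𝓘(ℝ, V) ∞ Ψ v) (hU : IsOpen U)
    (hψ : ContMDiffOn 𝓘(ℝ, V) 𝓘(ℝ, V) ∞ ψ U)
    (hψU : ∀ y ∈ U, ψ y ∈ Metric.ball 0 R ∧ Ψ (ψ y) = y)
    (hΨU : ∀ v ∈ Metric.ball 0 R, Ψ v ∈ U ∧ ψ (Ψ v) = v) (k : V)
    (hP : ∀ y ∈ U, ∀ t : ℝ, ψ y + t • k ∈ Metric.ball 0 R → ∀ u ∈ P.frames y,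
      ∃ u' ∈ P.frames (Ψ (ψ y + t • k)), ∀ w,
        u' w = md V V Ψ (ψ y + t • k) (md V V ψ y (u w))) :
    P.IsInfinitesimalAutOn (fun y => md V V Ψ (ψ y) k) U := by
  intro p hp
  obtain ⟨r, hr, hrb⟩ := Metric.mem_nhds_iff.1
    (Metric.isOpen_ball.mem_nhds (hψU p hp).1)
  -- Starting within `r/2` of `ψ p` and moving by at most `r/2` keeps the point in the coordinate
  -- ball; adding `1` avoids division by zero.
  let ε : ℝ := r / 2 / (‖k‖ + 1)
  have hε : 0 < ε := by positivity
  let W : Set M := U ∩ ψ ⁻¹' Metric.ball (ψ p) (r / 2)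
  have hW : IsOpen W := hψ.continuousOn.isOpen_inter_preimage hU Metric.isOpen_ball
  have hball : ∀ x ∈ W, ∀ t ∈ Set.Ioo (-ε) ε, ψ x + t • k ∈ Metric.ball (0 : V) R := by
    rintro x ⟨-, hx⟩ t ht
    refine hrb ?_
    have h1 : ‖ψ x - ψ p‖ < r / 2 := by simpa [dist_eq_norm] using hx
    have h2 : ‖t • k‖ ≤ r / 2 := by
      rw [norm_smul, Real.norm_eq_abs]
      calc |t| * ‖k‖ ≤ ε * (‖k‖ + 1) := by
            gcongr
            · exact (abs_lt.2 ht).le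
            · linarith
        _ = r / 2 := div_mul_cancel₀ _ (by positivity)
    rw [Metric.mem_ball, dist_eq_norm]
    calc ‖ψ x + t • k - ψ p‖ = ‖(ψ x - ψ p) + t • k‖ := by congr 1; abel
      _ ≤ ‖ψ x - ψ p‖ + ‖t • k‖ := norm_add_le _ _
      _ < r := by linarith
  refine ⟨W, hW, ⟨hp, Metric.mem_ball_self (by positivity)⟩, ε, hε,
    fun t y => Ψ (ψ y + t • k), ?_, fun x hx => ⟨?_, fun t ht => ?_, fun t ht => ⟨?_, ?_⟩⟩⟩
  · rintro ⟨t, x⟩ ⟨ht, hx⟩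
    have h1 : ContMDiffAt (𝓘(ℝ, ℝ).prod 𝓘(ℝ, V)) 𝓘(ℝ, V) ∞
        (fun q : ℝ × M => ψ q.2 + q.1 • k) (t, x) :=
      ((hψ.contMDiffAt (hU.mem_nhds hx.1)).comp (t, x) contMDiffAt_snd).add
        (contMDiffAt_fst.smul contMDiffAt_const)
    exact (ContMDiffAt.comp (t, x) (hΨ _ (hball x hx t ht)) h1).contMDiffWithinAt
  · simpa using (hψU x hx.1).2
  · have h1 : HasMFDerivAt 𝓘(ℝ, ℝ) 𝓘(ℝ, V) (fun t : ℝ => ψ x + t • k) t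
        ((1 : ℝ →L[ℝ] ℝ).smulRight k) := by
      apply HasFDerivAt.hasMFDerivAt
      exact (((1 : ℝ →L[ℝ] ℝ).smulRight k).hasFDerivAt).const_add (ψ x)
    have h2 := hball x hx t ht
    have h3 : HasMFDerivAt 𝓘(ℝ, V) 𝓘(ℝ, V) Ψ (ψ x + t • k) (md V V Ψ (ψ x + t • k)) :=
      ((hΨ _ h2).mdifferentiableAt (by simp)).hasMFDerivAt
    refine (HasMFDerivAt.congr_mfderiv (h3.comp t h1) ?_).hasMFDerivWithinAt
    refine ContinuousLinearMap.ext fun c => ?_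
    have h4 : ∀ c : ℝ, md V V Ψ (ψ x + t • k) (c • k) =
        c • md V V Ψ (ψ (Ψ (ψ x + t • k))) k := fun c => by
      rw [(hΨU _ h2).2, map_smul]
    exact h4 c
  · exact (hΨU _ (hball x hx t ht)).1
  · intro u hu
    obtain ⟨u', hu', h⟩ := hP x hx.1 t (hball x hx t ht) u hu
    refine ⟨u', hu', fun w => (h w).trans ?_⟩
    have h2 := hball x hx t ht
    have h3 := (hψ.contMDiffAt (hU.mem_nhds hx.1)).mdifferentiableAt
      (by simp : (∞ : WithTop ℕ∞) ≠ 0)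
    have h5 : MDifferentiableAt 𝓘(ℝ, V) 𝓘(ℝ, V) (fun v : V => v + t • k) (ψ x) := by
      apply DifferentiableAt.mdifferentiableAt
      fun_prop
    have h6 : md V V (fun v : V => v + t • k) (ψ x) = ContinuousLinearMap.id ℝ V := by
      rw [md_eq_fderiv, fderiv_add_const]
      exact fderiv_fun_id
    have h7 : ∀ w' : V, md V V (fun y => ψ y + t • k) x w' = md V V ψ x w' := fun w' => by
      rw [md_comp_apply (E := V) (E' := V) (E'' := V) (g := fun v : V => v + t • k) (f := ψ) x
        h5 h3, h6]
      rfl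
    have h8 := md_comp_apply (E := V) (E' := V) (E'' := V) (g := Ψ) (f := fun y => ψ y + t • k) x
      ((hΨ _ h2).mdifferentiableAt (by simp))
      (MDifferentiableAt.comp x (g := fun v : V => v + t • k) h5 h3) (u w)
    exact (congrArg (md V V Ψ (ψ x + t • k)) (h7 (u w))).symm.trans h8.symm

end CoordinateFlow

/-! ### Conserved quantities along the null curve -/

section Transport

variable {m : ℕ}

/-- `N` and `N'` are the matrices of the coordinate derivative in translated frames at two points of
one coordinate line, so `N' ∘ N⁻¹` is the matrix of the coordinate translation between them. -/
theorem isGN_of_transport {N N' : Mink m ≃L[ℝ] Mink m} {r r' : ℝ} (hr : r ≠ 0)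
    (hN : N (kvec m) = r • kvec m) (hN' : N' (kvec m) = r' • kvec m)
    (h₁ : ∀ a, r' * eta (kvec m) (N' a) = r * eta (kvec m) (N a))
    (h₂ : ∀ a b, eta (kvec m) (N a) = 0 → eta (kvec m) (N b) = 0 →
      eta (N' a) (N' b) = eta (N a) (N b)) : N.symm.trans N' ∈ GN m := by
  have hk : N' (N.symm (kvec m)) = (r' / r) • kvec m := by
    have : N.symm (kvec m) = r⁻¹ • kvec m := by
      rw [N.symm_apply_eq, map_smul, hN, smul_smul, inv_mul_cancel₀ hr, one_smul]
    rw [this, map_smul, hN', smul_smul, div_eq_inv_mul]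
  refine ⟨?_, fun w w' hw hw' => ?_, fun z => ?_⟩
  · change N' (N.symm (kvec m)) ∈ _
    rw [hk]
    exact Submodule.smul_mem _ _ (Submodule.mem_span_singleton_self _)
  · have h := h₂ (N.symm w) (N.symm w') (by simpa using hw) (by simpa using hw')
    simpa using h
  · change eta (N' (N.symm (kvec m))) (N' (N.symm z)) = _
    have h := h₁ (N.symm z)
    rw [N.apply_symm_apply] at h
    rw [hk, eta_smul_left, div_mul_eq_mul_div, h, mul_div_cancel_left₀ _ hr]

theorem eq_of_hasDerivAt_zero {f : ℝ → ℝ} {δ : ℝ} (h : ∀ s, |s| < δ → HasDerivAt f 0 s) {s s' : ℝ}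
    (hs : |s| < δ) (hs' : |s'| < δ) : f s = f s' := by
  have hm : ∀ s, s ∈ Metric.ball (0 : ℝ) δ → |s| < δ := fun s hs => by simpa using hs
  refine Metric.isOpen_ball.is_const_of_deriv_eq_zero
    (convex_ball (0 : ℝ) δ).isPreconnected
    (fun s hs => (h s (hm s hs)).differentiableAt.differentiableWithinAt)
    (fun s hs => (h s (hm s hs)).deriv) ?_ ?_ <;> simpa

variable {E : Type*} [NormedAddCommGroup E] [NormedSpace ℝ E] [FiniteDimensional ℝ E]
  {K : Type*} [TopologicalSpace K] [ChartedSpace E K] [Group K] [LieGroup 𝓘(ℝ, E) ∞ K]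
  {B : E →L[ℝ] Mink m} {A : E} {κ : ℝ} {ρ : ℝ → ℝ} {δ : ℝ} {c d : ℝ → E} {a b : ℝ}

/-- The factor `η(k, Bc)` has logarithmic derivative `-κρ`, and `ρ' = κρ²` gives `ρ` the opposite
one. The `A`-term drops out since `η(k, k) = 0`. -/
theorem eta_kvec_transport (hA : B A = kvec m)
    (hκ : ∀ z, eta (kvec m) (B (brk K A z)) = κ * eta (kvec m) (B z))
    (hρ : ∀ s, |s| < δ → HasDerivAt ρ (κ * ρ s ^ 2) s)
    (hc : ∀ s, |s| < δ → HasDerivAt c (-(ρ s • brk K A (c s)) + (a * (κ * ρ s ^ 2)) • A) s)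
    {s s' : ℝ} (hs : |s| < δ) (hs' : |s'| < δ) :
    ρ s * eta (kvec m) (B (c s)) = ρ s' * eta (kvec m) (B (c s')) := by
  refine eq_of_hasDerivAt_zero (f := fun s => ρ s * eta (kvec m) (B (c s))) (fun s hs => ?_) hs hs'
  have h1 : HasDerivAt (fun s => eta (kvec m) (B (c s)))
      (eta (kvec m) (B (-(ρ s • brk K A (c s)) + (a * (κ * ρ s ^ 2)) • A))) s :=
    (etaL m (kvec m) ∘L B).hasFDerivAt.comp_hasDerivAt s (hc s hs)
  refine ((hρ s hs).mul h1).congr_deriv ?_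
  have hk : eta (kvec m) (kvec m) = 0 := by rw [eta_kvec_left]; simp [kvec]
  rw [map_add, map_neg, map_smul, map_smul, eta_add_right, eta_neg_right, eta_smul_right,
    eta_smul_right, hA, hκ, hk]
  ring

/-- By `eta_kvec_transport` both curves remain in `𝔟`. There the brackets cancel by skewness, and
the `A`-terms pair `k` with `k^⊥`. -/
theorem eta_transport (hA : B A = kvec m)
    (hκ : ∀ z, eta (kvec m) (B (brk K A z)) = κ * eta (kvec m) (B z))
    (hS : ∀ x y, eta (kvec m) (B x) = 0 → eta (kvec m) (B y) = 0 →
      eta (B (brk K A x)) (B y) + eta (B x) (B (brk K A y)) = 0)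
    (hρ : ∀ s, |s| < δ → HasDerivAt ρ (κ * ρ s ^ 2) s) (hρ0 : ∀ s, |s| < δ → ρ s ≠ 0)
    (hc : ∀ s, |s| < δ → HasDerivAt c (-(ρ s • brk K A (c s)) + (a * (κ * ρ s ^ 2)) • A) s)
    (hd : ∀ s, |s| < δ → HasDerivAt d (-(ρ s • brk K A (d s)) + (b * (κ * ρ s ^ 2)) • A) s)
    {s s' : ℝ} (hs : |s| < δ) (hs' : |s'| < δ) (hcs : eta (kvec m) (B (c s)) = 0)
    (hds : eta (kvec m) (B (d s)) = 0) :
    eta (B (c s)) (B (d s)) = eta (B (c s')) (B (d s')) := by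
  refine eq_of_hasDerivAt_zero (f := fun s => eta (B (c s)) (B (d s))) (fun r hr => ?_) hs hs'
  have hcr : eta (kvec m) (B (c r)) = 0 := by
    have := eta_kvec_transport hA hκ hρ hc hs hr
    rw [hcs, mul_zero] at this
    exact (mul_eq_zero.1 this.symm).resolve_left (hρ0 r hr)
  have hdr : eta (kvec m) (B (d r)) = 0 := by
    have := eta_kvec_transport hA hκ hρ hd hs hr
    rw [hds, mul_zero] at this
    exact (mul_eq_zero.1 this.symm).resolve_left (hρ0 r hr)
  have h1 : HasDerivAt (fun s => eta (B (c s)) (B (d s)))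
      (eta (B (-(ρ r • brk K A (c r)) + (a * (κ * ρ r ^ 2)) • A)) (B (d r)) +
        eta (B (c r)) (B (-(ρ r • brk K A (d r)) + (b * (κ * ρ r ^ 2)) • A))) r :=
    ((etaL m ∘L B).hasFDerivAt.comp_hasDerivAt r (hc r hr)).clm_apply
      (B.hasFDerivAt.comp_hasDerivAt r (hd r hr))
  refine h1.congr_deriv ?_
  have h2 := hS _ _ hcr hdr
  rw [map_add, map_add, map_neg, map_neg, map_smul, map_smul, map_smul, map_smul, eta_add_left,
    eta_add_right, eta_neg_left, eta_neg_right, eta_smul_left, eta_smul_left, eta_smul_right,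
    eta_smul_right, hA, hdr, eta_comm _ (kvec m), hcr]
  linear_combination -(ρ r) * h2

end Transport

/-! ### Coordinates adapted to the null line -/

section Construction

variable {E : Type*} [NormedAddCommGroup E] [NormedSpace ℝ E] [FiniteDimensional ℝ E]
  {K : Type*} [TopologicalSpace K] [ChartedSpace E K] [Group K] [LieGroup 𝓘(ℝ, E) ∞ K]

/-- `md_adInv` composed with a curve of velocity `ρ A`. -/
theorem hasDerivAt_adInv_comp {q : ℝ → K} {s ρ : ℝ} {A : E}
    (hq : MDifferentiableAt 𝓘(ℝ, ℝ) 𝓘(ℝ, E) q s) (hq' : md ℝ E q s 1 = Lm E (q s) (ρ • A)) (z : E) :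
    HasDerivAt (fun t => adInv E (q t) z) (-(ρ • brk K A (adInv E (q s) z))) s := by
  have h1 := (contMDiff_adInv (K := K) z).mdifferentiableAt (by simp) (x := q s)
  have h2 := md_comp_apply (E := ℝ) (E' := E) (E'' := E) (g := fun k : K => adInv E k z) (f := q)
    s h1 hq 1
  rw [hq', md_adInv, brk_smul_left, md_eq_fderiv] at h2
  have h3 : DifferentiableAt ℝ (fun t => adInv E (q t) z) s :=
    mdifferentiableAt_iff_differentiableAt.1
      (MDifferentiableAt.comp s (g := fun k : K => adInv E k z) h1 hq)
  exact h3.hasDerivAt.congr_deriv ((fderiv_apply_one_eq_deriv).symm.trans h2)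

theorem brk_self (A : E) : brk K A A = 0 := by
  have : LieGroup 𝓘(ℝ, E) (minSmoothness ℝ 3) K := by
    simpa using (inferInstance : LieGroup 𝓘(ℝ, E) 3 K)
  have : CompleteSpace E := FiniteDimensional.complete ℝ E
  exact lie_self (L := LieAlg E K) A

/-- Coordinates on `K` along the translates of a slice by a curve `q`: the lift of the coordinates
on `K ⧸ H` adapted to the null line. -/
theorem exists_adapted_coordinates {m : ℕ} {B : E →L[ℝ] Mink m} (hB : Function.Surjective B)
    {A : E} (hA : B A = kvec m) {κ : ℝ} (g : K) :
    ∃ (δ : ℝ) (p : Mink m → K) (ξ : Mink m → Mink m → E) (ρ : ℝ → ℝ), 0 < δ ∧ p 0 = g ∧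
      (∀ v ∈ Metric.ball 0 δ, ContMDiffAt 𝓘(ℝ, Mink m) 𝓘(ℝ, E) ∞ p v ∧
        ∀ w, md (Mink m) E p v w = Lm E (p v) (ξ v w)) ∧
      (∀ w, B (ξ 0 w) = w) ∧ (∀ v ∈ Metric.ball 0 δ, ξ v (kvec m) = ρ (v 0) • A) ∧
      (∀ s, |s| < δ → ρ s ≠ 0 ∧ HasDerivAt ρ (κ * ρ s ^ 2) s) ∧
      ∀ v w, ∃ (c : ℝ → E) (a : ℝ), (∀ t, ξ (v + t • kvec m) w = c (v 0 + t)) ∧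
        ∀ s, |s| < δ →
          HasDerivAt c (-(ρ s • brk K A (c s)) + (a * (κ * ρ s ^ 2)) • A) s := by
  obtain ⟨q, ρ, δ₁, hδ₁, hq0, hρ0, hq⟩ := exists_reparametrized_integralCurve (K := K) A κ
  obtain ⟨J, hJ⟩ := (B : E →ₗ[ℝ] Mink m).exists_rightInverse_of_surjective
    (LinearMap.range_eq_top.2 hB)
  have hJ' : ∀ w, B (J w) = w := fun w => LinearMap.congr_fun hJ w
  obtain ⟨h, δ₂, hδ₂, h0, hdh, hh⟩ := exists_map_md_eq g (Lm E g ∘L J.toContinuousLinearMap)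
  let x₀ : Mink m →L[ℝ] ℝ := EuclideanSpace.proj 0
  have hx₀ : ∀ v, x₀ v = v 0 := fun v => rfl
  have hx₀k : x₀ (kvec m) = 1 := by simp [hx₀, kvec]
  -- The projection along `k` onto the slice: the coordinates are `v ↦ h(pr v) q(v₀)`, and moving
  -- along `k` changes only the factor `q`.
  let pr : Mink m →L[ℝ] Mink m := ContinuousLinearMap.id ℝ (Mink m) - x₀.smulRight (kvec m)
  have hpr : ∀ v, pr v = v - v 0 • kvec m := fun v => rfl
  have hprk : pr (kvec m) = 0 := by
    have : pr (kvec m) = kvec m - x₀ (kvec m) • kvec m := rfl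
    rw [this, hx₀k, one_smul, sub_self]
  obtain ⟨δ₃, hδ₃, hδ⟩ := Metric.eventually_nhds_iff_ball.1
    (((pr.continuous.tendsto' 0 0 (map_zero _)).eventually (Metric.ball_mem_nhds 0 hδ₂)).and
      ((x₀.continuous.tendsto' 0 0 (map_zero _)).eventually (Metric.ball_mem_nhds 0 hδ₁)))
  let δ := min δ₁ δ₃
  have hδ' : ∀ v ∈ Metric.ball (0 : Mink m) δ, pr v ∈ Metric.ball 0 δ₂ ∧ |x₀ v| < δ₁ :=
      fun v hv => by
    have := hδ v (Metric.ball_subset_ball (min_le_right _ _) hv)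
    exact ⟨this.1, by simpa using this.2⟩
  let ζ : Mink m → Mink m → E := fun c w =>
    md E E (fun k : K => (h c)⁻¹ * k) (h c) (md (Mink m) E h c w)
  have hζ : ∀ c w, md (Mink m) E h c w = Lm E (h c) (ζ c w) := fun c w => (Lm_md_inv_mul _ _).symm
  have hζ0 : ∀ w, ζ 0 w = J w := fun w => by
    simp only [ζ, h0, hdh]
    exact md_inv_mul_Lm g (J w)
  have hζk : ∀ c, ζ c (pr (kvec m)) = 0 := fun c => by simp only [ζ, hprk, map_zero]
  -- The left logarithmic derivative given by `md_mul_Lm`. Along `k` it evolves by `c' = -ρ[A, c] +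
  -- w₀ ρ' A`; the `A`-part contributes nothing to the bracket because `[A, A] = 0`.
  let ξ : Mink m → Mink m → E := fun v w =>
    adInv E (q (x₀ v)) (ζ (pr v) (pr w)) + (x₀ w * ρ (x₀ v)) • A
  refine ⟨δ, fun v => h (pr v) * q (x₀ v), ξ, ρ, lt_min hδ₁ hδ₃, ?_, fun v hv => ?_, fun w => ?_,
    fun v hv => ?_, fun s hs => ?_, fun v w => ?_⟩
  · simp [h0, hq0]
  · obtain ⟨hv1, hv2⟩ := hδ' v hv
    obtain ⟨hqs, hqd, -⟩ := hq _ hv2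
    have hp : ContMDiffAt 𝓘(ℝ, Mink m) 𝓘(ℝ, E) ∞ (fun v => h (pr v)) v :=
      (hh _ hv1).comp v pr.contDiff.contMDiff.contMDiffAt
    have hr : ContMDiffAt 𝓘(ℝ, Mink m) 𝓘(ℝ, E) ∞ (fun v => q (x₀ v)) v :=
      ContMDiffAt.comp v hqs x₀.contDiff.contMDiff.contMDiffAt
    refine ⟨hp.mul hr, fun w => md_mul_Lm (hp.mdifferentiableAt (by simp))
      (hr.mdifferentiableAt (by simp)) ?_ ?_⟩
    · rw [← hζ]
      have h1 := md_comp_apply (E := Mink m) (E' := Mink m) (E'' := E) (g := h) (f := pr) v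
        ((hh _ hv1).mdifferentiableAt (by simp)) pr.differentiableAt.mdifferentiableAt w
      rwa [md_eq_fderiv, pr.fderiv] at h1
    · have h1 := md_comp_apply (E := Mink m) (E' := ℝ) (E'' := E) (g := q) (f := x₀) v
        (hqs.mdifferentiableAt (by simp)) x₀.differentiableAt.mdifferentiableAt w
      rw [md_eq_fderiv, x₀.fderiv] at h1
      have h2 : x₀ w = x₀ w • (1 : ℝ) := by simp
      rw [h2, map_smul, hqd] at h1
      rw [mul_smul, map_smul]
      exact h1
  · have h1 : ξ 0 w = J (pr w) + x₀ w • A := by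
      simp only [ξ, map_zero, hζ0, hq0, hρ0, mul_one]
      congr 1
      have := Lm_adInv (1 : K) (J (pr w))
      simp only [Lm_one, mul_one, md_id] at this
      exact this
    rw [h1, map_add, map_smul, hJ', hA, hpr, hx₀, sub_add_cancel]
  · simp only [ξ, hζk, map_zero, zero_add, hx₀k, one_mul]
    rfl
  · obtain ⟨-, -, h1, h2⟩ := hq s (hs.trans_le (min_le_left _ _))
    exact ⟨h2, h1⟩
  · refine ⟨fun s => adInv E (q s) (ζ (pr v) (pr w)) + (x₀ w * ρ s) • A, x₀ w, fun t => ?_,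
      fun s hs => ?_⟩
    · have h1 : x₀ (v + t • kvec m) = v 0 + t := by
        rw [map_add, map_smul, hx₀k, smul_eq_mul, mul_one, hx₀]
      have h2 : pr (v + t • kvec m) = pr v := by
        rw [map_add, map_smul, hprk, smul_zero, add_zero]
      simp only [ξ, h1, h2]
    · obtain ⟨h1, h2, h3, -⟩ := hq s (hs.trans_le (min_le_left _ _))
      refine ((hasDerivAt_adInv_comp (h1.mdifferentiableAt (by simp)) h2 _).add
        ((h3.const_mul (x₀ w)).smul_const A)).congr_deriv ?_
      rw [← adL_apply, ← adL_apply, map_add, map_smul, adL_apply A A]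
      have h4 : brk K A A = 0 := brk_self A
      rw [h4, smul_zero, add_zero]

end Construction

/-! ### The Kundt condition for invariant structures -/

section Characterization

variable {E : Type*} [NormedAddCommGroup E] [NormedSpace ℝ E] [FiniteDimensional ℝ E]
  {K : Type*} [TopologicalSpace K] [ChartedSpace E K] [Group K] [LieGroup 𝓘(ℝ, E) ∞ K]
  {H : Subgroup K} {m : ℕ} [ChartedSpace (Mink m) (K ⧸ H)]
  [IsManifold 𝓘(ℝ, Mink m) ∞ (K ⧸ H)] {u₀ : Mink m ≃L[ℝ] Mink m}
  {P : GStructure (GN m) (K ⧸ H)}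

/-- An operator preserving the hyperplane `𝔟` acts on the line `𝔨/𝔟` by a scalar. -/
theorem exists_eta_kvec_brk
    (hπ : Manifold.IsSubmersion 𝓘(ℝ, E) 𝓘(ℝ, Mink m) ∞ (fun x : K => (x : K ⧸ H))) {A : E}
    (hA : ∀ z : E, eta (kvec m) (coB E H u₀ z) = 0 →
      eta (kvec m) (coB E H u₀ (brk K A z)) = 0) :
    ∃ κ : ℝ, ∀ z, eta (kvec m) (coB E H u₀ (brk K A z)) = κ * eta (kvec m) (coB E H u₀ z) := by
  let l : E →L[ℝ] ℝ := etaL m (kvec m) ∘L coB E H u₀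
  have hl : ∀ z, l z = eta (kvec m) (coB E H u₀ z) := fun z => rfl
  obtain ⟨z₀, hz₀⟩ := coB_surjective (u₀ := u₀) hπ (EuclideanSpace.single 1 1)
  have hlz : l z₀ = 1 := by rw [hl, hz₀, eta_kvec_left]; simp
  refine ⟨l (brk K A z₀), fun z => ?_⟩
  have h1 := hA (z - l z • z₀) (by
    rw [← hl, map_sub, map_smul, hlz, smul_eq_mul, mul_one, sub_self])
  rw [← hl, ← adL_apply, map_sub, map_smul, map_sub, map_smul, adL_apply, adL_apply, smul_eq_mul,
    sub_eq_zero] at h1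
  rw [← hl, ← hl, h1, mul_comm]

/-- The frame `frm H u₀ g` as a linear isomorphism. -/
def frmEquiv
    (hπ : Manifold.IsSubmersion 𝓘(ℝ, E) 𝓘(ℝ, Mink m) ∞ (fun x : K => (x : K ⧸ H)))
    (u₀ : Mink m ≃L[ℝ] Mink m) (g : K) : Mink m ≃L[ℝ] Mink m :=
  have := contMDiffSMul_quotient hπ
  ContinuousLinearEquiv.equivOfInverse (frm H u₀ g) (cof H u₀ g) (cof_frm (E := E) g)
    (frm_cof (E := E) g)

theorem mem_nullLine_of_eq
    (hπ : Manifold.IsSubmersion 𝓘(ℝ, E) 𝓘(ℝ, Mink m) ∞ (fun x : K => (x : K ⧸ H)))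
    (hP : IsInvariantStructure P) (hu₀ : u₀ ∈ P.frames ((1 : K) : K ⧸ H)) {g : K} {y : K ⧸ H}
    (hy : (g : K ⧸ H) = y) (r : ℝ) :
    (frm H u₀ g (r • kvec m) : TangentSpace 𝓘(ℝ, Mink m) y) ∈ nullLine P y := by
  have := contMDiffSMul_quotient hπ
  subst hy
  refine (mem_nullLine_mk_iff hπ hP hu₀ g _).2 ?_
  rw [cof_frm (E := E)]
  exact Submodule.smul_mem _ _ (Submodule.mem_span_singleton_self _)

/-- The field is the coordinate field along `k` in the coordinates of `exists_adapted_coordinates`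
projected to `K/H`. Since `ξ(k) = ρ A` and `B A = k`, it is null and nonzero. Its flow acts on
translated frames by `N' ∘ N⁻¹`, which lies in `GN` by the two transport lemmas. -/
theorem exists_infinitesimalAut
    (hπ : Manifold.IsSubmersion 𝓘(ℝ, E) 𝓘(ℝ, Mink m) ∞ (fun x : K => (x : K ⧸ H)))
    (hP : IsInvariantStructure P) (hu₀ : u₀ ∈ P.frames ((1 : K) : K ⧸ H)) {A : E}
    (hA : coB E H u₀ A = kvec m) {κ : ℝ}
    (hκ : ∀ z, eta (kvec m) (coB E H u₀ (brk K A z)) = κ * eta (kvec m) (coB E H u₀ z))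
    (hS : ∀ x y : E, eta (kvec m) (coB E H u₀ x) = 0 → eta (kvec m) (coB E H u₀ y) = 0 →
      eta (coB E H u₀ (brk K A x)) (coB E H u₀ y) +
        eta (coB E H u₀ x) (coB E H u₀ (brk K A y)) = 0) (o : K ⧸ H) :
    ∃ U : Set (K ⧸ H), IsOpen U ∧ o ∈ U ∧ ∃ X : ∀ y : K ⧸ H, TangentSpace 𝓘(ℝ, Mink m) y,
      ContMDiffOn 𝓘(ℝ, Mink m) 𝓘(ℝ, Mink m).tangent ∞
        (fun y => (⟨y, X y⟩ : TangentBundle 𝓘(ℝ, Mink m) (K ⧸ H))) U ∧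
      (∀ y ∈ U, X y ∈ nullLine P y ∧ X y ≠ 0) ∧ P.IsInfinitesimalAutOn X U := by
  have := contMDiffSMul_quotient hπ
  obtain ⟨g, rfl⟩ := QuotientGroup.mk_surjective o
  obtain ⟨δ, p, ξ, ρ, hδ, hp0, hp, hξ0, hξk, hρ, hξ⟩ :=
    exists_adapted_coordinates (K := K) (coB_surjective (u₀ := u₀) hπ) hA (κ := κ) g
  let Ψ : Mink m → K ⧸ H := fun v => (p v : K ⧸ H)
  have hΨ : ∀ v ∈ Metric.ball (0 : Mink m) δ, ContMDiffAt 𝓘(ℝ, Mink m) 𝓘(ℝ, Mink m) ∞ Ψ v :=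
    fun v hv =>
    (hπ.contMDiff.contMDiffAt).comp v (hp v hv).1
  have hdΨ : ∀ v ∈ Metric.ball (0 : Mink m) δ, ∀ w,
      md (Mink m) (Mink m) Ψ v w = frm H u₀ (p v) (coB E H u₀ (ξ v w)) := fun v hv w => by
    have h1 := md_comp_apply (E := Mink m) (E' := E) (E'' := Mink m)
      (g := fun k : K => (k : K ⧸ H)) (f := p) v (hπ.contMDiff.mdifferentiableAt (by simp)) ((hp v hv).1.mdifferentiableAt (by simp)) w
    rw [(hp v hv).2, md_mk_Lm (u₀ := u₀) hπ] at h1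
    exact h1
  have hΨ0 : md (Mink m) (Mink m) Ψ 0 = (frmEquiv hπ u₀ g : Mink m →L[ℝ] Mink m) := by
    refine ContinuousLinearMap.ext fun w => ?_
    rw [hdΨ 0 (Metric.mem_ball_self hδ), hξ0, hp0]
    rfl
  obtain ⟨R, hR, hRδ, U, hU, ψ, hψ, hψU, hΨU⟩ := exists_localInverse hδ hΨ hΨ0
  have hb : ∀ v ∈ Metric.ball (0 : Mink m) R, v ∈ Metric.ball (0 : Mink m) δ := fun v hv =>
    Metric.ball_subset_ball hRδ hv
  have hv0 : ∀ v ∈ Metric.ball (0 : Mink m) δ, |v 0| < δ := fun v hv =>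
    lt_of_le_of_lt (PiLp.norm_apply_le v 0) (by simpa using hv)
  have hψΨ : ∀ v ∈ Metric.ball (0 : Mink m) R, ∀ w,
      md (Mink m) (Mink m) ψ (Ψ v) (md (Mink m) (Mink m) Ψ v w) = w := by
    intro v hv w
    have h1 := md_comp_apply (E := Mink m) (E' := Mink m) (E'' := Mink m) (g := ψ) (f := Ψ) v
      ((hψ.contMDiffAt (hU.mem_nhds (hΨU v hv).1)).mdifferentiableAt (by simp))
      ((hΨ v (hb v hv)).mdifferentiableAt (by simp)) w
    rw [← h1, md_congr (g := fun y => y), md_id]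
    · rfl
    · filter_upwards [Metric.isOpen_ball.mem_nhds hv] with z hz using (hΨU z hz).2
  -- The matrix of `dΨ` in the translated frame is injective because `dψ` inverts `dΨ`, hence
  -- bijective by dimension.
  have hN : ∀ v ∈ Metric.ball (0 : Mink m) R, ∃ N : Mink m ≃L[ℝ] Mink m,
      ∀ a, N a = coB E H u₀ (ξ v a) := by
    intro v hv
    have hinj : Function.Injective
        (cof H u₀ (p v) ∘L md (Mink m) (Mink m) Ψ v : Mink m →ₗ[ℝ] Mink m) := by
      intro a b hab
      have h1 : ∀ a, (cof H u₀ (p v) ∘L md (Mink m) (Mink m) Ψ v : Mink m →ₗ[ℝ] Mink m) a =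
        cof H u₀ (p v) (md (Mink m) (Mink m) Ψ v a) := fun _ => rfl
      rw [h1, h1] at hab
      have h2 := congrArg (frm H u₀ (p v)) hab
      rw [frm_cof (E := E), frm_cof (E := E)] at h2
      rw [← hψΨ v hv a, h2, hψΨ v hv b]
    refine ⟨(LinearEquiv.ofInjectiveEndo _ hinj).toContinuousLinearEquiv, fun a => ?_⟩
    exact (congrArg (cof H u₀ (p v)) (hdΨ v (hb v hv) a)).trans (cof_frm (E := E) _ _)
  have hXk : ∀ v ∈ Metric.ball (0 : Mink m) R,
      md (Mink m) (Mink m) Ψ v (kvec m) = frm H u₀ (p v) (ρ (v 0) • kvec m) := fun v hv => by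
    rw [hdΨ v (hb v hv), hξk v (hb v hv), map_smul (coB E H u₀), hA]
  refine ⟨U, hU, ?_, fun y => md (Mink m) (Mink m) Ψ (ψ y) (kvec m),
    contMDiffOn_coordinateField (fun v hv => hΨ v (hb v hv)) hU hψ hψU _, fun y hy => ⟨?_, ?_⟩,
    isInfinitesimalAutOn_coordinateField (fun v hv => hΨ v (hb v hv)) hU hψ hψU hΨU _ ?_⟩
  · have h1 := (hΨU 0 (Metric.mem_ball_self hR)).1
    have h2 : Ψ 0 = (g : K ⧸ H) := congrArg (fun k : K => (k : K ⧸ H)) hp0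
    rwa [h2] at h1
  · have h1 := mem_nullLine_of_eq hπ hP hu₀ (g := p (ψ y)) (hψU y hy).2 (ρ (ψ y 0))
    have h2 := hXk _ (hψU y hy).1
    exact (congrArg (fun w : Mink m => (w : TangentSpace 𝓘(ℝ, Mink m) y) ∈ nullLine P y) h2).mpr h1
  · intro h1
    have h2 := hXk _ (hψU y hy).1
    have h3 : cof H u₀ (p (ψ y)) (md (Mink m) (Mink m) Ψ (ψ y) (kvec m)) = 0 :=
      (congrArg (cof H u₀ (p (ψ y))) h1).trans (map_zero _)
    rw [h2, cof_frm (E := E), smul_eq_zero] at h3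
    exact h3.elim (hρ _ (hv0 _ (hb _ (hψU y hy).1))).1 kvec_ne_zero
  · intro y hy t ht u hu
    have hv := (hψU y hy).1
    obtain ⟨n, hn, hnu⟩ := exists_GN_of_mem_frames hπ hP hu₀ (g := p (ψ y)) (hψU y hy).2 hu
    obtain ⟨N, hNξ⟩ := hN _ hv
    obtain ⟨N', hNξ'⟩ := hN _ ht
    have e0 : (ψ y + t • kvec m) 0 = ψ y 0 + t := by simp [kvec]
    have hs := hv0 _ (hb _ hv)
    have hs' : |ψ y 0 + t| < δ := by
      have := hv0 _ (hb _ ht)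
      rwa [e0] at this
    have hT : N.symm.trans N' ∈ GN m := by
      refine isGN_of_transport (r := ρ (ψ y 0)) (r' := ρ (ψ y 0 + t)) (hρ _ hs).1 ?_ ?_
        (fun a => ?_) (fun a b ha hb' => ?_)
      · rw [hNξ, hξk _ (hb _ hv), map_smul, hA]
      · rw [hNξ', hξk _ (hb _ ht), map_smul, hA, e0]
      · obtain ⟨c, r, hc, hcd⟩ := hξ (ψ y) a
        have hc0 : ξ (ψ y) a = c (ψ y 0) := by simpa using hc 0
        rw [hNξ, hNξ', hc, hc0]
        exact eta_kvec_transport hA hκ (fun s hs => (hρ s hs).2) hcd hs' hs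
      · obtain ⟨c, r, hc, hcd⟩ := hξ (ψ y) a
        obtain ⟨d, r', hd, hdd⟩ := hξ (ψ y) b
        have hc0 : ξ (ψ y) a = c (ψ y 0) := by simpa using hc 0
        have hd0 : ξ (ψ y) b = d (ψ y 0) := by simpa using hd 0
        rw [hNξ, hc0] at ha
        rw [hNξ, hd0] at hb'
        rw [hNξ, hNξ, hNξ', hNξ', hc, hc0, hd, hd0]
        exact (eta_transport hA hκ hS (fun s hs => (hρ s hs).2) (fun s hs => (hρ s hs).1) hcd hdd
          hs hs' ha hb').symm
    refine ⟨(n.trans (N.symm.trans N')).trans (frmEquiv hπ u₀ (p (ψ y + t • kvec m))), ?_,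
      fun w => ?_⟩
    · exact (frames_mk_iff hπ hP hu₀ (p (ψ y + t • kvec m)) _).2
        ⟨n.trans (N.symm.trans N'), (GN m).mul_mem hT hn, fun v => rfl⟩
    · have h1 : ∀ w' : Mink m, w' = frm H u₀ (p (ψ y)) (n w) →
          frm H u₀ (p (ψ y + t • kvec m)) (N' (N.symm (n w))) =
            md (Mink m) (Mink m) Ψ (ψ y + t • kvec m) (md (Mink m) (Mink m) ψ y w') := by
        rintro _ rfl
        have h2 : frm H u₀ (p (ψ y)) (n w) = md (Mink m) (Mink m) Ψ (ψ y) (N.symm (n w)) := by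
          rw [hdΨ _ (hb _ hv), ← hNξ, N.apply_symm_apply]
        have h3 := hψΨ _ hv (N.symm (n w))
        rw [(hψU y hy).2] at h3
        rw [h2, h3, hdΨ _ (hb _ ht), ← hNξ']
      exact h1 (u w) (hnu w)

theorem isKundtStructure_iff
    (hπ : Manifold.IsSubmersion 𝓘(ℝ, E) 𝓘(ℝ, Mink m) ∞ (fun x : K => (x : K ⧸ H)))
    (hP : IsInvariantStructure P) (hu₀ : u₀ ∈ P.frames ((1 : K) : K ⧸ H)) :
    IsKundtStructure P ↔
      (∀ x y : E, eta (kvec m) (coB E H u₀ x) = 0 → eta (kvec m) (coB E H u₀ y) = 0 →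
        eta (kvec m) (coB E H u₀ (brk K x y)) = 0) ∧
      ∀ A : E, coB E H u₀ A ∈ Submodule.span ℝ {kvec m} → ∀ x y : E,
        eta (kvec m) (coB E H u₀ x) = 0 → eta (kvec m) (coB E H u₀ y) = 0 →
        eta (coB E H u₀ (brk K A x)) (coB E H u₀ y) +
          eta (coB E H u₀ x) (coB E H u₀ (brk K A y)) = 0 := by
  have := contMDiffSMul_quotient hπ
  constructor
  · rintro ⟨hΛ, hX⟩
    refine ⟨(isIntegrableDistribution_nullPerp_iff hπ hP hu₀).1 hΛ, fun A hA x y hx hy => ?_⟩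
    obtain ⟨U, hU, ho, X, hXs, hXl, haut⟩ := hX ((1 : K) : K ⧸ H)
    obtain ⟨hl, hne⟩ := hXl _ ho
    let w : Mink m := cof H u₀ (1 : K) (X ((1 : K) : K ⧸ H))
    have hw : w ∈ Submodule.span ℝ {kvec m} := (mem_nullLine_mk_iff hπ hP hu₀ 1 _).1 hl
    have hw0 : w ≠ 0 := fun h => hne
      ((frm_cof (E := E) (H := H) (u₀ := u₀) (1 : K) _).symm.trans
        ((congrArg (frm H u₀ (1 : K)) h).trans (map_zero _)))
    obtain ⟨c, hc⟩ := Submodule.mem_span_singleton.1 hw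
    obtain ⟨a, ha⟩ := Submodule.mem_span_singleton.1 hA
    have hc0 : c ≠ 0 := by rintro rfl; exact hw0 (by rw [← hc, zero_smul])
    obtain ⟨A₀, hA₀⟩ := coB_surjective (u₀ := u₀) hπ w
    have hskew := fun (A : E) (hA : coB E H u₀ A = w) =>
      skew_of_infinitesimalAut hπ hP hu₀ hU ho hXs (fun y hy => (hXl y hy).1) haut hA hx hy
    have h1 := hskew A₀ hA₀
    -- With `B A = a k` and `w = c k`, both `A₀` and this vector are lifts of `w`. Skewness holds
    -- for every lift, and subtracting the two instances leaves it for `A` itself, including the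
    -- case `a = 0` of `A ∈ 𝔥`.
    have h2 := hskew (A + (1 - a / c) • A₀) (by
      rw [map_add, map_smul, hA₀, ← ha, ← hc, smul_smul, ← add_smul]
      congr 1
      field_simp
      ring)
    rw [brk_add_left, brk_add_left, brk_smul_left, brk_smul_left, map_add, map_add, map_smul,
      map_smul, eta_add_left, eta_add_right, eta_smul_left, eta_smul_right] at h2
    linear_combination h2 - (1 - a / c) * h1
  · rintro ⟨h1, h2⟩
    refine ⟨(isIntegrableDistribution_nullPerp_iff hπ hP hu₀).2 h1, fun o => ?_⟩
    obtain ⟨A, hA⟩ := coB_surjective (u₀ := u₀) hπ (kvec m)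
    have hk : eta (kvec m) (coB E H u₀ A) = 0 := by
      rw [hA, eta_kvec_left]; simp [kvec]
    obtain ⟨κ, hκ⟩ := exists_eta_kvec_brk hπ (fun z hz => h1 A z hk hz)
    exact exists_infinitesimalAut hπ hP hu₀ hA hκ
      (h2 A (by rw [hA]; exact Submodule.mem_span_singleton_self _)) o

end Characterization

end KundtHom

end

theorem mainTheorem1
    {E : Type*} [NormedAddCommGroup E] [NormedSpace ℝ E] [FiniteDimensional ℝ E]
    {K : Type*} [TopologicalSpace K] [ChartedSpace E K] [Group K] [LieGroup 𝓘(ℝ, E) ∞ K]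
    (H : Subgroup K) (_hH : IsClosed (H : Set K))
    (m : ℕ) [ChartedSpace (KundtHom.Mink m) (K ⧸ H)]
    [IsManifold 𝓘(ℝ, KundtHom.Mink m) ∞ (K ⧸ H)]
    (_hπ : Manifold.IsSubmersion 𝓘(ℝ, E) 𝓘(ℝ, KundtHom.Mink m) ∞ (fun x : K => (x : K ⧸ H))) :
    ∃ Φ : {P : KundtHom.GStructure (KundtHom.GN m) (K ⧸ H) // KundtHom.IsInvariantStructure P} ≃
        KundtHom.InvariantQuadruple E H,
      (∀ P Q, Φ P = Q ↔ KundtHom.Corresponds P.1 Q) ∧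
      ∀ P, KundtHom.IsKundtStructure P.1 ↔ (Φ P).IsKundt := by
  obtain ⟨Φ, hΦ⟩ := KundtHom.exists_equiv_quadruples (E := E) (H := H) (m := m) _hπ
  refine ⟨Φ, hΦ, fun P => ?_⟩
  obtain ⟨u₀, hu₀⟩ := KundtHom.exists_mem_frames P.1 ((1 : K) : K ⧸ H)
  -- The adapted map `frameMap E u₀` and `coB E H u₀` agree by unfolding, so what remains is to
  -- translate membership in `𝔞` and `𝔟`.
  have hB := KundtHom.Corresponds.adapted _hπ ((hΦ P (Φ P)).1 rfl) hu₀
  refine (KundtHom.isKundtStructure_iff (u₀ := u₀) _hπ P.2 hu₀).trans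
    (Iff.trans ?_ hB.isKundt_iff.symm)
  refine and_congr ⟨fun h x hx y hy => ?_, fun h x y hx hy => ?_⟩
    ⟨fun h A hA x hx y hy => ?_, fun h A hA x y hx hy => ?_⟩
  · exact (hB.b_iff _).2 (h x y ((hB.b_iff x).1 hx) ((hB.b_iff y).1 hy))
  · exact (hB.b_iff _).1 (h x ((hB.b_iff x).2 hx) y ((hB.b_iff y).2 hy))
  · exact h A ((hB.a_iff A).1 hA) x y ((hB.b_iff x).1 hx) ((hB.b_iff y).1 hy)
  · exact h A ((hB.a_iff A).2 hA) x ((hB.b_iff x).2 hx) y ((hB.b_iff y).2 hy)
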